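/- **Theorem 1.5.** Let $m\ge 0$, let $S\subset\mathbb R^3$ be a finite set of $k+1\ge 1$ points, and put $$\phi(x)=m+\sum_{p\in S}\frac{1}{2|x-p|}.$$ Let $X_{m,S}$ denote the complete hyperkähler $4$-manifold given by the Gibbons–Hawking ansatz with potential $\phi$: there is a smooth map $\pi:X_{m,S}\to\mathbb R^3$ (the hyperkähler moment map of a circle action whose orbits are the fibres of $\pi$) which is a principal circle bundle over $\mathbb R^3\setminus S$ carrying a connection form $\eta$ with $d\eta=-\ast d\phi$ and on which $g=\phi^{-1}\eta^2+\phi\,g_{\mathbb R^3}$, and which near the single point above each $p\in S$ is modelled on the radially extended Hopf fibration $\mathbb C^2\to\mathbb R^3$. For $m=0$ this is an ALE gravitational instanton of type $A_k$, for $m>0$ an ALF gravitational instanton of type $A_k$. A closed geodesic is *stable to second order* if its index is zero, i.e. if there is no non-zero space of normal vector fields along it on which $-J$ is negative definite, where $J(V)=\frac{D^2V}{dt^2}-\mathrm{Riem}(\dot\gamma,V)\dot\gamma$ is the Jacobi operator. It is *stable* if it is a local minimum of the length functional on the space of smooth closed curves with the $C^1$ topology. There are infinitely many $k\in\mathbb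 N$ such that $k+1$ is a sum of (not necessarily distinct) elements of $\{4,6,8,12,20\}$, the numbers of vertices of the Platonic solids. For each such $k$: 1. there are $c\in\mathbb R^3$ and a set $S\subset\mathbb R^3$ of $k+1$ points which is the disjoint union of the vertex sets of finitely many Platonic solids with common centre $c$; 2. for every such $c$ and $S$ and every $m\ge 0$, the potential $\phi$ is smooth near $c$ with $\nabla\phi(c)=0$ and $\nabla^2\phi(c)=0$, and the circle $\pi^{-1}(c)$ in the gravitational instanton $X_{m,S}$ (of type $A_k$; ALE if $m=0$, ALF if $m>0$) is a closed geodesic that is stable to second order but not stable. -/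

import Mathlib

open scoped Manifold Bundle ContDiff Topology

/-- Euclidean three-space, the base of the Gibbons-Hawking fibration. -/
abbrev E3 : Type := EuclideanSpace ℝ (Fin 3)

/-- Euclidean four-space, the model space of the four-manifolds. -/
abbrev E4 : Type := EuclideanSpace ℝ (Fin 4)

/-- The (boundaryless) model with corners of a real four-manifold. -/
noncomputable abbrev I4 : ModelWithCorners ℝ E4 E4 := modelWithCornersSelf ℝ E4

/-- The `i`-th coordinate vector of `ℝ⁴`. -/
noncomputable def coordBasis (i : Fin 4) : E4 := EuclideanSpace.single i 1

/-- The partial derivative `∂_i f` of a function on `ℝ⁴`. -/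
noncomputable def pd (i : Fin 4) (f : E4 → ℝ) (y : E4) : ℝ := fderiv ℝ f y (coordBasis i)

section Riemannian

variable {X : Type} [TopologicalSpace X] [ChartedSpace E4 X]

/-- Smooth Riemannian metrics on a four-manifold. -/
abbrev Metric4 (X : Type) [TopologicalSpace X] [ChartedSpace E4 X] [IsManifold I4 ∞ X] : Type :=
  Bundle.ContMDiffRiemannianMetric I4 ∞ E4 (fun x : X => TangentSpace I4 x)

/-- The differential at `q` of the preferred chart around `p`. -/
noncomputable def chartDeriv (p q : X) : TangentSpace I4 q →L[ℝ] E4 :=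
  mfderiv I4 (modelWithCornersSelf ℝ E4) (extChartAt I4 p) q

/-- The differential at `y` of the inverse of the preferred chart around `p`. -/
noncomputable def chartSymmDeriv (p : X) (y : E4) :
    E4 →L[ℝ] TangentSpace I4 ((extChartAt I4 p).symm y) :=
  mfderiv (modelWithCornersSelf ℝ E4) I4 (extChartAt I4 p).symm y

/-- The coordinate components of a tangent vector at `p` in the preferred chart around `p`.
(In Mathlib `TangentSpace I4 p` is by definition the model space `E4`, through that chart.) -/
def toCoords {p : X} (u : TangentSpace I4 p) : E4 := u

/-- The tangent vector at `p` with given components in the preferred chart around `p`. -/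
def ofCoords (p : X) (u : E4) : TangentSpace I4 p := u

/-- The velocity of a curve. -/
noncomputable def velocity (γ : ℝ → X) (t : ℝ) : TangentSpace I4 (γ t) :=
  mfderiv (modelWithCornersSelf ℝ ℝ) I4 γ t (1 : ℝ)

variable [IsManifold I4 ∞ X]

/-- The matrix `g_ij` of the metric in the preferred chart around `p`. -/
noncomputable def metricMatrix (g : Metric4 X) (p : X) (y : E4) : Matrix (Fin 4) (Fin 4) ℝ :=
  Matrix.of fun i j => g.inner ((extChartAt I4 p).symm y)
    (chartSymmDeriv p y (coordBasis i)) (chartSymmDeriv p y (coordBasis j))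

/-- The Christoffel symbol `Γ^k_ij` of the Levi-Civita connection in the preferred chart
around `p`. -/
noncomputable def christoffel (g : Metric4 X) (p : X) (k i j : Fin 4) (y : E4) : ℝ :=
  (1 / 2) * ∑ l : Fin 4, (metricMatrix g p y)⁻¹ k l *
    (pd i (fun z => metricMatrix g p z j l) y + pd j (fun z => metricMatrix g p z i l) y
      - pd l (fun z => metricMatrix g p z i j) y)

/-- The components of the curvature tensor in the preferred chart around `p`:
`R(∂_i, ∂_j) ∂_k = ∑ l, riemannComponent g p l i j k • ∂_l`, where
`R(u, v) w = ∇_u ∇_v w - ∇_v ∇_u w - ∇_[u, v] w`. -/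
noncomputable def riemannComponent (g : Metric4 X) (p : X) (l i j k : Fin 4) (y : E4) : ℝ :=
  pd i (christoffel g p l j k) y - pd j (christoffel g p l i k) y
    + ∑ n : Fin 4, (christoffel g p l i n y * christoffel g p n j k y
        - christoffel g p l j n y * christoffel g p n i k y)

/-- The Riemann curvature tensor `Riem(u, v) w` at `p`. -/
noncomputable def riemann (g : Metric4 X) (p : X) (u v w : TangentSpace I4 p) :
    TangentSpace I4 p :=
  ofCoords p (WithLp.toLp 2 fun l => ∑ i : Fin 4, ∑ j : Fin 4, ∑ k : Fin 4,
    riemannComponent g p l i j k (extChartAt I4 p p) *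
      toCoords u i * toCoords v j * toCoords w k)

/-- The covariant derivative `DV/dt` of a vector field `V` along a curve `γ`, computed at time `t`
in the preferred chart around `γ t`. -/
noncomputable def covDeriv (g : Metric4 X) (γ : ℝ → X) (V : ∀ t, TangentSpace I4 (γ t)) (t : ℝ) :
    TangentSpace I4 (γ t) :=
  ofCoords (γ t) (WithLp.toLp 2 fun k =>
    deriv (fun s => chartDeriv (γ t) (γ s) (V s) k) t
      + ∑ i : Fin 4, ∑ j : Fin 4, christoffel g (γ t) k i j (extChartAt I4 (γ t) (γ t)) *
          toCoords (velocity γ t) i * toCoords (V t) j)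

/-- A smooth free loop, parametrized as a `2π`-periodic smooth curve. -/
structure SmoothLoop (X : Type) [TopologicalSpace X] [ChartedSpace E4 X] where
  toFun : ℝ → X
  smooth : ContMDiff (modelWithCornersSelf ℝ ℝ) I4 ∞ toFun
  periodic : ∀ t, toFun (t + 2 * Real.pi) = toFun t

/-- The lift `t ↦ (γ t, γ' t)` of a smooth loop to the tangent bundle. -/
noncomputable def SmoothLoop.lift (γ : SmoothLoop X) : C(ℝ, TangentBundle I4 X) where
  toFun t := ⟨γ.toFun t, velocity γ.toFun t⟩
  continuous_toFun := by
    have h := γ.smooth.continuous_tangentMap (by simp)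
    have h2 : Continuous fun t : ℝ =>
        (⟨t, (1 : ℝ)⟩ : TangentBundle (modelWithCornersSelf ℝ ℝ) ℝ) := by
      have h3 : Continuous fun t : ℝ =>
          (tangentBundleModelSpaceHomeomorph (modelWithCornersSelf ℝ ℝ)).symm (t, (1 : ℝ)) :=
        (Homeomorph.continuous _).comp (by fun_prop)
      exact h3
    exact h.comp h2

/-- The `C¹` topology on the space of smooth loops: uniform convergence of the loops together with
their velocities. (It is finer than the `C⁰` and the `W^{1,2}` topologies.) -/
noncomputable instance : TopologicalSpace (SmoothLoop X) :=
  TopologicalSpace.induced SmoothLoop.lift inferInstance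

/-- The length of a loop. -/
noncomputable def loopLength (g : Metric4 X) (γ : SmoothLoop X) : ℝ :=
  ∫ t in (0 : ℝ)..(2 * Real.pi),
    Real.sqrt (g.inner (γ.toFun t) (velocity γ.toFun t) (velocity γ.toFun t))

/-- A closed geodesic: a loop with nowhere vanishing velocity and `Dγ'/dt = 0`. -/
def IsClosedGeodesic (g : Metric4 X) (γ : SmoothLoop X) : Prop :=
  (∀ t, velocity γ.toFun t ≠ 0) ∧ ∀ t, covDeriv g γ.toFun (velocity γ.toFun) t = 0

/-- Smooth periodic vector fields along a loop that are normal to it, i.e. the smooth sections of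
the normal bundle of the loop over the circle. -/
def IsNormalField (g : Metric4 X) (γ : SmoothLoop X)
    (V : ∀ t, TangentSpace I4 (γ.toFun t)) : Prop :=
  ContMDiff (modelWithCornersSelf ℝ ℝ) I4.tangent ∞
      (fun t => (⟨γ.toFun t, V t⟩ : TangentBundle I4 X)) ∧
  (∀ t, (⟨γ.toFun (t + 2 * Real.pi), V (t + 2 * Real.pi)⟩ : TangentBundle I4 X)
      = ⟨γ.toFun t, V t⟩) ∧
  ∀ t, g.inner (γ.toFun t) (velocity γ.toFun t) (V t) = 0

/-- The Jacobi operator `J(V) = D²V/dt² - Riem(γ', V) γ'`. -/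
noncomputable def jacobiOperator (g : Metric4 X) (γ : SmoothLoop X)
    (V : ∀ t, TangentSpace I4 (γ.toFun t)) (t : ℝ) : TangentSpace I4 (γ.toFun t) :=
  covDeriv g γ.toFun (covDeriv g γ.toFun V) t
    - riemann g (γ.toFun t) (velocity γ.toFun t) (V t) (velocity γ.toFun t)

/-- The quadratic form `∫ g(V, -J(V)) dt` of the second variation. -/
noncomputable def indexForm (g : Metric4 X) (γ : SmoothLoop X)
    (V : ∀ t, TangentSpace I4 (γ.toFun t)) : ℝ :=
  ∫ t in (0 : ℝ)..(2 * Real.pi), g.inner (γ.toFun t) (V t) (-jacobiOperator g γ V t)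

/-- The index of a closed geodesic: the largest dimension of a space of normal fields on which
`-J` is negative definite. -/
noncomputable def geodesicIndex (g : Metric4 X) (γ : SmoothLoop X) : ℕ∞ :=
  ⨆ (W : Submodule ℝ (∀ t, TangentSpace I4 (γ.toFun t)))
    (_ : (∀ V ∈ W, IsNormalField g γ V) ∧ ∀ V ∈ W, V ≠ 0 → indexForm g γ V < 0),
    Cardinal.toENat (Module.rank ℝ W)

/-- Stability to second order: the index vanishes. -/
def IsStableToSecondOrder (g : Metric4 X) (γ : SmoothLoop X) : Prop := geodesicIndex g γ = 0

/-- Stability: the loop is a local minimum of the length functional. -/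
def IsStable (g : Metric4 X) (γ : SmoothLoop X) : Prop := IsLocalMin (loopLength g) γ

/-- Completeness of a Riemannian metric: Cauchy sequences for the Riemannian distance converge. -/
def IsCompleteMetric (g : Metric4 X) : Prop :=
  letI : Bundle.RiemannianBundle (fun x : X => TangentSpace I4 x) := ⟨g.toRiemannianMetric⟩
  ∀ u : ℕ → X,
    (∀ ε : ENNReal, 0 < ε → ∃ N, ∀ i ≥ N, ∀ j ≥ N, Manifold.riemannianEDist I4 (u i) (u j) < ε) →
    ∃ x, Filter.Tendsto u Filter.atTop (𝓝 x)

/-- The components in the preferred chart around `p` of the two-form `ω(u, v) = g(J u, v)`. -/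
noncomputable def twoFormComponent (g : Metric4 X)
    (J : ∀ x : X, TangentSpace I4 x →L[ℝ] TangentSpace I4 x) (p : X) (a b : Fin 4) (y : E4) : ℝ :=
  g.inner ((extChartAt I4 p).symm y)
    (J _ (chartSymmDeriv p y (coordBasis a))) (chartSymmDeriv p y (coordBasis b))

/-- A hyperkähler triple for `g`: smooth orthogonal almost complex structures `J 0, J 1, J 2` with
the quaternion relations, whose associated two-forms `ω_i(u, v) = g(J i u, v)` are closed.
(Equivalently, the `J i` are parallel complex structures.) -/
structure IsHyperKahler (g : Metric4 X)
    (J : Fin 3 → ∀ x : X, TangentSpace I4 x →L[ℝ] TangentSpace I4 x) : Prop where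
  smooth : ∀ i p a b, ContDiffOn ℝ ∞ (twoFormComponent g (J i) p a b) (extChartAt I4 p).target
  sq : ∀ i x u, J i x (J i x u) = -u
  mul : ∀ x u, J 0 x (J 1 x u) = J 2 x u
  orthogonal : ∀ i x u v, g.inner x (J i x u) (J i x v) = g.inner x u v
  closed : ∀ i p a b c,
    pd a (twoFormComponent g (J i) p b c) (extChartAt I4 p p)
      + pd b (twoFormComponent g (J i) p c a) (extChartAt I4 p p)
      + pd c (twoFormComponent g (J i) p a b) (extChartAt I4 p p) = 0

end Riemannian

section GibbonsHawking

/-- The electrostatic potential `m + ∑ 1 / (2 |x - p|)` of unit charges at the points of `S`. -/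
noncomputable def potential (m : ℝ) (S : Finset E3) (x : E3) : ℝ :=
  m + ∑ p ∈ S, 1 / (2 * ‖x - p‖)

/-- The cross product of `ℝ³`. -/
noncomputable def cross (a b : E3) : E3 :=
  WithLp.toLp 2 (crossProduct (WithLp.ofLp a) (WithLp.ofLp b))

/-- The (radially extended) Hopf map `ℂ² → ℝ³`,
`(z, w) ↦ (2 Re (z̄ w), 2 Im (z̄ w), |z|² - |w|²)` with `z = q 0 + i q 1`, `w = q 2 + i q 3`. -/
noncomputable def hopf (q : E4) : E3 :=
  !₂[2 * (q 0 * q 2 + q 1 * q 3), 2 * (q 0 * q 3 - q 1 * q 2),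
    q 0 ^ 2 + q 1 ^ 2 - q 2 ^ 2 - q 3 ^ 2]

/-- The diagonal circle action `(z, w) ↦ (e^{it} z, e^{it} w)` on `ℂ²`. -/
noncomputable def hopfRot (t : ℝ) (q : E4) : E4 :=
  !₂[Real.cos t * q 0 - Real.sin t * q 1, Real.sin t * q 0 + Real.cos t * q 1,
    Real.cos t * q 2 - Real.sin t * q 3, Real.sin t * q 2 + Real.cos t * q 3]

variable {X : Type} [TopologicalSpace X] [ChartedSpace E4 X]

/-- A one-form read in the preferred chart around `p`. -/
noncomputable def oneFormInChart (η : ∀ x : X, TangentSpace I4 x →L[ℝ] ℝ) (p : X) (y : E4) :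
    E4 →L[ℝ] ℝ :=
  (η ((extChartAt I4 p).symm y)).comp (chartSymmDeriv p y)

/-- The exterior derivative `dη(u, v)` of a one-form at `p`. -/
noncomputable def oneFormDeriv (η : ∀ x : X, TangentSpace I4 x →L[ℝ] ℝ) (p : X)
    (u v : TangentSpace I4 p) : ℝ :=
  fderiv ℝ (oneFormInChart η p) (extChartAt I4 p p) (toCoords u) (toCoords v)
    - fderiv ℝ (oneFormInChart η p) (extChartAt I4 p p) (toCoords v) (toCoords u)

/-- The differential of a map to `ℝ³`. -/
noncomputable def projDeriv (proj : X → E3) (x : X) : TangentSpace I4 x →L[ℝ] E3 :=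
  mfderiv I4 (modelWithCornersSelf ℝ E3) proj x

/-- The structure, on a four-manifold `X`, of the complete hyperkähler manifold produced by the
Gibbons-Hawking ansatz from the potential `φ = m + ∑ 1 / (2 |x - p|)`, `p ∈ S`. If `S` has `k + 1`
points this is, for `m = 0`, an ALE gravitational instanton of type `A_k`, and, for `m > 0`, an ALF
one. -/
structure GibbonsHawking (X : Type) [TopologicalSpace X] [ChartedSpace E4 X] [IsManifold I4 ∞ X]
    (m : ℝ) (S : Finset E3) where
  /-- the metric -/
  g : Metric4 X
  /-- the fibration over `ℝ³` -/
  proj : X → E3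
  /-- the circle action, written as a `2π`-periodic action of `ℝ` -/
  rot : ℝ → X → X
  /-- the connection form; only its values away from the fixed points matter -/
  η : ∀ x : X, TangentSpace I4 x →L[ℝ] ℝ
  /-- the complex structures -/
  J : Fin 3 → ∀ x : X, TangentSpace I4 x →L[ℝ] TangentSpace I4 x
  proj_smooth : ContMDiff I4 (modelWithCornersSelf ℝ E3) ∞ proj
  proj_surjective : Function.Surjective proj
  rot_smooth : ContMDiff ((modelWithCornersSelf ℝ ℝ).prod I4) I4 ∞ fun a : ℝ × X => rot a.1 a.2
  rot_zero : ∀ x, rot 0 x = x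
  rot_add : ∀ s t x, rot (s + t) x = rot s (rot t x)
  rot_two_pi : ∀ x, rot (2 * Real.pi) x = x
  /-- the fibres of `proj` are the orbits -/
  fibre : ∀ x y, proj x = proj y ↔ ∃ t, rot t x = y
  /-- the circle acts freely away from `S` -/
  free : ∀ x, proj x ∉ S → ∀ t, rot t x = x → ∃ n : ℤ, t = n * (2 * Real.pi)
  /-- around the point above each `p ∈ S`, the local model is the radially extended Hopf bundle
  (in particular that point is fixed by the circle) -/
  hopf_chart : ∀ p ∈ S, ∃ e ∈ IsManifold.maximalAtlas I4 ∞ X, (0 : E4) ∈ e.target ∧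
    ∀ x ∈ e.source, proj x = p + hopf (e x) ∧
      ∀ t, rot t x ∈ e.source ∧ e (rot t x) = hopfRot t (e x)
  /-- `η` is a connection form: smooth, invariant, and `1` on the generator of the action -/
  η_smooth : ∀ p, ContDiffOn ℝ ∞ (oneFormInChart η p)
    ((extChartAt I4 p).target ∩ {y | proj ((extChartAt I4 p).symm y) ∉ S})
  η_invariant : ∀ x, proj x ∉ S → ∀ t u, η (rot t x) (mfderiv I4 I4 (rot t) x u) = η x u
  η_generator : ∀ x, proj x ∉ S → ∀ t, η (rot t x) (velocity (fun s => rot s x) t) = 1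
  /-- `dη = - * dφ` -/
  monopole : ∀ x, proj x ∉ S → ∀ u v, oneFormDeriv η x u v =
    -fderiv ℝ (potential m S) (proj x) (cross (projDeriv proj x u) (projDeriv proj x v))
  /-- `g = φ⁻¹ η² + φ g_E` -/
  metric_eq : ∀ x, proj x ∉ S → ∀ u v, g.inner x u v =
    (potential m S (proj x))⁻¹ * (η x u * η x v)
      + potential m S (proj x) * inner ℝ (projDeriv proj x u) (projDeriv proj x v)
  complete : IsCompleteMetric g
  hyperKahler : IsHyperKahler g J
  /-- `proj` is the hyperkähler moment map of the circle action -/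
  moment : ∀ i x t u, g.inner (rot t x) (J i (rot t x) (velocity (fun s => rot s x) t)) u =
    projDeriv proj (rot t x) u i

end GibbonsHawking

section Platonic

/-- The five Platonic solids. -/
inductive PlatonicSolid
  | tetrahedron
  | octahedron
  | cube
  | icosahedron
  | dodecahedron

/-- The vertices of standard copies of the Platonic solids, centred at the origin. -/
noncomputable def PlatonicSolid.vertices : PlatonicSolid → Set E3
  | tetrahedron => {x | (∀ i, |x i| = 1) ∧ x 0 * x 1 * x 2 = 1}
  | octahedron => {x | ∃ (i : Fin 3) (s : ℝ), |s| = 1 ∧ x = EuclideanSpace.single i s}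
  | cube => {x | ∀ i, |x i| = 1}
  | icosahedron => {x | ∃ i : Fin 3, x i = 0 ∧ |x (i + 1)| = 1 ∧ |x (i + 2)| = Real.goldenRatio}
  | dodecahedron => {x | (∀ i, |x i| = 1) ∨ ∃ i : Fin 3,
      x i = 0 ∧ |x (i + 1)| = Real.goldenRatio⁻¹ ∧ |x (i + 2)| = Real.goldenRatio}

/-- `T` is the vertex set of a Platonic solid with centre `c`. -/
def IsPlatonicVertexSet (c : E3) (T : Set E3) : Prop :=
  ∃ (s : PlatonicSolid) (r : ℝ) (A : E3 ≃ₗᵢ[ℝ] E3), 0 < r ∧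
    T = (fun v => c + r • A v) '' s.vertices

/-- `S` is the disjoint union of the vertex sets of finitely many (at least one) Platonic solids
with common centre `c`. -/
def IsConcentricPlatonic (c : E3) (S : Finset E3) : Prop :=
  ∃ (n : ℕ) (T : Fin n → Set E3), 0 < n ∧ (∀ i, IsPlatonicVertexSet c (T i)) ∧
    Pairwise (fun i j => Disjoint (T i) (T j)) ∧ (S : Set E3) = ⋃ i, T i

/-- `N` is a sum of numbers of vertices of Platonic solids. -/
def IsPlatonicSum (N : ℕ) : Prop :=
  ∃ P : Nat.Partition N, ∀ a ∈ P.parts, a ∈ ({4, 6, 8, 12, 20} : Set ℕ)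

end Platonic

/-!
# Unstable closed geodesics of index zero on gravitational instantons

Let `φ = m + ∑ 1 / (2 |x - P j|)` be the potential, and let `c` be the common centre of the Platonic
solids whose vertices are the charges.

*The instanton.* The total space `GHBundle P` is the set of pairs `(x, ⊗ⱼ qⱼ)`, where
`qⱼ ∈ ℂ²` is a spinor which the Hopf map sends to `x - P j`; the torus of phases with product one is
thereby divided out, and one circle acts on what remains. Near a charge `P i` the factor `q i` is a
coordinate, once the other factors are normalised by local sections of the Hopf fibration, which
gives the charts (`GHBundle.hopfChart`). In these the connection form is the Hopf connection plus
Dirac monopole potentials of the other charges, so that the equation `dη = -∗dφ` reduces to the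
computation `extD_hopfConn` for a single charge, and the metric and the Kähler forms extend across
the fibres of the charges. The function `log (1 + |x|²)` is proper with bounded gradient, whence
completeness; everything is collected in `GHSpace.gibbonsHawking`.

*Second order.* The vertex set of a Platonic solid is invariant under a tetrahedral group, so its
first moments vanish and its second moments are isotropic (`IsTetrahedral.isDesign`). As
`1 / (2 |x|)` is harmonic, `∇φ` and `∇²φ` vanish at `c` (`IsConcentricPlatonic.sum_newton`). The
curvature `-∗dφ` of the connection then vanishes to first order at `c`, and a one-form with exterior
derivative vanishing to first order at a point agrees there to second order with an exact one
(`exists_flatAt_add_fderiv`), so that there is a gauge in which the connection form vanishes to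
second order at `c` (`exists_flatGauge`). In the resulting charts the metric is constant to second
order along the fibre of `c`: the fibre is a geodesic, the curvature vanishes along it, and
`-J = -d²/dt²` is nonnegative on periodic normal fields (`FlatGauge.isClosedGeodesic_orbit`,
`FlatGauge.isStableToSecondOrder_orbit`).

*Instability.* The fibre over `x` has length `2π φ(x)^{-1/2}` and depends continuously on `x` in the
`C¹` topology. Were the fibre over `c` a local minimum of length, `c` would be a local maximum
of `φ` (`FlatGauge.isLocalMax_of_isStable`). But `φ` is harmonic and not constant, so the strong
maximum principle excludes this (`not_isLocalMax_pot`).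
-/

set_option linter.unusedSectionVars false

/-! ### Exterior derivatives of one-forms on normed spaces -/

section ExteriorDerivative

/-- The coordinate functionals of Euclidean space. -/
noncomputable def coordL {n : ℕ} (i : Fin n) : EuclideanSpace ℝ (Fin n) →L[ℝ] ℝ :=
  EuclideanSpace.proj i

@[simp] lemma coordL_apply {n : ℕ} (i : Fin n) (x : EuclideanSpace ℝ (Fin n)) :
    coordL i x = x i := rfl

variable {V W : Type*} [NormedAddCommGroup V] [NormedSpace ℝ V] [NormedAddCommGroup W]
  [NormedSpace ℝ W]

/-- The exterior derivative `dα(u, v)` of a one-form on a normed space. -/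
noncomputable def extD (α : V → V →L[ℝ] ℝ) (x u v : V) : ℝ :=
  fderiv ℝ α x u v - fderiv ℝ α x v u

/-- The pullback of a one-form. -/
noncomputable def pullForm (F : V → W) (α : W → W →L[ℝ] ℝ) (x : V) : V →L[ℝ] ℝ :=
  (α (F x)).comp (fderiv ℝ F x)

@[simp] lemma pullForm_apply (F : V → W) (α : W → W →L[ℝ] ℝ) (x u : V) :
    pullForm F α x u = α (F x) (fderiv ℝ F x u) := rfl

lemma ContDiffAt.differentiableAt_fderiv {F : V → W} {x : V} (hF : ContDiffAt ℝ 2 F x) :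
    DifferentiableAt ℝ (fderiv ℝ F) x :=
  (hF.fderiv_right (m := 1) (by norm_num)).differentiableAt (by norm_num)

lemma ContDiffAt.fderiv_fderiv_symm {F : V → W} {x : V} (hF : ContDiffAt ℝ 2 F x) (u v : V) :
    fderiv ℝ (fderiv ℝ F) x u v = fderiv ℝ (fderiv ℝ F) x v u :=
  (hF.isSymmSndFDerivAt (by simp)) u v

/-- The exterior derivative commutes with pullbacks. -/
lemma extD_pullForm {F : V → W} {α : W → W →L[ℝ] ℝ} {x : V} (hF : ContDiffAt ℝ 2 F x)
    (hα : DifferentiableAt ℝ α (F x)) (u v : V) :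
    extD (pullForm F α) x u v = extD α (F x) (fderiv ℝ F x u) (fderiv ℝ F x v) := by
  have h1 : HasFDerivAt (fun y => α (F y)) ((fderiv ℝ α (F x)).comp (fderiv ℝ F x)) x :=
    hα.hasFDerivAt.comp x (hF.differentiableAt (by norm_num)).hasFDerivAt
  have h2 := hF.differentiableAt_fderiv.hasFDerivAt
  have h := h1.clm_comp h2
  have h' : fderiv ℝ (pullForm F α) x = _ := h.fderiv
  unfold extD
  rw [h']
  simp [hF.fderiv_fderiv_symm u v]

lemma extD_congr {α β : V → V →L[ℝ] ℝ} {x : V} (h : α =ᶠ[𝓝 x] β) (u v : V) :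
    extD α x u v = extD β x u v := by
  unfold extD; rw [h.fderiv_eq]

lemma extD_sum {ι : Type*} (s : Finset ι) {α : ι → V → V →L[ℝ] ℝ} {x : V}
    (h : ∀ i ∈ s, DifferentiableAt ℝ (α i) x) (u v : V) :
    extD (fun y => ∑ i ∈ s, α i y) x u v = ∑ i ∈ s, extD (α i) x u v := by
  unfold extD
  rw [fderiv_fun_sum h]
  simp [Finset.sum_sub_distrib]

lemma fderiv_clm_apply_const {f : V → W →L[ℝ] ℝ} {x : V} (h : DifferentiableAt ℝ f x) (u : V)
    (w : W) : fderiv ℝ (fun y => f y w) x u = fderiv ℝ f x u w := by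
  have := (h.hasFDerivAt.clm_apply (hasFDerivAt_const w x)).fderiv
  rw [this]; simp

lemma fderiv_coord {n : ℕ} {f : V → EuclideanSpace ℝ (Fin n)} {x : V}
    (h : DifferentiableAt ℝ f x) (u : V) (i : Fin n) :
    fderiv ℝ (fun y => f y i) x u = fderiv ℝ f x u i := by
  have := ((coordL i).hasFDerivAt.comp x
    h.hasFDerivAt).fderiv
  exact congrArg (fun L => L u) this

end ExteriorDerivative

/-! ### Algebra of the Hopf map -/

lemma norm_sq_E3 (x : E3) : ‖x‖ ^ 2 = x 0 ^ 2 + x 1 ^ 2 + x 2 ^ 2 := by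
  rw [EuclideanSpace.norm_sq_eq, Fin.sum_univ_three]; simp

lemma norm_sq_E4 (x : E4) : ‖x‖ ^ 2 = x 0 ^ 2 + x 1 ^ 2 + x 2 ^ 2 + x 3 ^ 2 := by
  rw [EuclideanSpace.norm_sq_eq, Fin.sum_univ_four]; simp

lemma inner_E3 (x y : E3) : inner ℝ x y = x 0 * y 0 + x 1 * y 1 + x 2 * y 2 := by
  rw [PiLp.inner_apply, Fin.sum_univ_three]; simp [mul_comm]

lemma inner_E4 (x y : E4) : inner ℝ x y = x 0 * y 0 + x 1 * y 1 + x 2 * y 2 + x 3 * y 3 := by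
  rw [PiLp.inner_apply, Fin.sum_univ_four]; simp [mul_comm]

lemma cross_eq (a b : E3) : cross a b =
    !₂[a 1 * b 2 - a 2 * b 1, a 2 * b 0 - a 0 * b 2, a 0 * b 1 - a 1 * b 0] := by
  ext i; fin_cases i <;> simp [cross, crossProduct]

lemma E3_ext {x y : E3} (h0 : x 0 = y 0) (h1 : x 1 = y 1) (h2 : x 2 = y 2) : x = y := by
  ext i; fin_cases i <;> assumption

lemma E4_ext {x y : E4} (h0 : x 0 = y 0) (h1 : x 1 = y 1) (h2 : x 2 = y 2) (h3 : x 3 = y 3) :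
    x = y := by
  ext i; fin_cases i <;> assumption

@[simp] lemma hopf_zero (q : E4) : hopf q 0 = 2 * (q 0 * q 2 + q 1 * q 3) := by simp [hopf]
@[simp] lemma hopf_one (q : E4) : hopf q 1 = 2 * (q 0 * q 3 - q 1 * q 2) := by simp [hopf]
@[simp] lemma hopf_two (q : E4) : hopf q 2 = q 0 ^ 2 + q 1 ^ 2 - q 2 ^ 2 - q 3 ^ 2 := by
  simp [hopf]

@[simp] lemma hopfRot_zero_apply (t : ℝ) (q : E4) :
    hopfRot t q 0 = Real.cos t * q 0 - Real.sin t * q 1 := by simp [hopfRot]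
@[simp] lemma hopfRot_one_apply (t : ℝ) (q : E4) :
    hopfRot t q 1 = Real.sin t * q 0 + Real.cos t * q 1 := by simp [hopfRot]
@[simp] lemma hopfRot_two_apply (t : ℝ) (q : E4) :
    hopfRot t q 2 = Real.cos t * q 2 - Real.sin t * q 3 := by simp [hopfRot]
@[simp] lemma hopfRot_three_apply (t : ℝ) (q : E4) :
    hopfRot t q 3 = Real.sin t * q 2 + Real.cos t * q 3 := by simp [hopfRot]

/-- The differential of the Hopf map, as the polarization of a quadratic map. -/
noncomputable def dhopf (q u : E4) : E3 :=
  !₂[2 * (u 0 * q 2 + q 0 * u 2 + (u 1 * q 3 + q 1 * u 3)),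
    2 * (u 0 * q 3 + q 0 * u 3 - (u 1 * q 2 + q 1 * u 2)),
    2 * (q 0 * u 0 + q 1 * u 1 - q 2 * u 2 - q 3 * u 3)]

@[simp] lemma dhopf_zero (q u : E4) :
    dhopf q u 0 = 2 * (u 0 * q 2 + q 0 * u 2 + (u 1 * q 3 + q 1 * u 3)) := by simp [dhopf]
@[simp] lemma dhopf_one (q u : E4) :
    dhopf q u 1 = 2 * (u 0 * q 3 + q 0 * u 3 - (u 1 * q 2 + q 1 * u 2)) := by simp [dhopf]
@[simp] lemma dhopf_two (q u : E4) :
    dhopf q u 2 = 2 * (q 0 * u 0 + q 1 * u 1 - q 2 * u 2 - q 3 * u 3) := by simp [dhopf]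

lemma contDiff_coord {k : ℕ} {n : WithTop ℕ∞} (i : Fin k) :
    ContDiff ℝ n (fun q : EuclideanSpace ℝ (Fin k) => q i) :=
  (coordL i).contDiff

lemma contDiff_hopf {n : WithTop ℕ∞} : ContDiff ℝ n hopf := by
  rw [contDiff_euclidean]
  intro i
  have := fun j : Fin 4 => contDiff_coord (n := n) j
  fin_cases i <;> simp <;> fun_prop

lemma hasFDerivAt_coord {k : ℕ} (i : Fin k) (x : EuclideanSpace ℝ (Fin k)) :
    HasFDerivAt (fun q : EuclideanSpace ℝ (Fin k) => q i)
      (coordL i) x :=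
  (coordL i).hasFDerivAt

lemma fderiv_hopf (q u : E4) : fderiv ℝ hopf q u = dhopf q u := by
  have hd : DifferentiableAt ℝ hopf q := (contDiff_hopf (n := 1)).differentiable (by norm_num) q
  have h := fun i : Fin 4 => hasFDerivAt_coord i q
  apply E3_ext <;> rw [← fderiv_coord hd]
  · simp only [hopf_zero]
    rw [((((h 0).fun_mul (h 2)).fun_add ((h 1).fun_mul (h 3))).const_mul 2).fderiv]
    simp; ring
  · simp only [hopf_one]
    rw [((((h 0).fun_mul (h 3)).fun_sub ((h 1).fun_mul (h 2))).const_mul 2).fderiv]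
    simp; ring
  · simp only [hopf_two, sq]
    rw [(((((h 0).fun_mul (h 0)).fun_add ((h 1).fun_mul (h 1))).fun_sub
        ((h 2).fun_mul (h 2))).fun_sub ((h 3).fun_mul (h 3))).fderiv]
    simp; ring

lemma norm_hopf (q : E4) : ‖hopf q‖ = ‖q‖ ^ 2 := by
  have : ‖hopf q‖ ^ 2 = (‖q‖ ^ 2) ^ 2 := by
    rw [norm_sq_E3, norm_sq_E4]; simp; ring
  exact (sq_eq_sq₀ (norm_nonneg _) (by positivity)).1 this

lemma hopf_eq_zero {q : E4} : hopf q = 0 ↔ q = 0 := by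
  rw [← norm_eq_zero, norm_hopf]; simp

/-- The one-form `u ↦ Im ⟨q, u⟩ = Im (z̄ u_z + w̄ u_w)` on `ℂ²`, where `q = (z, w)`. -/
noncomputable def angForm (q : E4) : E4 →L[ℝ] ℝ :=
  q 0 • coordL 1
    - q 1 • coordL 0
    + (q 2 • coordL 3
    - q 3 • coordL 2)

lemma angForm_apply (q u : E4) :
    angForm q u = q 0 * u 1 - q 1 * u 0 + (q 2 * u 3 - q 3 * u 2) := by
  simp [angForm]

lemma contDiff_angForm {n : WithTop ℕ∞} : ContDiff ℝ n angForm := by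
  have := fun j : Fin 4 => contDiff_coord (n := n) j
  unfold angForm
  fun_prop

/-- The Hopf map is, up to the factor `4 |q|²`, a Riemannian submersion. -/
lemma inner_dhopf (q u v : E4) : inner ℝ (dhopf q u) (dhopf q v) =
    4 * (‖q‖ ^ 2 * inner ℝ u v - angForm q u * angForm q v) := by
  rw [inner_E3, inner_E4, norm_sq_E4, angForm_apply, angForm_apply]; simp; ring

/-- The tangent vector of the diagonal circle action. -/
noncomputable def hopfGen (q : E4) : E4 := !₂[-q 1, q 0, -q 3, q 2]

@[simp] lemma hopfGen_zero (q : E4) : hopfGen q 0 = -q 1 := by simp [hopfGen]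
@[simp] lemma hopfGen_one (q : E4) : hopfGen q 1 = q 0 := by simp [hopfGen]
@[simp] lemma hopfGen_two (q : E4) : hopfGen q 2 = -q 3 := by simp [hopfGen]
@[simp] lemma hopfGen_three (q : E4) : hopfGen q 3 = q 2 := by simp [hopfGen]

lemma angForm_hopfGen (q : E4) : angForm q (hopfGen q) = ‖q‖ ^ 2 := by
  rw [angForm_apply, norm_sq_E4]; simp; ring

lemma dhopf_hopfGen (q : E4) : dhopf q (hopfGen q) = 0 := by
  apply E3_ext <;> simp <;> ring

lemma hopf_hopfRot (t : ℝ) (q : E4) : hopf (hopfRot t q) = hopf q := by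
  have h := Real.sin_sq_add_cos_sq t
  apply E3_ext <;> simp only [hopf_zero, hopf_one, hopf_two, hopfRot_zero_apply,
    hopfRot_one_apply, hopfRot_two_apply, hopfRot_three_apply]
  · linear_combination (2 * (q 0 * q 2 + q 1 * q 3)) * h
  · linear_combination (2 * (q 0 * q 3 - q 1 * q 2)) * h
  · linear_combination (q 0 ^ 2 + q 1 ^ 2 - q 2 ^ 2 - q 3 ^ 2) * h

lemma hopfRot_zero (q : E4) : hopfRot 0 q = q := by
  apply E4_ext <;> simp

lemma hopfRot_add (s t : ℝ) (q : E4) : hopfRot (s + t) q = hopfRot s (hopfRot t q) := by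
  apply E4_ext <;> simp [Real.cos_add, Real.sin_add] <;> ring

/-- The diagonal circle action as a linear map. -/
noncomputable def hopfRotL (t : ℝ) : E4 →L[ℝ] E4 :=
  LinearMap.toContinuousLinearMap
    { toFun := hopfRot t
      map_add' := fun x y => by apply E4_ext <;> simp <;> ring
      map_smul' := fun c x => by apply E4_ext <;> simp <;> ring }

lemma norm_hopfRot (t : ℝ) (q : E4) : ‖hopfRot t q‖ = ‖q‖ := by
  have h : ‖hopfRot t q‖ ^ 2 = ‖q‖ ^ 2 := by rw [← norm_hopf, ← norm_hopf, hopf_hopfRot]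
  exact (sq_eq_sq₀ (norm_nonneg _) (norm_nonneg _)).1 h

lemma angForm_hopfRot (t : ℝ) (q u : E4) : angForm (hopfRot t q) (hopfRot t u) = angForm q u := by
  have h := Real.sin_sq_add_cos_sq t
  rw [angForm_apply, angForm_apply]; simp
  linear_combination (q 0 * u 1 - q 1 * u 0 + (q 2 * u 3 - q 3 * u 2)) * h

lemma dhopf_hopfRot (t : ℝ) (q u : E4) : dhopf (hopfRot t q) (hopfRot t u) = dhopf q u := by
  have h := Real.sin_sq_add_cos_sq t
  apply E3_ext <;> simp only [dhopf_zero, dhopf_one, dhopf_two, hopfRot_zero_apply,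
    hopfRot_one_apply, hopfRot_two_apply, hopfRot_three_apply]
  · linear_combination (2 * (u 0 * q 2 + q 0 * u 2 + (u 1 * q 3 + q 1 * u 3))) * h
  · linear_combination (2 * (u 0 * q 3 + q 0 * u 3 - (u 1 * q 2 + q 1 * u 2))) * h
  · linear_combination (2 * (q 0 * u 0 + q 1 * u 1 - q 2 * u 2 - q 3 * u 3)) * h

lemma contDiff_hopfRot {n : WithTop ℕ∞} : ContDiff ℝ n (fun p : ℝ × E4 => hopfRot p.1 p.2) := by
  rw [contDiff_euclidean]
  have h := fun j : Fin 4 => (contDiff_coord (n := n) j).comp (contDiff_snd (E := ℝ) (F := E4))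
  have hc : ContDiff ℝ n (fun p : ℝ × E4 => Real.cos p.1) := Real.contDiff_cos.comp contDiff_fst
  have hs : ContDiff ℝ n (fun p : ℝ × E4 => Real.sin p.1) := Real.contDiff_sin.comp contDiff_fst
  intro i
  fin_cases i
  · simpa using (hc.mul (h 0)).sub (hs.mul (h 1))
  · simpa using (hs.mul (h 0)).add (hc.mul (h 1))
  · simpa using (hc.mul (h 2)).sub (hs.mul (h 3))
  · simpa using (hs.mul (h 2)).add (hc.mul (h 3))

lemma hasDerivAt_euclid {n : ℕ} {f : ℝ → EuclideanSpace ℝ (Fin n)}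
    {f' : EuclideanSpace ℝ (Fin n)} {t : ℝ} :
    HasDerivAt f f' t ↔ ∀ i, HasDerivAt (fun s => f s i) (f' i) t := by
  simp only [hasDerivAt_iff_hasFDerivAt]
  rw [← hasFDerivWithinAt_univ, hasFDerivWithinAt_euclidean]
  simp only [hasFDerivWithinAt_univ]
  refine forall_congr' fun i => ?_
  constructor <;> intro h <;> convert! h using 1

lemma hasDerivAt_hopfRot (q : E4) (t : ℝ) :
    HasDerivAt (fun s => hopfRot s q) (hopfGen (hopfRot t q)) t := by
  rw [hasDerivAt_euclid]
  intro i
  have hc := Real.hasDerivAt_cos t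
  have hs := Real.hasDerivAt_sin t
  fin_cases i
  · simpa [sub_eq_add_neg, add_comm] using (hc.mul_const (q 0)).fun_sub (hs.mul_const (q 1))
  · simpa [sub_eq_add_neg, add_comm] using (hs.mul_const (q 0)).fun_add (hc.mul_const (q 1))
  · simpa [sub_eq_add_neg, add_comm] using (hc.mul_const (q 2)).fun_sub (hs.mul_const (q 3))
  · simpa [sub_eq_add_neg, add_comm] using (hs.mul_const (q 2)).fun_add (hc.mul_const (q 3))

/-! ### The connection form of the Hopf fibration -/

/-- The canonical connection form `Im ⟨q, dq⟩ / |q|²` of the Hopf fibration. -/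
noncomputable def hopfConn (q : E4) : E4 →L[ℝ] ℝ := (‖q‖ ^ 2)⁻¹ • angForm q

lemma hopfConn_apply (q u : E4) : hopfConn q u = angForm q u / ‖q‖ ^ 2 := by
  simp [hopfConn]; ring

lemma contDiffAt_hopfConn {n : WithTop ℕ∞} {q : E4} (hq : q ≠ 0) : ContDiffAt ℝ n hopfConn q := by
  unfold hopfConn
  have h1 : ContDiffAt ℝ n (fun y : E4 => ‖y‖ ^ 2) q := (contDiff_norm_sq ℝ).contDiffAt
  have h2 : ContDiffAt ℝ n (fun y : E4 => (‖y‖ ^ 2)⁻¹) q := h1.inv (by simpa using hq)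
  exact h2.smul contDiff_angForm.contDiffAt

/-- The elementary potential `1 / (2 |x|)`. -/
noncomputable def newton (x : E3) : ℝ := 1 / (2 * ‖x‖)

lemma contDiffAt_newton {n : WithTop ℕ∞} {x : E3} (hx : x ≠ 0) : ContDiffAt ℝ n newton x := by
  have h1 : ContDiffAt ℝ n (fun y : E3 => ‖y‖) x := contDiffAt_norm ℝ hx
  have h2 : ContDiffAt ℝ n (fun y : E3 => 2 * ‖y‖) x := contDiffAt_const.mul h1
  exact (contDiffAt_const (c := (1 : ℝ))).div h2 (by simpa using hx)

lemma hasFDerivAt_norm_E {n : ℕ} {x : EuclideanSpace ℝ (Fin n)} (hx : x ≠ 0) :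
    HasFDerivAt (fun y : EuclideanSpace ℝ (Fin n) => ‖y‖)
        (‖x‖⁻¹ • (innerSL ℝ x : EuclideanSpace ℝ (Fin n) →L[ℝ] ℝ)) x := by
  have h0 : HasFDerivAt (fun y : EuclideanSpace ℝ (Fin n) => ‖y‖ ^ 2) (2 • innerSL ℝ x) x :=
    (hasStrictFDerivAt_norm_sq x).hasFDerivAt
  have h1 := h0.sqrt (by positivity)
  have h2 : (fun y : EuclideanSpace ℝ (Fin n) => √(‖y‖ ^ 2)) = fun y => ‖y‖ := by
    ext y; exact Real.sqrt_sq (norm_nonneg y)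
  rw [h2] at h1
  convert! h1 using 1
  rw [Real.sqrt_sq (norm_nonneg x)]
  ext v; simp; ring

lemma fderiv_newton {x : E3} (hx : x ≠ 0) (v : E3) :
    fderiv ℝ newton x v = -inner ℝ x v / (2 * ‖x‖ ^ 3) := by
  have hx' : ‖x‖ ≠ 0 := norm_ne_zero_iff.2 hx
  have h := (hasFDerivAt_norm_E hx).const_mul (2 : ℝ)
  have h2 := (hasDerivAt_inv (x := 2 * ‖x‖) (by simpa using hx)).comp_hasFDerivAt x h
  have h3 : newton = (fun y => y⁻¹) ∘ fun y : E3 => 2 * ‖y‖ := by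
    ext y; simp [newton]
  rw [h3, h2.fderiv]
  simp [innerSL_apply_apply]
  field_simp

/-- The Hopf connection is the Dirac monopole: its curvature is `-* d (1 / (2 |x|))`. -/
lemma extD_hopfConn {q : E4} (hq : q ≠ 0) (u v : E4) :
    extD hopfConn q u v = -fderiv ℝ newton (hopf q) (cross (dhopf q u) (dhopf q v)) := by
  have hN : ‖q‖ ≠ 0 := norm_ne_zero_iff.2 hq
  have key : ∀ u v : E4, fderiv ℝ hopfConn q u v =
      angForm u v / ‖q‖ ^ 2 - angForm q v * (2 * inner ℝ q u) / (‖q‖ ^ 2) ^ 2 := by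
    intro u v
    rw [← fderiv_clm_apply_const
      ((contDiffAt_hopfConn (n := 1) hq).differentiableAt (by norm_num))]
    have h1 : HasFDerivAt (fun y : E4 => ‖y‖ ^ 2) (2 • innerSL ℝ q) q :=
      (hasStrictFDerivAt_norm_sq q).hasFDerivAt
    have h2 : HasFDerivAt (fun y => angForm y v) (-angForm v) q := by
      have h := fun i : Fin 4 => hasFDerivAt_coord i q
      have := (((h 0).mul_const (v 1)).sub ((h 1).mul_const (v 0))).add
        (((h 2).mul_const (v 3)).sub ((h 3).mul_const (v 2)))
      convert! this using 1
      ext y; simp [angForm_apply]; ring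
    have h3 := h2.mul ((hasDerivAt_inv (x := ‖q‖ ^ 2) (by positivity)).comp_hasFDerivAt q h1)
    have h4 : (fun y => hopfConn y v) = (fun y => angForm y v) * (Inv.inv ∘ fun y => ‖y‖ ^ 2) := by
      ext y; simp [hopfConn_apply, div_eq_mul_inv]
    rw [h4, h3.fderiv]
    simp [innerSL_apply_apply, angForm_apply]
    field_simp
    ring
  have hne : hopf q ≠ 0 := fun h => hq (hopf_eq_zero.1 h)
  unfold extD
  rw [key, key, fderiv_newton hne, norm_hopf]
  have pol : inner ℝ (hopf q) (cross (dhopf q u) (dhopf q v)) =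
      4 * (‖q‖ ^ 2) ^ 2 * angForm u v
        - 4 * ‖q‖ ^ 2 * (inner ℝ q u * angForm q v - inner ℝ q v * angForm q u) := by
    rw [inner_E3, inner_E4, inner_E4, norm_sq_E4, cross_eq]
    simp only [angForm_apply]
    simp
    ring
  have anti : angForm v u = -angForm u v := by simp only [angForm_apply]; ring
  rw [pol, anti]
  field_simp
  ring


/-! ### Local sections of the Hopf fibration -/

/-- The two complex coordinates of `ℝ⁴ = ℂ²`: `z` for `true` and `w` for `false`. -/
noncomputable def spinor (b : Bool) : E4 →L[ℝ] ℂ :=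
  LinearMap.toContinuousLinearMap
    { toFun := fun q => bif b then ⟨q 0, q 1⟩ else ⟨q 2, q 3⟩
      map_add' := fun x y => by cases b <;> rfl
      map_smul' := fun c x => by cases b <;> apply Complex.ext <;> simp }

lemma spinor_true (q : E4) : spinor true q = ⟨q 0, q 1⟩ := rfl
lemma spinor_false (q : E4) : spinor false q = ⟨q 2, q 3⟩ := rfl

/-- The point of `ℝ⁴` with given complex coordinates. -/
noncomputable def ofSpinor (z : Bool → ℂ) : E4 :=
  !₂[(z true).re, (z true).im, (z false).re, (z false).im]

lemma ofSpinor_spinor (q : E4) : ofSpinor (fun b => spinor b q) = q := by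
  apply E4_ext <;> simp [ofSpinor, spinor_true, spinor_false]

lemma spinor_ofSpinor (z : Bool → ℂ) (b : Bool) : spinor b (ofSpinor z) = z b := by
  cases b <;> apply Complex.ext <;> simp [ofSpinor, spinor_true, spinor_false]

lemma spinor_hopfRot (b : Bool) (t : ℝ) (q : E4) :
    spinor b (hopfRot t q) = Complex.exp (t * Complex.I) * spinor b q := by
  cases b <;> apply Complex.ext <;>
    simp [spinor_true, spinor_false, Complex.exp_re, Complex.exp_im] <;> ring

lemma normSq_spinor_add (q : E4) :
    Complex.normSq (spinor true q) + Complex.normSq (spinor false q) = ‖q‖ ^ 2 := by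
  rw [norm_sq_E4]; simp [Complex.normSq_apply, spinor_true, spinor_false]; ring

lemma exists_cos_sin {c s : ℝ} (h : c ^ 2 + s ^ 2 = 1) :
    ∃ t : ℝ, Real.cos t = c ∧ Real.sin t = s := by
  have h1 : ‖(⟨c, s⟩ : ℂ)‖ = 1 := by
    rw [Complex.norm_eq_sqrt_sq_add_sq]; simp [h]
  refine ⟨Complex.arg ⟨c, s⟩, ?_, ?_⟩
  · have := Complex.norm_mul_cos_arg ⟨c, s⟩
    rwa [h1, one_mul] at this
  · have := Complex.norm_mul_sin_arg ⟨c, s⟩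
    rwa [h1, one_mul] at this

/-- The fibres of the Hopf map are the orbits of the diagonal circle action. -/
lemma exists_hopfRot_of_hopf_eq {q p : E4} (h : hopf q = hopf p) : ∃ t, p = hopfRot t q := by
  have hN : ‖q‖ ^ 2 = ‖p‖ ^ 2 := by rw [← norm_hopf, ← norm_hopf, h]
  by_cases hq : q = 0
  · have hp : p = 0 := by
      rw [hq] at hN; simpa using hN.symm
    exact ⟨0, by rw [hq, hp, hopfRot_zero]⟩
  have hpos : 0 < ‖q‖ ^ 2 := by positivity
  have h0 := congrArg (fun x : E3 => x 0) h
  have h1 := congrArg (fun x : E3 => x 1) h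
  have h2 := congrArg (fun x : E3 => x 2) h
  simp only [hopf_zero, hopf_one, hopf_two] at h0 h1 h2
  have hN' := hN
  rw [norm_sq_E4, norm_sq_E4] at hN'
  set N := ‖q‖ ^ 2 with hNdef
  have hNq : N = q 0 ^ 2 + q 1 ^ 2 + q 2 ^ 2 + q 3 ^ 2 := norm_sq_E4 q
  set c := (q 0 * p 0 + q 1 * p 1 + q 2 * p 2 + q 3 * p 3) with hc
  set s := (q 0 * p 1 - q 1 * p 0 + (q 2 * p 3 - q 3 * p 2)) with hs
  -- `N p = ⟨q, p⟩ q` over `ℂ`, coordinate by coordinate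
  have e0 : c * q 0 - s * q 1 = N * p 0 := by
    rw [hc, hs, hNq]
    linear_combination (p 2 / 2) * h0 + (p 3 / 2) * h1 - (p 0 / 2) * (hN' - h2)
  have e1 : s * q 0 + c * q 1 = N * p 1 := by
    rw [hc, hs, hNq]
    linear_combination (p 3 / 2) * h0 - (p 2 / 2) * h1 - (p 1 / 2) * (hN' - h2)
  have e2 : c * q 2 - s * q 3 = N * p 2 := by
    rw [hc, hs, hNq]
    linear_combination (p 0 / 2) * h0 - (p 1 / 2) * h1 - (p 2 / 2) * (hN' + h2)
  have e3 : s * q 2 + c * q 3 = N * p 3 := by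
    rw [hc, hs, hNq]
    linear_combination (p 1 / 2) * h0 + (p 0 / 2) * h1 - (p 3 / 2) * (hN' + h2)
  have hcs : (c / N) ^ 2 + (s / N) ^ 2 = 1 := by
    have : (c ^ 2 + s ^ 2) * N = N ^ 2 * N := by
      calc (c ^ 2 + s ^ 2) * N = (c * q 0 - s * q 1) ^ 2 + (s * q 0 + c * q 1) ^ 2
            + (c * q 2 - s * q 3) ^ 2 + (s * q 2 + c * q 3) ^ 2 := by rw [hNq]; ring
        _ = N ^ 2 * N := by rw [e0, e1, e2, e3, hNq]; linear_combination (-1) *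
              (q 0 ^ 2 + q 1 ^ 2 + q 2 ^ 2 + q 3 ^ 2) ^ 2 * hN'
    have := mul_right_cancel₀ hpos.ne' this
    field_simp; exact this
  obtain ⟨t, ht, ht'⟩ := exists_cos_sin hcs
  refine ⟨t, ?_⟩
  apply E4_ext
  · rw [hopfRot_zero_apply, ht, ht']; field_simp; linear_combination -e0
  · rw [hopfRot_one_apply, ht, ht']; field_simp; linear_combination -e1
  · rw [hopfRot_two_apply, ht, ht']; field_simp; linear_combination -e2
  · rw [hopfRot_three_apply, ht, ht']; field_simp; linear_combination -e3

/-- The function `|x| ± x₂`, positive off one half of the last coordinate axis. -/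
noncomputable def axisGap (ε : Bool) (x : E3) : ℝ := ‖x‖ + (bif ε then x 2 else -x 2)

/-- The complement of the half-axis (a Dirac string) on which `axisGap ε` vanishes. -/
def offAxis (ε : Bool) : Set E3 := {x | 0 < axisGap ε x}

lemma continuous_axisGap (ε : Bool) : Continuous (axisGap ε) := by
  have := fun j : Fin 3 => (contDiff_coord (n := 0) j).continuous
  unfold axisGap
  cases ε <;> simp only [cond_true, cond_false] <;> fun_prop

lemma isOpen_offAxis (ε : Bool) : IsOpen (offAxis ε) :=
  isOpen_lt continuous_const (continuous_axisGap ε)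

lemma ne_zero_of_mem_offAxis {ε : Bool} {x : E3} (h : x ∈ offAxis ε) : x ≠ 0 := by
  rintro rfl
  cases ε <;> simp [offAxis, axisGap] at h

lemma exists_mem_offAxis {x : E3} (hx : x ≠ 0) : ∃ ε, x ∈ offAxis ε := by
  have := norm_pos_iff.2 hx
  by_contra! h
  have h1 := h true
  have h2 := h false
  simp only [offAxis, axisGap, Set.mem_ofPred_eq, not_lt, cond_true, cond_false] at h1 h2
  linarith

lemma axisGap_hopf (ε : Bool) (q : E4) :
    axisGap ε (hopf q) = 2 * Complex.normSq (spinor ε q) := by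
  rw [axisGap, norm_hopf, norm_sq_E4]
  cases ε <;> simp [Complex.normSq_apply, spinor_true, spinor_false] <;> ring

lemma hopf_mem_offAxis {ε : Bool} {q : E4} : hopf q ∈ offAxis ε ↔ spinor ε q ≠ 0 := by
  simp [offAxis, axisGap_hopf]

/-- The modulus `√((|x| ± x₂) / 2)` of the leading coordinate of the local section. -/
noncomputable def secMod (ε : Bool) (x : E3) : ℝ := √(axisGap ε x / 2)

lemma secMod_pos {ε : Bool} {x : E3} (h : x ∈ offAxis ε) : 0 < secMod ε x :=
  Real.sqrt_pos.2 (div_pos h two_pos)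

/-- The section of the Hopf map over `offAxis ε` whose coordinate `ε` is real and positive. -/
noncomputable def hopfSec (ε : Bool) (x : E3) : E4 :=
  bif ε then !₂[secMod true x, 0, x 0 / (2 * secMod true x), x 1 / (2 * secMod true x)]
  else !₂[x 0 / (2 * secMod false x), -(x 1 / (2 * secMod false x)), secMod false x, 0]

lemma spinor_hopfSec (ε : Bool) (x : E3) : spinor ε (hopfSec ε x) = (secMod ε x : ℂ) := by
  cases ε <;> apply Complex.ext <;> simp [hopfSec, spinor_true, spinor_false]

lemma hopf_hopfSec {ε : Bool} {x : E3} (h : x ∈ offAxis ε) : hopf (hopfSec ε x) = x := by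
  have hp := secMod_pos h
  have hsq : secMod ε x ^ 2 = axisGap ε x / 2 := Real.sq_sqrt (div_pos h two_pos).le
  have hx := norm_sq_E3 x
  cases ε
  · simp only [axisGap, cond_false] at hsq
    have key : (x 0 / (2 * secMod false x)) ^ 2 + (x 1 / (2 * secMod false x)) ^ 2
        = (‖x‖ + x 2) / 2 := by
      rw [div_pow, div_pow, ← add_div, mul_pow, hsq, div_eq_iff
        (by have := pow_pos hp 2; rw [hsq] at this; positivity)]
      linear_combination -hx
    apply E3_ext
    · simp [hopfSec]; field_simp
    · simp [hopfSec]; field_simp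
    · simp [hopfSec]; rw [key, hsq]; ring
  · simp only [axisGap, cond_true] at hsq
    have key : (x 0 / (2 * secMod true x)) ^ 2 + (x 1 / (2 * secMod true x)) ^ 2
        = (‖x‖ - x 2) / 2 := by
      rw [div_pow, div_pow, ← add_div, mul_pow, hsq, div_eq_iff
        (by have := pow_pos hp 2; rw [hsq] at this; positivity)]
      linear_combination -hx
    apply E3_ext
    · simp [hopfSec]; field_simp
    · simp [hopfSec]; field_simp
    · simp [hopfSec]; rw [hsq]; linear_combination -key

lemma hopfSec_ne_zero {ε : Bool} {x : E3} (h : x ∈ offAxis ε) : hopfSec ε x ≠ 0 := by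
  intro h0
  have := hopf_hopfSec h
  rw [h0, hopf_eq_zero.2 rfl] at this
  exact ne_zero_of_mem_offAxis h this.symm

lemma contDiffAt_secMod {ε : Bool} {x : E3} {n : WithTop ℕ∞} (h : x ∈ offAxis ε) :
    ContDiffAt ℝ n (secMod ε) x := by
  have h1 : ContDiffAt ℝ n (fun y : E3 => ‖y‖) x := contDiffAt_norm ℝ (ne_zero_of_mem_offAxis h)
  have h2 := (contDiff_coord (n := n) (2 : Fin 3)).contDiffAt (x := x)
  have h3 : ContDiffAt ℝ n (fun y => axisGap ε y / 2) x := by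
    cases ε <;> simp only [axisGap, cond_true, cond_false] <;> fun_prop
  exact h3.sqrt (div_pos h two_pos).ne'

lemma contDiffAt_hopfSec {ε : Bool} {x : E3} {n : WithTop ℕ∞} (h : x ∈ offAxis ε) :
    ContDiffAt ℝ n (hopfSec ε) x := by
  have h0 := (contDiff_coord (n := n) (0 : Fin 3)).contDiffAt (x := x)
  have h1 := (contDiff_coord (n := n) (1 : Fin 3)).contDiffAt (x := x)
  have hm := contDiffAt_secMod (n := n) h
  have hne : 2 * secMod ε x ≠ 0 := by have := secMod_pos h; positivity
  have hm2 : ContDiffAt ℝ n (fun y => 2 * secMod ε y) x := contDiffAt_const.mul hm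
  have d0 := h0.fun_div hm2 hne
  have d1 := h1.fun_div hm2 hne
  rw [contDiffAt_euclidean]
  intro i
  cases ε <;> fin_cases i
  · simpa [hopfSec] using d0
  · simpa [hopfSec] using d1.neg
  · simpa [hopfSec] using hm
  · simpa [hopfSec] using contDiffAt_const
  · simpa [hopfSec] using hm
  · simpa [hopfSec] using contDiffAt_const
  · simpa [hopfSec] using d0
  · simpa [hopfSec] using d1

lemma dhopf_fderiv_hopfSec {ε : Bool} {x : E3} (h : x ∈ offAxis ε) (v : E3) :
    dhopf (hopfSec ε x) (fderiv ℝ (hopfSec ε) x v) = v := by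
  have h1 : hopf ∘ hopfSec ε =ᶠ[𝓝 x] id := by
    filter_upwards [(isOpen_offAxis ε).mem_nhds h] with y hy
    exact hopf_hopfSec hy
  have h2 := h1.fderiv_eq (𝕜 := ℝ)
  have hd : DifferentiableAt ℝ (hopfSec ε) x :=
    (contDiffAt_hopfSec (n := 1) h).differentiableAt (by norm_num)
  rw [fderiv_comp x ((contDiff_hopf (n := 1)).differentiable (by norm_num) _) hd, fderiv_id] at h2
  rw [← fderiv_hopf]
  exact congrArg (fun L => L v) h2

/-- The Dirac potential: the Hopf connection in the gauge `hopfSec ε`. -/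
noncomputable def diracForm (ε : Bool) : E3 → E3 →L[ℝ] ℝ := pullForm (hopfSec ε) hopfConn

lemma contDiffAt_pullForm {V W : Type*} [NormedAddCommGroup V] [NormedSpace ℝ V]
    [NormedAddCommGroup W] [NormedSpace ℝ W] {F : V → W} {α : W → W →L[ℝ] ℝ} {x : V}
    (hF : ContDiffAt ℝ ∞ F x) (hα : ContDiffAt ℝ ∞ α (F x)) :
    ContDiffAt ℝ ∞ (pullForm F α) x :=
  (hα.comp x hF).clm_comp (hF.fderiv_right (m := ∞) (by simp))

lemma contDiffAt_diracForm {ε : Bool} {x : E3} (h : x ∈ offAxis ε) :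
    ContDiffAt ℝ ∞ (diracForm ε) x :=
  contDiffAt_pullForm (contDiffAt_hopfSec h) (contDiffAt_hopfConn (hopfSec_ne_zero h))

/-- The monopole equation in a gauge: the Dirac potential has curvature `-∗d(1 / 2|x|)`. -/
lemma extD_diracForm {ε : Bool} {x : E3} (h : x ∈ offAxis ε) (u v : E3) :
    extD (diracForm ε) x u v = -fderiv ℝ newton x (cross u v) := by
  rw [diracForm, extD_pullForm (contDiffAt_hopfSec h)
    ((contDiffAt_hopfConn (n := 1) (hopfSec_ne_zero h)).differentiableAt (by norm_num)),
    extD_hopfConn (hopfSec_ne_zero h), hopf_hopfSec h, dhopf_fderiv_hopfSec h,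
    dhopf_fderiv_hopfSec h]


/-! ### Tensor products of spinors -/

section Tensor

variable {ι : Type} [Fintype ι] [DecidableEq ι]

/-- The components of the tensor product of a family of vectors of `ℂ²`. -/
noncomputable def tens (Q : ι → E4) (b : ι → Bool) : ℂ := ∏ i, spinor (b i) (Q i)

lemma tens_hopfRot (t : ι → ℝ) (Q : ι → E4) (b : ι → Bool) :
    tens (fun i => hopfRot (t i) (Q i)) b =
        Complex.exp ((∑ i, t i : ℝ) * Complex.I) * tens Q b := by
  simp only [tens, spinor_hopfRot]
  rw [Finset.prod_mul_distrib, ← Complex.exp_sum]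
  congr 2
  push_cast
  rw [Finset.sum_mul]

lemma tens_update_hopfRot (Q : ι → E4) (i : ι) (t : ℝ) (q : E4) (b : ι → Bool) :
    tens (Function.update Q i (hopfRot t q)) b =
      Complex.exp (t * Complex.I) * tens (Function.update Q i q) b := by
  have h := tens_hopfRot (Function.update (fun _ => 0) i t) (Function.update Q i q) b
  have h1 : (fun j => hopfRot (Function.update (fun _ => (0 : ℝ)) i t j)
      (Function.update Q i q j)) = Function.update Q i (hopfRot t q) := by
    ext1 j
    by_cases hj : j = i
    · subst hj; simp
    · simp [hj, hopfRot_zero]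
  have h2 : ∑ j, Function.update (fun _ => (0 : ℝ)) i t j = t := by
    rw [Finset.sum_update_of_mem (Finset.mem_univ i)]; simp
  rw [h1, h2] at h
  exact h

lemma tens_update_same (Q : ι → E4) (i : ι) (q : E4) (b : ι → Bool) (β : Bool) :
    tens (Function.update Q i q) (Function.update b i β) =
      spinor β q * ∏ j ∈ Finset.univ.erase i, spinor (b j) (Q j) := by
  rw [tens, ← Finset.mul_prod_erase _ _ (Finset.mem_univ i)]
  congr 1
  · simp
  · refine Finset.prod_congr rfl fun j hj => ?_
    have := Finset.ne_of_mem_erase hj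
    simp [this]

/-- The Hermitian product of `ℂ²`. -/
noncomputable def herm (q u : E4) : ℂ :=
  ∑ β : Bool, (starRingEnd ℂ) (spinor β q) * spinor β u

lemma herm_self (q : E4) : herm q q = (‖q‖ ^ 2 : ℝ) := by
  rw [← normSq_spinor_add, herm, Fintype.sum_bool]
  push_cast
  rw [Complex.normSq_eq_conj_mul_self, Complex.normSq_eq_conj_mul_self]

lemma herm_im (q u : E4) : (herm q u).im = angForm q u := by
  rw [angForm_apply, herm, Fintype.sum_bool]
  simp [spinor_true, spinor_false]; ring

lemma sum_conj_tens_mul_tens (Q R : ι → E4) :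
    ∑ b, (starRingEnd ℂ) (tens Q b) * tens R b = ∏ i, herm (Q i) (R i) := by
  simp only [herm, tens, map_prod]
  rw [Finset.prod_univ_sum, Fintype.piFinset_univ]
  simp [Finset.prod_mul_distrib]

lemma sum_normSq_tens (Q : ι → E4) : ∑ b, Complex.normSq (tens Q b) = ∏ i, ‖Q i‖ ^ 2 := by
  have h := sum_conj_tens_mul_tens Q Q
  simp only [herm_self, ← Complex.normSq_eq_conj_mul_self] at h
  exact_mod_cast h

end Tensor

/-! ### The total space of the Gibbons-Hawking fibration -/

section TotalSpace

variable {ι : Type} [Fintype ι] [DecidableEq ι]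

lemma hopf_surjective : Function.Surjective hopf := by
  intro x
  by_cases hx : x = 0
  · exact ⟨0, by rw [hx]; exact hopf_eq_zero.2 rfl⟩
  · obtain ⟨ε, h⟩ := exists_mem_offAxis hx
    exact ⟨_, hopf_hopfSec h⟩

/-- The points of the total space: pairs of a point `x` of `ℝ³` and a tensor `⊗ qᵢ`, where `qᵢ` is
a point of `ℂ²` over `x - P i` under the Hopf map. Away from the centres this is the tensor product
of the pulled back Hopf circle bundles; over a centre the tensor vanishes and the fibre is a
point. -/
def totalSet (P : ι ↪ E3) : Set (E3 × ((ι → Bool) → ℂ)) :=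
  {y | ∃ Q : ι → E4, (∀ i, hopf (Q i) = y.1 - P i) ∧ y.2 = tens Q}

/-- The total space of the Gibbons-Hawking fibration with centres `P i`. -/
abbrev GHBundle (P : ι ↪ E3) : Type := totalSet P

namespace GHBundle

variable {P : ι ↪ E3}

/-- The projection to `ℝ³`. -/
def pr (y : GHBundle P) : E3 := y.1.1

/-- The tensor coordinates. -/
def tn (y : GHBundle P) : (ι → Bool) → ℂ := y.1.2

lemma continuous_pr : Continuous (pr : GHBundle P → E3) :=
    continuous_fst.comp continuous_subtype_val

lemma continuous_tn : Continuous (tn : GHBundle P → _) := continuous_snd.comp continuous_subtype_val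

lemma ext' {y z : GHBundle P} (h : pr y = pr z) (h' : tn y = tn z) : y = z :=
  Subtype.ext (Prod.ext h h')

lemma pr_surjective : Function.Surjective (pr : GHBundle P → E3) := by
  intro x
  choose Q hQ using fun i => hopf_surjective (x - P i)
  exact ⟨⟨(x, tens Q), Q, hQ, rfl⟩, rfl⟩

/-- The circle action. -/
noncomputable def rot [Nonempty ι] (t : ℝ) (y : GHBundle P) : GHBundle P :=
  ⟨(y.1.1, fun b => Complex.exp (t * Complex.I) * y.1.2 b), by
    obtain ⟨Q, hQ, hT⟩ := y.2
    let i := Classical.arbitrary ι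
    refine ⟨Function.update Q i (hopfRot t (Q i)), fun j => ?_, ?_⟩
    · by_cases hj : j = i
      · subst hj; simp [hopf_hopfRot, hQ]
      · simp [hj, hQ]
    · ext b
      simp only [hT]
      rw [tens_update_hopfRot, Function.update_eq_self]⟩

@[simp] lemma pr_rot [Nonempty ι] (t : ℝ) (y : GHBundle P) : pr (rot t y) = pr y := rfl
@[simp] lemma tn_rot [Nonempty ι] (t : ℝ) (y : GHBundle P) (b : ι → Bool) :
    tn (rot t y) b = Complex.exp (t * Complex.I) * tn y b := rfl

lemma rot_zero [Nonempty ι] (y : GHBundle P) : rot 0 y = y :=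
  ext' rfl (by ext b; simp)

lemma rot_add [Nonempty ι] (s t : ℝ) (y : GHBundle P) : rot (s + t) y = rot s (rot t y) :=
  ext' rfl (by ext b; simp [add_mul, Complex.exp_add, mul_assoc])

lemma rot_two_pi [Nonempty ι] (y : GHBundle P) : rot (2 * Real.pi) y = y :=
  ext' rfl (by ext b; simp [Complex.exp_two_pi_mul_I])

/-- The fibres of the projection are the orbits of the circle action. -/
lemma pr_eq_iff [Nonempty ι] (y z : GHBundle P) : pr y = pr z ↔ ∃ t, rot t y = z := by
  constructor
  · intro h
    obtain ⟨Q, hQ, hT⟩ := y.2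
    obtain ⟨R, hR, hT'⟩ := z.2
    have hQR : ∀ i, hopf (Q i) = hopf (R i) := fun i => by
      rw [hQ, hR]; exact congrArg (· - P i) h
    choose t ht using fun i => exists_hopfRot_of_hopf_eq (hQR i)
    refine ⟨∑ i, t i, ext' h ?_⟩
    ext b
    have : R = fun i => hopfRot (t i) (Q i) := funext ht
    rw [tn_rot]
    change _ * y.1.2 b = z.1.2 b
    rw [hT, hT', this, tens_hopfRot]
  · rintro ⟨t, rfl⟩; rfl

lemma sum_normSq_tn (y : GHBundle P) :
    ∑ b, Complex.normSq (tn y b) = ∏ i, ‖pr y - P i‖ := by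
  obtain ⟨Q, hQ, hT⟩ := y.2
  change ∑ b, Complex.normSq (y.1.2 b) = _
  rw [hT, sum_normSq_tens]
  refine Finset.prod_congr rfl fun i _ => ?_
  rw [← norm_hopf, hQ]; rfl

lemma rot_free [Nonempty ι] (y : GHBundle P) (hy : ∀ i, pr y ≠ P i) (t : ℝ) (h : rot t y = y) :
    ∃ n : ℤ, t = n * (2 * Real.pi) := by
  have h1 : ∑ b, Complex.normSq (tn y b) ≠ 0 := by
    rw [sum_normSq_tn]
    exact Finset.prod_ne_zero_iff.2 fun i _ => norm_ne_zero_iff.2 (sub_ne_zero.2 (hy i))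
  obtain ⟨b, -, hb⟩ := Finset.exists_ne_zero_of_sum_ne_zero h1
  have hb' : tn y b ≠ 0 := fun h0 => hb (by simp [h0])
  have h2 : Complex.exp (t * Complex.I) * tn y b = tn y b := by
    rw [← tn_rot, h]
  have h3 := mul_right_cancel₀ hb' (h2.trans (one_mul _).symm)
  obtain ⟨n, hn⟩ := Complex.exp_eq_one_iff.1 h3
  refine ⟨n, ?_⟩
  have h4 : (t : ℂ) = n * (2 * Real.pi) := by
    have := Complex.I_ne_zero
    apply mul_right_cancel₀ this
    rw [hn]; ring
  exact_mod_cast h4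

/-! ### Hopf charts -/

/-- A choice of gauges near the centre `P i`. -/
noncomputable def centreGauge (P : ι ↪ E3) (i : ι) (j : ι) : Bool :=
  open Classical in if P i - P j ∈ offAxis true then true else false

lemma centreGauge_spec (P : ι ↪ E3) {i j : ι} (h : j ≠ i) :
    P i - P j ∈ offAxis (centreGauge P i j) := by
  unfold centreGauge
  split_ifs with h1
  · exact h1
  · obtain ⟨ε, hε⟩ := exists_mem_offAxis (sub_ne_zero.2 fun e => h (P.injective e).symm)
    cases ε
    · exact hε
    · exact absurd hε h1

variable (P) in
/-- The open subset of `ℝ³` over which the Hopf chart with index `i` and gauges `ε` is defined. The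
last condition leaves a single choice of gauges for the charts around the point over `P i`. -/
def chartBase (i : ι) (ε : ι → Bool) : Set E3 :=
  {x | ∀ j, j ≠ i → x - P j ∈ offAxis (ε j)} ∩ {x | x = P i → ε = centreGauge P i}

lemma isOpen_chartBase (i : ι) (ε : ι → Bool) : IsOpen (chartBase P i ε) := by
  apply IsOpen.inter
  · have : {x : E3 | ∀ j, j ≠ i → x - P j ∈ offAxis (ε j)} =
        ⋂ j, {x : E3 | j ≠ i → x - P j ∈ offAxis (ε j)} := by ext; simp
    rw [this]
    refine isOpen_iInter_of_finite fun j => ?_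
    by_cases hj : j = i
    · simp [hj]
    · simp only [ne_eq, hj, not_false_eq_true, forall_const]
      exact (isOpen_offAxis (ε j)).preimage (continuous_id.sub continuous_const)
  · by_cases h : ε = centreGauge P i
    · simp only [h, implies_true]; exact isOpen_univ
    · have : {x : E3 | x = P i → ε = centreGauge P i} = {P i}ᶜ := by
        ext x; simp [h]
      rw [this]; exact isOpen_compl_singleton

lemma exists_mem_chartBase [Nonempty ι] (x : E3) : ∃ i ε, x ∈ chartBase P i ε := by
  by_cases h : ∃ i, x = P i
  · obtain ⟨i, rfl⟩ := h
    exact ⟨i, centreGauge P i, fun j hj => centreGauge_spec P hj, fun _ => rfl⟩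
  · push Not at h
    choose ε hε using fun i => exists_mem_offAxis (sub_ne_zero.2 (h i))
    exact ⟨Classical.arbitrary ι, ε, fun j _ => hε j, fun h' => absurd h' (h _)⟩

variable (P) in
/-- The family of points of `ℂ²` over `x - P j`, for `x = P i + hopf q`, with `i`-th member `q` and
the other members in the gauges `ε`. -/
noncomputable def lift (i : ι) (ε : ι → Bool) (q : E4) : ι → E4 :=
  Function.update (fun j => hopfSec (ε j) (P i + hopf q - P j)) i q

@[simp] lemma lift_same (i : ι) (ε : ι → Bool) (q : E4) : lift P i ε q i = q := by simp [lift]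

lemma lift_of_ne {i j : ι} (h : j ≠ i) (ε : ι → Bool) (q : E4) :
    lift P i ε q j = hopfSec (ε j) (P i + hopf q - P j) := by simp [lift, h]

lemma hopf_lift {i : ι} {ε : ι → Bool} {q : E4} (h : P i + hopf q ∈ chartBase P i ε) (j : ι) :
    hopf (lift P i ε q j) = P i + hopf q - P j := by
  by_cases hj : j = i
  · subst hj; simp
  · rw [lift_of_ne hj, hopf_hopfSec (h.1 j hj)]

/-- Every point over the base of a Hopf chart has a representative of the normal form `lift`. -/
lemma exists_lift (y : GHBundle P) {i : ι} {ε : ι → Bool} (h : pr y ∈ chartBase P i ε) :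
    ∃ q, P i + hopf q = pr y ∧ tn y = tens (lift P i ε q) := by
  obtain ⟨Q, hQ, hT⟩ := y.2
  set R : ι → E4 := Function.update (fun j => hopfSec (ε j) (pr y - P j)) i (Q i) with hR
  have hRQ : ∀ j, hopf (R j) = hopf (Q j) := by
    intro j
    by_cases hj : j = i
    · subst hj; simp [hR]
    · simp only [hR, Function.update_of_ne hj]; rw [hopf_hopfSec (h.1 j hj), hQ]; rfl
  choose t ht using fun j => exists_hopfRot_of_hopf_eq (hRQ j)
  have hp : P i + hopf (hopfRot (∑ j, t j) (Q i)) = pr y := by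
    rw [hopf_hopfRot, hQ]; simp [pr]
  refine ⟨hopfRot (∑ j, t j) (Q i), hp, ?_⟩
  ext b
  have : Q = fun j => hopfRot (t j) (R j) := funext ht
  change y.1.2 b = _
  rw [hT, lift, tens_update_hopfRot, hp, ← hR]
  conv_lhs => rw [this]
  rw [tens_hopfRot]

lemma contDiffAt_lift {i : ι} {ε : ι → Bool} {q : E4} {n : WithTop ℕ∞}
    (h : P i + hopf q ∈ chartBase P i ε) (j : ι) :
    ContDiffAt ℝ n (fun p => lift P i ε p j) q := by
  by_cases hj : j = i
  · subst hj; simpa using! contDiffAt_id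
  · simp only [lift_of_ne hj]
    exact (contDiffAt_hopfSec (h.1 j hj)).comp q
      ((contDiffAt_const.add contDiff_hopf.contDiffAt).sub contDiffAt_const)

lemma contDiffAt_tens_lift {i : ι} {ε : ι → Bool} {q : E4} {n : WithTop ℕ∞}
    (h : P i + hopf q ∈ chartBase P i ε) :
    ContDiffAt ℝ n (fun p => tens (lift P i ε p)) q := by
  rw [contDiffAt_pi]
  intro b
  unfold tens
  exact contDiffAt_prod fun j _ => (spinor (b j)).contDiff.contDiffAt.comp q (contDiffAt_lift h j)

variable (P) in
/-- The coordinate of a Hopf chart, as a function on the ambient space. -/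
noncomputable def chartFun (i : ι) (ε : ι → Bool) (x : E3) (T : (ι → Bool) → ℂ) : E4 :=
  ofSpinor fun β => T (Function.update ε i β) /
    ((∏ j ∈ Finset.univ.erase i, secMod (ε j) (x - P j) : ℝ) : ℂ)

lemma prod_secMod_pos {i : ι} {ε : ι → Bool} {x : E3} (h : x ∈ chartBase P i ε) :
    0 < ∏ j ∈ Finset.univ.erase i, secMod (ε j) (x - P j) :=
  Finset.prod_pos fun j hj => secMod_pos (h.1 j (Finset.ne_of_mem_erase hj))

lemma chartFun_lift {i : ι} {ε : ι → Bool} {q : E4} (h : P i + hopf q ∈ chartBase P i ε) :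
    chartFun P i ε (P i + hopf q) (tens (lift P i ε q)) = q := by
  have hp := (prod_secMod_pos h).ne'
  have : ∀ β, tens (lift P i ε q) (Function.update ε i β) /
      ((∏ j ∈ Finset.univ.erase i, secMod (ε j) (P i + hopf q - P j) : ℝ) : ℂ) = spinor β q := by
    intro β
    rw [lift, tens_update_same, div_eq_iff (by exact_mod_cast hp)]
    congr 1
    push_cast
    exact Finset.prod_congr rfl fun j _ => spinor_hopfSec _ _
  unfold chartFun
  simp only [this]
  exact ofSpinor_spinor q

lemma contDiff_ofSpinor {V : Type*} [NormedAddCommGroup V] [NormedSpace ℝ V] {n : WithTop ℕ∞}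
    {f : V → Bool → ℂ} {x : V} (h : ∀ b, ContDiffAt ℝ n (fun y => f y b) x) :
    ContDiffAt ℝ n (fun y => ofSpinor (f y)) x := by
  have hr := fun b => Complex.reCLM.contDiff.contDiffAt.comp x (h b)
  have hi := fun b => Complex.imCLM.contDiff.contDiffAt.comp x (h b)
  rw [contDiffAt_euclidean]
  intro i
  fin_cases i
  · exact hr true
  · exact hi true
  · exact hr false
  · exact hi false

lemma contDiffAt_chartFun {i : ι} {ε : ι → Bool} {x : E3} {T : (ι → Bool) → ℂ}
    {n : WithTop ℕ∞} (h : x ∈ chartBase P i ε) :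
    ContDiffAt ℝ n (fun p : E3 × ((ι → Bool) → ℂ) => chartFun P i ε p.1 p.2) (x, T) := by
  unfold chartFun
  apply contDiff_ofSpinor
  intro β
  have h1 : ContDiffAt ℝ n (fun p : E3 × ((ι → Bool) → ℂ) =>
      ∏ j ∈ Finset.univ.erase i, secMod (ε j) (p.1 - P j)) (x, T) := by
    refine contDiffAt_prod fun j hj => ?_
    exact (contDiffAt_secMod (h.1 j (Finset.ne_of_mem_erase hj))).comp (x, T)
      (f := fun p : E3 × ((ι → Bool) → ℂ) => p.1 - P j)
      (contDiffAt_fst.sub contDiffAt_const)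
  have h2 : ContDiffAt ℝ n (fun p : E3 × ((ι → Bool) → ℂ) =>
      ((∏ j ∈ Finset.univ.erase i, secMod (ε j) (p.1 - P j) : ℝ) : ℂ)) (x, T) :=
    Complex.ofRealCLM.contDiff.contDiffAt.comp (x, T) h1
  have h3 : ContDiffAt ℝ n (fun p : E3 × ((ι → Bool) → ℂ) => p.2 (Function.update ε i β)) (x, T) :=
    (contDiff_apply ℝ ℂ (Function.update ε i β)).contDiffAt.comp (x, T) contDiffAt_snd
  simp only [div_eq_mul_inv]
  exact h3.mul (h2.inv (by exact_mod_cast (prod_secMod_pos h).ne'))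

open Classical in
variable (P) in
/-- The chart of the total space with values in `ℂ²` in which the projection is `P i + hopf q`. -/
noncomputable def hopfChart (i : ι) (ε : ι → Bool) : OpenPartialHomeomorph (GHBundle P) E4 where
  toFun y := chartFun P i ε (pr y) (tn y)
  invFun q := if h : P i + hopf q ∈ chartBase P i ε then
      ⟨(P i + hopf q, tens (lift P i ε q)), lift P i ε q, fun j => hopf_lift h j, rfl⟩
    else (pr_surjective (P := P) 0).choose
  source := {y | pr y ∈ chartBase P i ε}
  target := {q | P i + hopf q ∈ chartBase P i ε}
  map_source' y hy := by
    obtain ⟨q, hq, hT⟩ := exists_lift y hy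
    have hq' : P i + hopf q ∈ chartBase P i ε := hq ▸ hy
    rw [hT, ← hq, chartFun_lift hq']
    exact hq'
  map_target' q hq := by
    simp only [Set.mem_ofPred_eq] at hq
    simp only [hq, dif_pos]
    exact hq
  left_inv' y hy := by
    obtain ⟨q, hq, hT⟩ := exists_lift y hy
    have hq' : P i + hopf q ∈ chartBase P i ε := hq ▸ hy
    rw [hT, ← hq, chartFun_lift hq', dif_pos hq']
    exact ext' hq hT.symm
  right_inv' q hq := by
    simp only [Set.mem_ofPred_eq] at hq
    simp only [hq, dif_pos]
    exact chartFun_lift hq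
  open_source := (isOpen_chartBase i ε).preimage continuous_pr
  open_target := (isOpen_chartBase i ε).preimage
    (continuous_const.add (contDiff_hopf (n := 0)).continuous)
  continuousOn_toFun y hy :=
    ((contDiffAt_chartFun (n := 0) (T := tn y) hy).continuousAt.comp
      (f := fun z : GHBundle P => (pr z, tn z))
      (continuous_pr.prodMk continuous_tn).continuousAt).continuousWithinAt
  continuousOn_invFun := by
    rw [Topology.IsInducing.subtypeVal.continuousOn_iff]
    have : ContinuousOn (fun q => (P i + hopf q, tens (lift P i ε q)))
        {q | P i + hopf q ∈ chartBase P i ε} := by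
      intro q hq
      exact ((continuous_const.add (contDiff_hopf (n := 0)).continuous).continuousAt.prodMk
        (contDiffAt_tens_lift (n := 0) hq).continuousAt).continuousWithinAt
    refine this.congr fun q hq => ?_
    simp only [Set.mem_ofPred_eq] at hq
    simp [hq]

lemma hopfChart_apply (i : ι) (ε : ι → Bool) (y : GHBundle P) :
    hopfChart P i ε y = chartFun P i ε (pr y) (tn y) := rfl

lemma mem_hopfChart_target {i : ι} {ε : ι → Bool} {q : E4} :
    q ∈ (hopfChart P i ε).target ↔ P i + hopf q ∈ chartBase P i ε := Iff.rfl

lemma pr_hopfChart_symm {i : ι} {ε : ι → Bool} {q : E4} (h : q ∈ (hopfChart P i ε).target) :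
    pr ((hopfChart P i ε).symm q) = P i + hopf q := by
  have : (hopfChart P i ε).symm q = _ := dif_pos (mem_hopfChart_target.1 h)
  rw [this]; rfl

lemma tn_hopfChart_symm {i : ι} {ε : ι → Bool} {q : E4} (h : q ∈ (hopfChart P i ε).target) :
    tn ((hopfChart P i ε).symm q) = tens (lift P i ε q) := by
  have : (hopfChart P i ε).symm q = _ := dif_pos (mem_hopfChart_target.1 h)
  rw [this]; rfl

/-- In a Hopf chart the projection is the Hopf map. -/
lemma pr_eq_hopf {i : ι} {ε : ι → Bool} {y : GHBundle P} (h : y ∈ (hopfChart P i ε).source) :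
    pr y = P i + hopf (hopfChart P i ε y) := by
  rw [← pr_hopfChart_symm ((hopfChart P i ε).map_source h), (hopfChart P i ε).left_inv h]

lemma tn_eq_tens {i : ι} {ε : ι → Bool} {y : GHBundle P} (h : y ∈ (hopfChart P i ε).source) :
    tn y = tens (lift P i ε (hopfChart P i ε y)) := by
  rw [← tn_hopfChart_symm ((hopfChart P i ε).map_source h), (hopfChart P i ε).left_inv h]

/-- In a Hopf chart the circle action is the diagonal one. -/
lemma hopfChart_rot [Nonempty ι] {i : ι} {ε : ι → Bool} (y : GHBundle P) (t : ℝ) :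
    hopfChart P i ε (rot t y) = hopfRot t (hopfChart P i ε y) := by
  have : ∀ β, spinor β (hopfChart P i ε (rot t y)) =
      spinor β (hopfRot t (hopfChart P i ε y)) := by
    intro β
    rw [spinor_hopfRot, hopfChart_apply, hopfChart_apply, chartFun, chartFun, spinor_ofSpinor,
      spinor_ofSpinor, tn_rot, pr_rot, mul_div_assoc]
  rw [← ofSpinor_spinor (hopfChart P i ε (rot t y)), funext this, ofSpinor_spinor]

/-- The transition maps between Hopf charts are smooth. -/
lemma contDiffOn_transition (i j : ι) (ε δ : ι → Bool) :
    ContDiffOn ℝ ∞ (hopfChart P j δ ∘ (hopfChart P i ε).symm)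
      ((hopfChart P i ε).symm.trans (hopfChart P j δ)).source := by
  intro q hq
  rw [OpenPartialHomeomorph.trans_source] at hq
  have h1 : q ∈ (hopfChart P i ε).target := hq.1
  have h2 : pr ((hopfChart P i ε).symm q) ∈ chartBase P j δ := hq.2
  rw [pr_hopfChart_symm h1] at h2
  have h3 : ContDiffAt ℝ ∞ (fun p => chartFun P j δ (P i + hopf p) (tens (lift P i ε p))) q :=
    (contDiffAt_chartFun h2).comp q (f := fun p => (P i + hopf p, tens (lift P i ε p)))
      ((contDiffAt_const.add contDiff_hopf.contDiffAt).prodMk (contDiffAt_tens_lift h1))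
  refine (h3.congr_of_eventuallyEq ?_).contDiffWithinAt
  filter_upwards [(hopfChart P i ε).open_target.mem_nhds h1] with p hp
  simp only [Function.comp_apply, hopfChart_apply]
  rw [pr_hopfChart_symm hp, tn_hopfChart_symm hp]

variable [Nonempty ι]

noncomputable instance : ChartedSpace E4 (GHBundle P) where
  atlas := {e | ∃ i ε, e = hopfChart P i ε}
  chartAt y := hopfChart P (exists_mem_chartBase (P := P) (pr y)).choose
    (exists_mem_chartBase (P := P) (pr y)).choose_spec.choose
  mem_chart_source _ := (exists_mem_chartBase (P := P) _).choose_spec.choose_spec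
  chart_mem_atlas _ := ⟨_, _, rfl⟩

lemma hopfChart_mem_atlas (i : ι) (ε : ι → Bool) :
    hopfChart P i ε ∈ atlas E4 (GHBundle P) := ⟨i, ε, rfl⟩

instance : IsManifold I4 ∞ (GHBundle P) := by
  refine isManifold_of_contDiffOn I4 ∞ (GHBundle P) ?_
  rintro _ _ ⟨i, ε, rfl⟩ ⟨j, δ, rfl⟩
  simpa using contDiffOn_transition i j ε δ

/-! ### Topology of the total space -/

lemma isCompact_hopf_preimage (K : Set E3) (hK : IsCompact K) : IsCompact (hopf ⁻¹' K) := by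
  obtain ⟨r, hr⟩ := hK.isBounded.exists_norm_le
  refine Metric.isCompact_of_isClosed_isBounded
    (hK.isClosed.preimage (contDiff_hopf (n := 0)).continuous) ?_
  refine isBounded_iff_forall_norm_le.2 ⟨1 + r, fun q hq => ?_⟩
  have := hr _ hq
  rw [norm_hopf] at this
  nlinarith [norm_nonneg q, sq_nonneg (‖q‖ - 1)]

/-- The projection is proper. -/
lemma isCompact_preimage_pr {K : Set E3} (hK : IsCompact K) :
    IsCompact (pr ⁻¹' K : Set (GHBundle P)) := by
  rw [Topology.IsInducing.subtypeVal.isCompact_iff]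
  set Z : Set (E3 × (ι → E4)) := {z | z.1 ∈ K ∧ ∀ i, hopf (z.2 i) = z.1 - P i} with hZ
  have hZc : IsCompact Z := by
    have hbig : IsCompact (K ×ˢ Set.univ.pi fun i => hopf ⁻¹' ((· - P i) '' K)) :=
      hK.prod (isCompact_univ_pi fun i =>
        isCompact_hopf_preimage _ (hK.image (continuous_id.sub continuous_const)))
    refine hbig.of_isClosed_subset ?_ ?_
    · refine (hK.isClosed.preimage continuous_fst).inter ?_
      have : {z : E3 × (ι → E4) | ∀ i, hopf (z.2 i) = z.1 - P i} =
        ⋂ i, {z : E3 × (ι → E4) | hopf (z.2 i) = z.1 - P i} := by ext; simp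
      change IsClosed {z : E3 × (ι → E4) | ∀ i, hopf (z.2 i) = z.1 - P i}
      rw [this]
      refine isClosed_iInter fun i => isClosed_eq ?_ ?_
      · exact (contDiff_hopf (n := 0)).continuous.comp ((continuous_apply i).comp continuous_snd)
      · exact continuous_fst.sub continuous_const
    · rintro ⟨x, Q⟩ ⟨hx, hQ⟩
      exact ⟨hx, fun i _ => ⟨x, hx, (hQ i).symm⟩⟩
  have hcont : Continuous fun z : E3 × (ι → E4) => (z.1, tens z.2) := by
    refine continuous_fst.prodMk (continuous_pi fun b => ?_)
    unfold tens
    exact continuous_finsetProd _ fun i _ =>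
      (spinor (b i)).continuous.comp ((continuous_apply i).comp continuous_snd)
  convert hZc.image hcont using 1
  ext ⟨x, T⟩
  constructor
  · rintro ⟨y, hy, hxy⟩
    obtain ⟨Q, hQ, hT⟩ := y.2
    refine ⟨(y.1.1, Q), ⟨hy, hQ⟩, ?_⟩
    rw [← hxy]
    exact Prod.ext rfl hT.symm
  · rintro ⟨⟨x', Q⟩, ⟨hx, hQ⟩, h⟩
    refine ⟨⟨(x', tens Q), Q, hQ, rfl⟩, hx, h⟩

lemma continuous_rot_left (y : GHBundle P) : Continuous fun t => rot t y := by
  refine Continuous.subtype_mk ?_ _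
  fun_prop

lemma isClosedMap_pr : IsClosedMap (pr : GHBundle P → E3) := by
  have : IsProperMap (pr : GHBundle P → E3) :=
    isProperMap_iff_isCompact_preimage.2 ⟨continuous_pr, fun K hK => isCompact_preimage_pr hK⟩
  exact this.isClosedMap

/-- The projection is a quotient map to the connected space `ℝ³`, and its fibres are circle orbits,
hence connected. -/
instance : ConnectedSpace (GHBundle P) := by
  have hq : Topology.IsQuotientMap (pr : GHBundle P → E3) :=
    isClosedMap_pr.isQuotientMap continuous_pr pr_surjective
  have hfib : ∀ x : E3, IsConnected (pr ⁻¹' {x} : Set (GHBundle P)) := by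
    intro x
    obtain ⟨y, rfl⟩ := pr_surjective (P := P) x
    have : (pr ⁻¹' {pr y} : Set (GHBundle P)) = Set.range fun t => rot t y := by
      ext z
      simp only [Set.mem_preimage, Set.mem_singleton_iff, Set.mem_range]
      rw [eq_comm]; exact pr_eq_iff y z
    rw [this]
    exact isConnected_range (continuous_rot_left y)
  obtain ⟨y, -⟩ := pr_surjective (P := P) 0
  have h := hq.isCoinducing.preimage_connectedComponent hfib y
  rw [PreconnectedSpace.connectedComponent_eq_univ, Set.preimage_univ] at h
  exact connectedSpace_iff_connectedComponent.2 ⟨y, h.symm⟩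

end GHBundle

end TotalSpace


/-! ### The total space with arbitrary preferred charts -/

section Recharted

variable {ι : Type} [Fintype ι] [DecidableEq ι] [Nonempty ι]

/-- A choice of preferred charts in the maximal smooth atlas of the total space. The tensors of the
construction do not depend on it, but Mathlib identifies tangent spaces with the model space through
the preferred charts, and the geodesic of interest is best seen in charts adapted to it. -/
structure ChartChoice (P : ι ↪ E3) where
  /-- the preferred chart around a point -/
  chart : GHBundle P → OpenPartialHomeomorph (GHBundle P) E4
  mem_atlas : ∀ y, chart y ∈ IsManifold.maximalAtlas I4 ∞ (GHBundle P)
  mem_source : ∀ y, y ∈ (chart y).source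

/-- The total space of the Gibbons-Hawking fibration, with a given choice of preferred charts. -/
def GHSpace (P : ι ↪ E3) (_ : ChartChoice P) : Type := GHBundle P

namespace GHSpace

variable {P : ι ↪ E3} {c : ChartChoice P}

instance : TopologicalSpace (GHSpace P c) := inferInstanceAs (TopologicalSpace (GHBundle P))
instance : T2Space (GHSpace P c) := inferInstanceAs (T2Space (GHBundle P))
instance : T3Space (GHSpace P c) := inferInstanceAs (T3Space (GHBundle P))
instance : SecondCountableTopology (GHSpace P c) :=
  inferInstanceAs (SecondCountableTopology (GHBundle P))
instance : ConnectedSpace (GHSpace P c) := inferInstanceAs (ConnectedSpace (GHBundle P))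

instance : ChartedSpace E4 (GHSpace P c) where
  atlas := IsManifold.maximalAtlas I4 ∞ (GHBundle P)
  chartAt := c.chart
  mem_chart_source := c.mem_source
  chart_mem_atlas := c.mem_atlas

instance : IsManifold I4 ∞ (GHSpace P c) where
  compatible he he' :=
    (contDiffGroupoid ∞ I4).compatible_of_mem_maximalAtlas (M := GHBundle P) he he'

/-- The projection to `ℝ³`. -/
def pr (y : GHSpace P c) : E3 := GHBundle.pr y
/-- The tensor coordinates. -/
def tn (y : GHSpace P c) : (ι → Bool) → ℂ := GHBundle.tn y
/-- The circle action. -/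
noncomputable def rot (t : ℝ) (y : GHSpace P c) : GHSpace P c := GHBundle.rot t y

/-- The Hopf charts. -/
noncomputable def hopfChart (i : ι) (ε : ι → Bool) : OpenPartialHomeomorph (GHSpace P c) E4 :=
  GHBundle.hopfChart P i ε

lemma hopfChart_mem_maximalAtlas (i : ι) (ε : ι → Bool) :
    (hopfChart i ε : OpenPartialHomeomorph (GHSpace P c) E4) ∈
      IsManifold.maximalAtlas I4 ∞ (GHSpace P c) :=
  IsManifold.subset_maximalAtlas
    (IsManifold.subset_maximalAtlas (M := GHBundle P) (GHBundle.hopfChart_mem_atlas i ε))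

lemma exists_hopfChart (y : GHSpace P c) :
    ∃ i ε, y ∈ (hopfChart i ε : OpenPartialHomeomorph (GHSpace P c) E4).source :=
  GHBundle.exists_mem_chartBase (P := P) (pr y)

variable {i : ι} {ε : ι → Bool} {y : GHSpace P c}

lemma pr_mem_chartBase (h : y ∈ (hopfChart i ε : OpenPartialHomeomorph (GHSpace P c) E4).source) :
    pr y ∈ GHBundle.chartBase P i ε := h

lemma pr_eq_hopf (h : y ∈ (hopfChart i ε : OpenPartialHomeomorph (GHSpace P c) E4).source) :
    pr y = P i + hopf (hopfChart i ε y) := GHBundle.pr_eq_hopf h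

lemma tn_eq_tens (h : y ∈ (hopfChart i ε : OpenPartialHomeomorph (GHSpace P c) E4).source) :
    tn y = tens (GHBundle.lift P i ε (hopfChart i ε y)) := GHBundle.tn_eq_tens h

lemma hopfChart_rot (t : ℝ) (y : GHSpace P c) :
    hopfChart i ε (rot t y) = hopfRot t (hopfChart i ε y) := GHBundle.hopfChart_rot y t

lemma rot_mem_source (t : ℝ)
    (h : y ∈ (hopfChart i ε : OpenPartialHomeomorph (GHSpace P c) E4).source) :
    rot t y ∈ (hopfChart i ε : OpenPartialHomeomorph (GHSpace P c) E4).source := h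

lemma contMDiffAt_hopfChart
    (h : y ∈ (hopfChart i ε : OpenPartialHomeomorph (GHSpace P c) E4).source) :
    ContMDiffAt I4 𝓘(ℝ, E4) ∞ (hopfChart i ε : OpenPartialHomeomorph (GHSpace P c) E4) y :=
  (contMDiffOn_of_mem_maximalAtlas (hopfChart_mem_maximalAtlas i ε)).contMDiffAt
    ((hopfChart i ε).open_source.mem_nhds h)

lemma contMDiffAt_hopfChart_symm {q : E4}
    (h : q ∈ (hopfChart i ε : OpenPartialHomeomorph (GHSpace P c) E4).target) :
    ContMDiffAt 𝓘(ℝ, E4) I4 ∞ (hopfChart i ε : OpenPartialHomeomorph (GHSpace P c) E4).symm q :=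
  (contMDiffOn_symm_of_mem_maximalAtlas (hopfChart_mem_maximalAtlas i ε)).contMDiffAt
    ((hopfChart i ε).open_target.mem_nhds h)

/-- The differential of a Hopf chart. -/
noncomputable def hopfD (i : ι) (ε : ι → Bool) (y : GHSpace P c) : TangentSpace I4 y →L[ℝ] E4 :=
  mfderiv I4 𝓘(ℝ, E4) (hopfChart i ε : OpenPartialHomeomorph (GHSpace P c) E4) y

lemma injective_hopfD (h : y ∈ (hopfChart i ε : OpenPartialHomeomorph (GHSpace P c) E4).source) :
    Function.Injective (hopfD i ε y) := by
  have h1 : MDifferentiableAt I4 𝓘(ℝ, E4)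
      (hopfChart i ε : OpenPartialHomeomorph (GHSpace P c) E4) y :=
    (contMDiffAt_hopfChart h).mdifferentiableAt (by simp)
  have h2 : MDifferentiableAt 𝓘(ℝ, E4) I4
      (hopfChart i ε : OpenPartialHomeomorph (GHSpace P c) E4).symm (hopfChart i ε y) :=
    (contMDiffAt_hopfChart_symm ((hopfChart i ε).map_source h)).mdifferentiableAt (by simp)
  have h3 : (hopfChart i ε : OpenPartialHomeomorph (GHSpace P c) E4).symm ∘ hopfChart i ε
      =ᶠ[𝓝 y] id := by
    filter_upwards [(hopfChart i ε).open_source.mem_nhds h] with z hz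
    exact (hopfChart i ε).left_inv hz
  have h4 := h3.mfderiv_eq (I := I4) (I' := I4)
  rw [mfderiv_comp y h2 h1, mfderiv_id] at h4
  intro u v huv
  have key : ∀ w, (mfderiv 𝓘(ℝ, E4) I4 (hopfChart i ε : OpenPartialHomeomorph (GHSpace P c) E4).symm
      (hopfChart i ε y)) (hopfD i ε y w) = w := fun w => congrArg (fun L => L w) h4
  rw [← key u, ← key v, huv]

/-- The differential of a map that factors through a Hopf chart. -/
lemma mfderiv_of_eq_comp {V : Type*} [NormedAddCommGroup V] [NormedSpace ℝ V]
    (h : y ∈ (hopfChart i ε : OpenPartialHomeomorph (GHSpace P c) E4).source)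
    {f : GHSpace P c → V} {φ : E4 → V} (hφ : DifferentiableAt ℝ φ (hopfChart i ε y))
    (hf : ∀ z ∈ (hopfChart i ε : OpenPartialHomeomorph (GHSpace P c) E4).source,
      f z = φ (hopfChart i ε z)) (u : TangentSpace I4 y) :
    mfderiv I4 𝓘(ℝ, V) f y u = fderiv ℝ φ (hopfChart i ε y) (hopfD i ε y u) := by
  have h1 : MDifferentiableAt I4 𝓘(ℝ, E4)
      (hopfChart i ε : OpenPartialHomeomorph (GHSpace P c) E4) y :=
    (contMDiffAt_hopfChart h).mdifferentiableAt (by simp)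
  have h3 : f =ᶠ[𝓝 y] φ ∘ (hopfChart i ε : OpenPartialHomeomorph (GHSpace P c) E4) := by
    filter_upwards [(hopfChart i ε).open_source.mem_nhds h] with z hz
    exact hf z hz
  rw [h3.mfderiv_eq, mfderiv_comp y hφ.mdifferentiableAt h1, mfderiv_eq_fderiv]
  rfl

lemma contMDiffAt_of_eq_comp {V : Type*} [NormedAddCommGroup V] [NormedSpace ℝ V]
    (h : y ∈ (hopfChart i ε : OpenPartialHomeomorph (GHSpace P c) E4).source)
    {f : GHSpace P c → V} {φ : E4 → V} (hφ : ContDiffAt ℝ ∞ φ (hopfChart i ε y))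
    (hf : ∀ z ∈ (hopfChart i ε : OpenPartialHomeomorph (GHSpace P c) E4).source,
      f z = φ (hopfChart i ε z)) :
    ContMDiffAt I4 𝓘(ℝ, V) ∞ f y := by
  have h3 : f =ᶠ[𝓝 y] φ ∘ (hopfChart i ε : OpenPartialHomeomorph (GHSpace P c) E4) := by
    filter_upwards [(hopfChart i ε).open_source.mem_nhds h] with z hz
    exact hf z hz
  exact (hφ.contMDiffAt.comp y (contMDiffAt_hopfChart h)).congr_of_eventuallyEq h3

lemma contDiffAt_add_hopf {q : E4} (p : E3) : ContDiffAt ℝ ∞ (fun z => p + hopf z) q :=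
  contDiffAt_const.add contDiff_hopf.contDiffAt

lemma contMDiff_pr : ContMDiff I4 𝓘(ℝ, E3) ∞ (pr : GHSpace P c → E3) := by
  intro y
  obtain ⟨i, ε, h⟩ := exists_hopfChart y
  exact contMDiffAt_of_eq_comp h (contDiffAt_add_hopf (P i)) fun z hz => pr_eq_hopf hz

lemma contMDiff_rot : ContMDiff (𝓘(ℝ, ℝ).prod I4) I4 ∞
    fun a : ℝ × GHSpace P c => rot a.1 a.2 := by
  rintro ⟨t, y⟩
  obtain ⟨i, ε, h⟩ := exists_hopfChart y
  have h1 : ContMDiffAt (𝓘(ℝ, ℝ).prod I4) (𝓘(ℝ, ℝ × E4)) ∞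
      (fun a : ℝ × GHSpace P c => (a.1, hopfChart (c := c) i ε a.2)) (t, y) :=
    contMDiffAt_fst.prodMk_space ((contMDiffAt_hopfChart h).comp (t, y) contMDiffAt_snd)
  have hR : ContMDiff 𝓘(ℝ, ℝ × E4) 𝓘(ℝ, E4) ∞ (fun p : ℝ × E4 => hopfRot p.1 p.2) :=
    contDiff_hopfRot.contMDiff
  have h2 := hR.contMDiffAt.comp (t, y) h1
  have h4 : hopfRot t (hopfChart (c := c) i ε y) ∈ (hopfChart (c := c) i ε).target := by
    rw [← hopfChart_rot]; exact (hopfChart i ε).map_source (rot_mem_source t h)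
  have h5 : ContMDiffAt 𝓘(ℝ, E4) I4 ∞ (hopfChart (c := c) i ε).symm
      (((fun p : ℝ × E4 => hopfRot p.1 p.2) ∘
        fun a : ℝ × GHSpace P c => (a.1, hopfChart (c := c) i ε a.2)) (t, y)) :=
    contMDiffAt_hopfChart_symm h4
  have h3 := h5.comp (t, y) h2
  refine h3.congr_of_eventuallyEq ?_
  have h6 : {a : ℝ × GHSpace P c | a.2 ∈ (hopfChart (c := c) i ε).source} ∈ 𝓝 (t, y) :=
    continuous_snd.continuousAt.preimage_mem_nhds ((hopfChart i ε).open_source.mem_nhds h)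
  filter_upwards [h6] with a ha
  simp only [Function.comp_apply]
  rw [← hopfChart_rot, (hopfChart i ε).left_inv (rot_mem_source _ ha)]

lemma projDeriv_pr (h : y ∈ (hopfChart i ε : OpenPartialHomeomorph (GHSpace P c) E4).source)
    (u : TangentSpace I4 y) :
    projDeriv pr y u = dhopf (hopfChart i ε y) (hopfD i ε y u) := by
  refine (mfderiv_of_eq_comp h (((contDiffAt_add_hopf (P i)).differentiableAt (by simp)))
    (fun z hz => pr_eq_hopf hz) u).trans ?_
  rw [fderiv_const_add, fderiv_hopf]

/-! ### The connection form -/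

/-- The differential of the tensor coordinates. -/
noncomputable def tnD (y : GHSpace P c) : TangentSpace I4 y →L[ℝ] ((ι → Bool) → ℂ) :=
  mfderiv I4 𝓘(ℝ, (ι → Bool) → ℂ) tn y

/-- The connection form `Im ⟨T, dT⟩ / |T|²`, where `T` denotes the tensor coordinates. -/
noncomputable def conn (y : GHSpace P c) : TangentSpace I4 y →L[ℝ] ℝ :=
  (∑ b, Complex.normSq (tn y b))⁻¹ • Complex.imCLM.comp
    (∑ b, (starRingEnd ℂ) (tn y b) • (ContinuousLinearMap.proj (R := ℝ) (φ := fun _ => ℂ) b).comp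
        (tnD y))

lemma conn_apply (u : TangentSpace I4 y) : conn y u =
    (∑ b, (starRingEnd ℂ) (tn y b) * tnD y u b).im / ∑ b, Complex.normSq (tn y b) := by
  simp [conn]
  ring

end GHSpace

/-- The differential of a tensor product of spinors. -/
lemma fderiv_tens {V : Type*} [NormedAddCommGroup V] [NormedSpace ℝ V] {Q : V → ι → E4} {x : V}
    (hQ : ∀ j, DifferentiableAt ℝ (fun y => Q y j) x) (u : V) (b : ι → Bool) :
    fderiv ℝ (fun y => tens (Q y)) x u b =
      ∑ j, tens (Function.update (Q x) j (fderiv ℝ (fun y => Q y j) x u)) b := by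
  have h := fun b : ι → Bool => HasFDerivAt.finsetProd (u := Finset.univ)
    (g := fun j y => spinor (b j) (Q y j)) (x := x) fun j _ =>
      ((spinor (b j)).hasFDerivAt.comp x (hQ j).hasFDerivAt)
  have h2 : DifferentiableAt ℝ (fun y => tens (Q y)) x :=
    differentiableAt_pi.2 fun b => (h b).differentiableAt
  have h3 : fderiv ℝ (fun y => tens (Q y) b) x u = fderiv ℝ (fun y => tens (Q y)) x u b := by
    have := ((ContinuousLinearMap.proj (R := ℝ) (φ := fun _ : ι → Bool => ℂ) b).hasFDerivAt.comp x
      h2.hasFDerivAt).fderiv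
    exact congrArg (fun L => L u) this
  rw [← h3]
  simp only [tens]
  rw [(h b).fderiv]
  simp
  refine Finset.sum_congr rfl fun j _ => ?_
  rw [← Finset.mul_prod_erase _ _ (Finset.mem_univ j), mul_comm]
  congr 1
  · simp
  · exact Finset.prod_congr rfl fun l hl => by simp [Finset.ne_of_mem_erase hl]

/-- The form `Im ⟨T, dT⟩ / |T|²` of a tensor product is the sum of those of the factors. -/
lemma conn_tens {V : Type*} [NormedAddCommGroup V] [NormedSpace ℝ V] {Q : V → ι → E4} {x : V}
    (hQ : ∀ j, DifferentiableAt ℝ (fun y => Q y j) x) (h0 : ∀ j, Q x j ≠ 0) (u : V) :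
    (∑ b, (starRingEnd ℂ) (tens (Q x) b) * fderiv ℝ (fun y => tens (Q y)) x u b).im /
      ∑ b, Complex.normSq (tens (Q x) b) =
    ∑ j, pullForm (fun y => Q y j) hopfConn x u := by
  simp only [fderiv_tens hQ, Finset.mul_sum]
  rw [Finset.sum_comm]
  simp only [sum_conj_tens_mul_tens, sum_normSq_tens]
  rw [Complex.im_sum, Finset.sum_div]
  refine Finset.sum_congr rfl fun j _ => ?_
  rw [← Finset.mul_prod_erase _ _ (Finset.mem_univ j),
    ← Finset.mul_prod_erase _ (fun i => ‖Q x i‖ ^ 2) (Finset.mem_univ j)]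
  have h1 : ∏ l ∈ Finset.univ.erase j, herm (Q x l)
      (Function.update (Q x) j (fderiv ℝ (fun y => Q y j) x u) l) =
      ((∏ l ∈ Finset.univ.erase j, ‖Q x l‖ ^ 2 : ℝ) : ℂ) := by
    push_cast
    refine Finset.prod_congr rfl fun l hl => ?_
    rw [Function.update_of_ne (Finset.ne_of_mem_erase hl), herm_self]
    push_cast; rfl
  have h2 : ∏ l ∈ Finset.univ.erase j, ‖Q x l‖ ^ 2 ≠ 0 :=
    Finset.prod_ne_zero_iff.2 fun l _ => by simpa using h0 l
  rw [h1, Function.update_self, Complex.im_mul_ofReal, herm_im, pullForm_apply, hopfConn_apply,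
    mul_div_mul_right _ _ h2]

namespace GHSpace

variable {P : ι ↪ E3} {c : ChartChoice P} {i : ι} {ε : ι → Bool} {y : GHSpace P c}

/-- In a Hopf chart the connection form is the sum of the pullbacks of the Hopf connection. -/
lemma conn_eq_sum (h : y ∈ (hopfChart i ε : OpenPartialHomeomorph (GHSpace P c) E4).source)
    (hy : ∀ j, pr y ≠ P j) (u : TangentSpace I4 y) :
    conn y u = ∑ j, pullForm (fun q => GHBundle.lift P i ε q j) hopfConn (hopfChart i ε y)
      (hopfD i ε y u) := by
  have hb : P i + hopf (hopfChart i ε y) ∈ GHBundle.chartBase P i ε :=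
    (hopfChart (c := c) i ε).map_source h
  have hd : ∀ j, DifferentiableAt ℝ (fun q => GHBundle.lift P i ε q j) (hopfChart i ε y) :=
    fun j => (GHBundle.contDiffAt_lift (n := 1) hb j).differentiableAt (by norm_num)
  have h0 : ∀ j, GHBundle.lift P i ε (hopfChart i ε y) j ≠ 0 := by
    intro j h0
    have := GHBundle.hopf_lift hb j
    rw [h0, hopf_eq_zero.2 rfl, ← pr_eq_hopf h] at this
    exact hy j (sub_eq_zero.1 this.symm)
  rw [conn_apply, ← conn_tens hd h0]
  have h1 : tnD y u = fderiv ℝ (fun q => tens (GHBundle.lift P i ε q)) (hopfChart i ε y)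
      (hopfD i ε y u) :=
    mfderiv_of_eq_comp h ((GHBundle.contDiffAt_tens_lift (n := 1) hb).differentiableAt
        (by norm_num))
      (fun z hz => tn_eq_tens hz) u
  rw [h1, tn_eq_tens h]

end GHSpace

end Recharted


/-! ### The Gibbons-Hawking tensors in Hopf coordinates -/

section LocalTensors

/-- The metric `φ⁻¹ η² + φ |dx|²` in the coordinate `q` of a Hopf chart, for the potential
`φ = 1 / (2 |q|²) + h` and the connection form `η = Im ⟨q, dq⟩ / |q|² + α`, written so that it is
visibly smooth at `q = 0`. -/
noncomputable def metLoc (h : ℝ) (α : E3 →L[ℝ] ℝ) (q u v : E4) : ℝ :=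
  2 * inner ℝ u v + (2 * (angForm q u * α (dhopf q v)) + 2 * (α (dhopf q u) * angForm q v)
    + 2 * ‖q‖ ^ 2 * (α (dhopf q u) * α (dhopf q v)) - 4 * h * (angForm q u * angForm q v)) /
      (1 + 2 * ‖q‖ ^ 2 * h) + h * inner ℝ (dhopf q u) (dhopf q v)

lemma metLoc_eq {h : ℝ} (hh : 0 ≤ h) (α : E3 →L[ℝ] ℝ) {q : E4} (hq : q ≠ 0) (u v : E4) :
    metLoc h α q u v = (1 / (2 * ‖q‖ ^ 2) + h)⁻¹ *
        ((hopfConn q u + α (dhopf q u)) * (hopfConn q v + α (dhopf q v)))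
      + (1 / (2 * ‖q‖ ^ 2) + h) * inner ℝ (dhopf q u) (dhopf q v) := by
  have hN : 0 < ‖q‖ ^ 2 := by positivity
  rw [metLoc, inner_dhopf, hopfConn_apply, hopfConn_apply]
  generalize ‖q‖ ^ 2 = N at hN
  generalize angForm q u = a
  generalize angForm q v = b
  generalize α (dhopf q u) = c
  generalize α (dhopf q v) = d
  generalize (inner ℝ u v : ℝ) = e
  have h1 : 1 + 2 * N * h ≠ 0 := by positivity
  have h2 : (1 / (2 * N) + h) = (1 + 2 * N * h) / (2 * N) := by field_simp
  rw [h2]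
  field_simp
  ring

/-- The three parallel two-forms of flat `ℝ⁴`, in the normalization `2 |dq|²` of the metric. -/
def kahlerForm (k : Fin 3) (u v : E4) : ℝ :=
  ![2 * (u 1 * v 2 - u 2 * v 1 + (u 3 * v 0 - u 0 * v 3)),
    2 * (u 1 * v 3 - u 3 * v 1 + (u 0 * v 2 - u 2 * v 0)),
    2 * (u 1 * v 0 - u 0 * v 1 + (u 2 * v 3 - u 3 * v 2))] k

/-- The two-form `η ∧ dx_k + φ dx_{k+1} ∧ dx_{k+2}` in Hopf coordinates, in visibly smooth form. -/
noncomputable def kahlerLoc (k : Fin 3) (h : ℝ) (α : E3 →L[ℝ] ℝ) (q u v : E4) : ℝ :=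
  kahlerForm k u v + (α (dhopf q u) * dhopf q v k - α (dhopf q v) * dhopf q u k)
    + h * (dhopf q u (k + 1) * dhopf q v (k + 2) - dhopf q v (k + 1) * dhopf q u (k + 2))

lemma kahlerLoc_eq (k : Fin 3) (h : ℝ) (α : E3 →L[ℝ] ℝ) {q : E4} (hq : q ≠ 0) (u v : E4) :
    kahlerLoc k h α q u v = ((hopfConn q u + α (dhopf q u)) * dhopf q v k
        - (hopfConn q v + α (dhopf q v)) * dhopf q u k)
      + (1 / (2 * ‖q‖ ^ 2) + h) * (dhopf q u (k + 1) * dhopf q v (k + 2)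
        - dhopf q v (k + 1) * dhopf q u (k + 2)) := by
  have hN : ‖q‖ ^ 2 ≠ 0 := by positivity
  have key : ‖q‖ ^ 2 * kahlerForm k u v = angForm q u * dhopf q v k - angForm q v * dhopf q u k
      + (dhopf q u (k + 1) * dhopf q v (k + 2) - dhopf q v (k + 1) * dhopf q u (k + 2)) / 2 := by
    rw [norm_sq_E4, angForm_apply, angForm_apply]
    fin_cases k <;> simp [kahlerForm] <;> ring
  rw [kahlerLoc, hopfConn_apply, hopfConn_apply]
  generalize ‖q‖ ^ 2 = N at hN key
  have key' : kahlerForm k u v = (angForm q u * dhopf q v k - angForm q v * dhopf q u k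
      + (dhopf q u (k + 1) * dhopf q v (k + 2) - dhopf q v (k + 1) * dhopf q u (k + 2)) / 2) /
          N := by
    rw [eq_div_iff hN]; linear_combination key
  rw [key']
  field_simp
  ring

variable {V : Type*} [NormedAddCommGroup V] [NormedSpace ℝ V] {x : V} {n : WithTop ℕ∞}

lemma contDiffAt_coord_comp {k : ℕ} {f : V → EuclideanSpace ℝ (Fin k)} (hf : ContDiffAt ℝ n f x)
    (i : Fin k) : ContDiffAt ℝ n (fun y => f y i) x :=
  (contDiffAt_euclidean.1 hf) i

lemma contDiffAt_dhopf {q u : V → E4} (hq : ContDiffAt ℝ n q x) (hu : ContDiffAt ℝ n u x) :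
    ContDiffAt ℝ n (fun y => dhopf (q y) (u y)) x := by
  have h1 := contDiffAt_coord_comp hq
  have h2 := contDiffAt_coord_comp hu
  have := h1 0; have := h1 1; have := h1 2; have := h1 3
  have := h2 0; have := h2 1; have := h2 2; have := h2 3
  rw [contDiffAt_euclidean]
  intro i
  fin_cases i <;> simp <;> fun_prop

lemma contDiffAt_angForm {q u : V → E4} (hq : ContDiffAt ℝ n q x) (hu : ContDiffAt ℝ n u x) :
    ContDiffAt ℝ n (fun y => angForm (q y) (u y)) x :=
  (contDiff_angForm.contDiffAt.comp x hq).clm_apply hu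

lemma contDiffAt_metLoc {h : V → ℝ} {α : V → E3 →L[ℝ] ℝ} {q u v : V → E4}
    (hh : ContDiffAt ℝ n h x) (h0 : 0 ≤ h x) (hα : ContDiffAt ℝ n α x) (hq : ContDiffAt ℝ n q x)
    (hu : ContDiffAt ℝ n u x) (hv : ContDiffAt ℝ n v x) :
    ContDiffAt ℝ n (fun y => metLoc (h y) (α y) (q y) (u y) (v y)) x := by
  have h1 := contDiffAt_angForm hq hu
  have h2 := contDiffAt_angForm hq hv
  have h3 := contDiffAt_dhopf hq hu
  have h4 := contDiffAt_dhopf hq hv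
  have h5 := hα.clm_apply h3
  have h6 := hα.clm_apply h4
  have h7 : ContDiffAt ℝ n (fun y => ‖q y‖ ^ 2) x := hq.norm_sq ℝ
  have h8 : ContDiffAt ℝ n (fun y => inner ℝ (u y) (v y)) x := hu.inner ℝ hv
  have h9 : ContDiffAt ℝ n (fun y => inner ℝ (dhopf (q y) (u y)) (dhopf (q y) (v y))) x :=
    h3.inner ℝ h4
  have h10 : 1 + 2 * ‖q x‖ ^ 2 * h x ≠ 0 := by positivity
  unfold metLoc
  refine ((contDiffAt_const.mul h8).add (ContDiffAt.div ?_ ?_ h10)).add (hh.mul h9)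
  · exact ((((contDiffAt_const.mul (h1.mul h6)).add (contDiffAt_const.mul (h5.mul h2))).add
      ((contDiffAt_const.mul h7).mul (h5.mul h6))).sub ((contDiffAt_const.mul hh).mul (h1.mul h2)))
  · exact contDiffAt_const.add ((contDiffAt_const.mul h7).mul hh)

lemma contDiffAt_kahlerLoc (k : Fin 3) {h : V → ℝ} {α : V → E3 →L[ℝ] ℝ} {q u v : V → E4}
    (hh : ContDiffAt ℝ n h x) (hα : ContDiffAt ℝ n α x) (hq : ContDiffAt ℝ n q x)
    (hu : ContDiffAt ℝ n u x) (hv : ContDiffAt ℝ n v x) :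
    ContDiffAt ℝ n (fun y => kahlerLoc k (h y) (α y) (q y) (u y) (v y)) x := by
  have h3 := contDiffAt_dhopf hq hu
  have h4 := contDiffAt_dhopf hq hv
  have h5 := hα.clm_apply h3
  have h6 := hα.clm_apply h4
  have c3 := contDiffAt_coord_comp h3
  have c4 := contDiffAt_coord_comp h4
  have hk : ContDiffAt ℝ n (fun y => kahlerForm k (u y) (v y)) x := by
    have cu := contDiffAt_coord_comp hu
    have cv := contDiffAt_coord_comp hv
    have := cu 0; have := cu 1; have := cu 2; have := cu 3
    have := cv 0; have := cv 1; have := cv 2; have := cv 3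
    fin_cases k <;> simp [kahlerForm] <;> fun_prop
  exact (hk.add ((h5.mul (c4 k)).sub (h6.mul (c3 k)))).add
    (hh.mul (((c3 (k + 1)).mul (c4 (k + 2))).sub ((c4 (k + 1)).mul (c3 (k + 2)))))

end LocalTensors

/-! ### Closedness of the Kähler forms -/

section Closed

lemma cross_coord (k : Fin 3) (a b : E3) :
    cross a b k = a (k + 1) * b (k + 2) - a (k + 2) * b (k + 1) := by
  rw [cross_eq]; fin_cases k <;> simp

lemma clm_E3_apply (L : E3 →L[ℝ] ℝ) (x : E3) :
    L x = x 0 * L (EuclideanSpace.single 0 1) + x 1 * L (EuclideanSpace.single 1 1)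
      + x 2 * L (EuclideanSpace.single 2 1) := by
  have : x = x 0 • EuclideanSpace.single 0 (1 : ℝ) + x 1 • EuclideanSpace.single 1 (1 : ℝ)
      + x 2 • EuclideanSpace.single 2 (1 : ℝ) := by
    apply E3_ext <;> simp
  conv_lhs => rw [this]
  simp

variable {V : Type*} [NormedAddCommGroup V] [NormedSpace ℝ V]

/-- The two-form `α ∧ dX_k + φ(X) dX_{k+1} ∧ dX_{k+2}`. -/
noncomputable def wedgeForm (k : Fin 3) (α : V → V →L[ℝ] ℝ) (X : V → E3) (φ : E3 → ℝ) (z u v : V) :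
    ℝ :=
  (α z u * fderiv ℝ X z v k - α z v * fderiv ℝ X z u k)
    + φ (X z) * (fderiv ℝ X z u (k + 1) * fderiv ℝ X z v (k + 2)
      - fderiv ℝ X z v (k + 1) * fderiv ℝ X z u (k + 2))

lemma fderiv_wedgeForm (k : Fin 3) {α : V → V →L[ℝ] ℝ} {X : V → E3} {φ : E3 → ℝ} {z : V}
    (hα : DifferentiableAt ℝ α z) (hX : ContDiffAt ℝ 2 X z) (hφ : DifferentiableAt ℝ φ (X z))
    (w u v : V) :
    fderiv ℝ (fun y => wedgeForm k α X φ y u v) z w =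
      (fderiv ℝ α z w u * fderiv ℝ X z v k + α z u * fderiv ℝ (fderiv ℝ X) z w v k
        - (fderiv ℝ α z w v * fderiv ℝ X z u k + α z v * fderiv ℝ (fderiv ℝ X) z w u k))
      + (fderiv ℝ φ (X z) (fderiv ℝ X z w) * (fderiv ℝ X z u (k + 1) * fderiv ℝ X z v (k + 2)
          - fderiv ℝ X z v (k + 1) * fderiv ℝ X z u (k + 2))
        + φ (X z) * (fderiv ℝ (fderiv ℝ X) z w u (k + 1) * fderiv ℝ X z v (k + 2)
          + fderiv ℝ X z u (k + 1) * fderiv ℝ (fderiv ℝ X) z w v (k + 2)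
          - (fderiv ℝ (fderiv ℝ X) z w v (k + 1) * fderiv ℝ X z u (k + 2)
          + fderiv ℝ X z v (k + 1) * fderiv ℝ (fderiv ℝ X) z w u (k + 2)))) := by
  have hX1 : HasFDerivAt X (fderiv ℝ X z) z := (hX.differentiableAt (by norm_num)).hasFDerivAt
  have hX2 := hX.differentiableAt_fderiv.hasFDerivAt
  have hαu := fun u => hα.hasFDerivAt.clm_apply (hasFDerivAt_const u z)
  have hXu := fun (u : V) (i : Fin 3) =>
    (coordL i).hasFDerivAt.comp z (hX2.clm_apply (hasFDerivAt_const u z))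
  have hφX := hφ.hasFDerivAt.comp z hX1
  have h := (((hαu u).fun_mul (hXu v k)).fun_sub ((hαu v).fun_mul (hXu u k))).fun_add
    (hφX.fun_mul (((hXu u (k + 1)).fun_mul (hXu v (k + 2))).fun_sub
      ((hXu v (k + 1)).fun_mul (hXu u (k + 2)))))
  have h' : fderiv ℝ (fun y => wedgeForm k α X φ y u v) z = _ := h.fderiv
  rw [h']
  simp
  ring

/-- The monopole equation `dα = -* dφ` makes `α ∧ dX_k + φ(X) dX_{k+1} ∧ dX_{k+2}` closed. -/
lemma wedgeForm_closed (k : Fin 3) {α : V → V →L[ℝ] ℝ} {X : V → E3} {φ : E3 → ℝ} {z : V}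
    (hα : DifferentiableAt ℝ α z) (hX : ContDiffAt ℝ 2 X z) (hφ : DifferentiableAt ℝ φ (X z))
    (hm : ∀ u v, extD α z u v = -fderiv ℝ φ (X z) (cross (fderiv ℝ X z u) (fderiv ℝ X z v)))
    (u v w : V) :
    fderiv ℝ (fun y => wedgeForm k α X φ y v w) z u +
        fderiv ℝ (fun y => wedgeForm k α X φ y w u) z v
      + fderiv ℝ (fun y => wedgeForm k α X φ y u v) z w = 0 := by
  rw [fderiv_wedgeForm k hα hX hφ, fderiv_wedgeForm k hα hX hφ, fderiv_wedgeForm k hα hX hφ]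
  have h1 := hm u v
  have h2 := hm v w
  have h3 := hm w u
  unfold extD at h1 h2 h3
  rw [hX.fderiv_fderiv_symm v u, hX.fderiv_fderiv_symm w u, hX.fderiv_fderiv_symm w v]
  rw [clm_E3_apply _ (cross _ _)] at h1 h2 h3
  rw [clm_E3_apply (fderiv ℝ φ (X z)) (fderiv ℝ X z u),
      clm_E3_apply (fderiv ℝ φ (X z)) (fderiv ℝ X z v),
    clm_E3_apply (fderiv ℝ φ (X z)) (fderiv ℝ X z w)]
  simp only [cross_coord] at h1 h2 h3
  have e01 : (0 : Fin 3) + 1 = 1 := rfl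
  have e02 : (0 : Fin 3) + 2 = 2 := rfl
  have e11 : (1 : Fin 3) + 1 = 2 := rfl
  have e12 : (1 : Fin 3) + 2 = 0 := rfl
  have e21 : (2 : Fin 3) + 1 = 0 := rfl
  have e22 : (2 : Fin 3) + 2 = 1 := rfl
  simp only [e01, e02, e11, e12, e21, e22] at h1 h2 h3
  generalize fderiv ℝ (fderiv ℝ X) z u v = UV
  generalize fderiv ℝ (fderiv ℝ X) z u w = UW
  generalize fderiv ℝ (fderiv ℝ X) z v w = VW
  generalize fderiv ℝ X z u = U at *
  generalize fderiv ℝ X z v = W at *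
  generalize fderiv ℝ X z w = Z at *
  generalize φ (X z) = f at *
  generalize fderiv ℝ φ (X z) = L at *
  fin_cases k
  · simp only [Fin.zero_eta, e01, e02]
    linear_combination (Z 0) * h1 + (U 0) * h2 + (W 0) * h3
  · simp only [Fin.mk_one, e11, e12]
    linear_combination (Z 1) * h1 + (U 1) * h2 + (W 1) * h3
  · simp only [Fin.reduceFinMk, e21, e22]
    linear_combination (Z 2) * h1 + (U 2) * h2 + (W 2) * h3

end Closed


/-! ### The Gibbons-Hawking metric -/

section Potential

variable {ι : Type} [Fintype ι] [DecidableEq ι]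

/-- The electrostatic potential of unit charges at the centres `P j`. -/
noncomputable def pot (P : ι ↪ E3) (m : ℝ) (x : E3) : ℝ := m + ∑ j, newton (x - P j)

lemma potential_map (P : ι ↪ E3) (m : ℝ) : potential m (Finset.univ.map P) = pot P m := by
  ext x; simp [potential, pot, newton]

lemma newton_nonneg (x : E3) : 0 ≤ newton x := by unfold newton; positivity

lemma newton_pos {x : E3} (h : x ≠ 0) : 0 < newton x := by unfold newton; positivity

lemma pot_pos [Nonempty ι] {P : ι ↪ E3} {m : ℝ} (hm : 0 ≤ m) {x : E3} (h : ∀ j, x ≠ P j) :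
    0 < pot P m x :=
  add_pos_of_nonneg_of_pos hm (Finset.sum_pos (fun j _ => newton_pos (sub_ne_zero.2 (h j)))
    Finset.univ_nonempty)

lemma contDiffAt_pot {P : ι ↪ E3} {m : ℝ} {x : E3} {n : WithTop ℕ∞} (h : ∀ j, x ≠ P j) :
    ContDiffAt ℝ n (pot P m) x :=
  contDiffAt_const.add (ContDiffAt.sum fun j _ =>
    ContDiffAt.comp (g := newton) (f := fun z => z - P j) x
      (contDiffAt_newton (sub_ne_zero.2 (h j))) (contDiffAt_id.sub contDiffAt_const))

/-- The part of the potential that is regular at `P i`. -/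
noncomputable def regPot (P : ι ↪ E3) (m : ℝ) (i : ι) (x : E3) : ℝ :=
  m + ∑ j ∈ Finset.univ.erase i, newton (x - P j)

lemma pot_eq_regPot (P : ι ↪ E3) (m : ℝ) (i : ι) (x : E3) :
    pot P m x = newton (x - P i) + regPot P m i x := by
  rw [pot, regPot, ← Finset.add_sum_erase _ _ (Finset.mem_univ i)]; ring

lemma regPot_nonneg (P : ι ↪ E3) {m : ℝ} (hm : 0 ≤ m) (i : ι) (x : E3) : 0 ≤ regPot P m i x :=
  add_nonneg hm (Finset.sum_nonneg fun _ _ => newton_nonneg _)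

/-- The part of the connection form that comes from the centres other than `P i`. -/
noncomputable def regForm (P : ι ↪ E3) (i : ι) (ε : ι → Bool) (x : E3) : E3 →L[ℝ] ℝ :=
  ∑ j ∈ Finset.univ.erase i, diracForm (ε j) (x - P j)

variable {P : ι ↪ E3} {i : ι} {ε : ι → Bool} {x : E3}

lemma contDiffAt_regPot {m : ℝ} (h : x ∈ GHBundle.chartBase P i ε) :
    ContDiffAt ℝ ∞ (regPot P m i) x :=
  contDiffAt_const.add (ContDiffAt.sum fun j hj =>
    ContDiffAt.comp (g := newton) (f := fun z => z - P j) x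
      (contDiffAt_newton (ne_zero_of_mem_offAxis (h.1 j (Finset.ne_of_mem_erase hj))))
      (contDiffAt_id.sub contDiffAt_const))

lemma contDiffAt_regForm (h : x ∈ GHBundle.chartBase P i ε) :
    ContDiffAt ℝ ∞ (regForm P i ε) x :=
  ContDiffAt.sum fun j hj => (contDiffAt_diracForm (h.1 j (Finset.ne_of_mem_erase hj))).comp x
      (contDiffAt_id.sub contDiffAt_const)

lemma pullForm_lift {q : E4} (h : P i + hopf q ∈ GHBundle.chartBase P i ε) {j : ι} (hj : j ≠ i)
    (u : E4) : pullForm (fun q => GHBundle.lift P i ε q j) hopfConn q u =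
      diracForm (ε j) (P i + hopf q - P j) (dhopf q u) := by
  simp only [GHBundle.lift_of_ne hj, pullForm_apply, diracForm]
  congr 1
  have h1 : DifferentiableAt ℝ (hopfSec (ε j)) (P i + hopf q - P j) :=
    (contDiffAt_hopfSec (n := 1) (h.1 j hj)).differentiableAt (by norm_num)
  have h2 : HasFDerivAt (fun q => P i + hopf q - P j) (fderiv ℝ hopf q) q :=
    (((contDiff_hopf (n := 1)).differentiable (by norm_num) q).hasFDerivAt.const_add _).sub_const _
  have h3 := (h1.hasFDerivAt.comp q h2).fderiv
  rw [← fderiv_hopf]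
  exact congrArg (fun L => L u) h3

lemma eq_of_mem_chartBase {j : ι} (h : P j ∈ GHBundle.chartBase P i ε) :
    j = i ∧ ε = GHBundle.centreGauge P i := by
  have : j = i := by
    by_contra hj
    exact ne_zero_of_mem_offAxis (h.1 j hj) (sub_self _)
  subst this
  exact ⟨rfl, h.2 rfl⟩

lemma newton_hopf (q : E4) : newton (hopf q) = 1 / (2 * ‖q‖ ^ 2) := by rw [newton, norm_hopf]

end Potential

namespace GHSpace

variable {ι : Type} [Fintype ι] [DecidableEq ι] [Nonempty ι]
variable {P : ι ↪ E3} {c : ChartChoice P} {i : ι} {ε : ι → Bool} {y : GHSpace P c} {m : ℝ}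

lemma conn_eq (h : y ∈ (hopfChart i ε : OpenPartialHomeomorph (GHSpace P c) E4).source)
    (hy : ∀ j, pr y ≠ P j) (u : TangentSpace I4 y) :
    conn y u = hopfConn (hopfChart i ε y) (hopfD i ε y u) +
      regForm P i ε (pr y) (dhopf (hopfChart i ε y) (hopfD i ε y u)) := by
  have hb : P i + hopf (hopfChart i ε y) ∈ GHBundle.chartBase P i ε :=
    (hopfChart (c := c) i ε).map_source h
  rw [conn_eq_sum h hy, ← Finset.add_sum_erase _ _ (Finset.mem_univ i)]
  congr 1
  · simp [GHBundle.lift_same]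
  · rw [regForm, sum_apply]
    refine Finset.sum_congr rfl fun j hj => ?_
    rw [pullForm_lift hb (Finset.ne_of_mem_erase hj), pr_eq_hopf h]

/-- The inclusion `ℝ³ → ℝ × ℝ³ = ℝ⁴`. -/
noncomputable def spaceL : E3 →L[ℝ] E4 := LinearMap.toContinuousLinearMap
  { toFun := fun x => !₂[0, x 0, x 1, x 2]
    map_add' := fun x y => by apply E4_ext <;> simp
    map_smul' := fun a x => by apply E4_ext <;> simp }

/-- A cyclic permutation of the coordinates of `ℝ⁴`. -/
noncomputable def cycL : E4 →L[ℝ] E4 := LinearMap.toContinuousLinearMap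
  { toFun := fun x => !₂[x 1, x 2, x 3, x 0]
    map_add' := fun x y => by apply E4_ext <;> simp
    map_smul' := fun a x => by apply E4_ext <;> simp }

lemma spaceL_apply (x : E3) : spaceL x = !₂[0, x 0, x 1, x 2] := rfl
lemma cycL_apply (x : E4) : cycL x = !₂[x 1, x 2, x 3, x 0] := rfl

open Classical in
/-- The orthonormal coframe `(φ^{-1/2} η, φ^{1/2} dx)`, extended to the fixed points of the circle
action by `√2 (dq₁, dq₂, dq₃, dq₀)` in Hopf coordinates. (This is not continuous at the fixed
points, where the coframe spins, but the resulting metric and two-forms are smooth.) -/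
noncomputable def cof (m : ℝ) (y : GHSpace P c) : TangentSpace I4 y →L[ℝ] E4 :=
  if h : ∃ j, pr y = P j then
    √2 • cycL.comp (hopfD h.choose (GHBundle.centreGauge P h.choose) y)
  else (√(pot P m (pr y)))⁻¹ • (conn y).smulRight (coordBasis 0) +
    √(pot P m (pr y)) • spaceL.comp (projDeriv pr y)

lemma cof_of_ne (hy : ∀ j, pr y ≠ P j) (u : TangentSpace I4 y) :
    cof m y u = !₂[(√(pot P m (pr y)))⁻¹ * conn y u, √(pot P m (pr y)) * projDeriv pr y u 0,
      √(pot P m (pr y)) * projDeriv pr y u 1, √(pot P m (pr y)) * projDeriv pr y u 2] := by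
  rw [cof, dif_neg (by simpa using hy)]
  apply E4_ext <;> simp [spaceL_apply, coordBasis]

lemma cof_of_eq (h : y ∈ (hopfChart i ε : OpenPartialHomeomorph (GHSpace P c) E4).source) {j : ι}
    (hy : pr y = P j) (u : TangentSpace I4 y) :
    cof m y u = √2 • cycL (hopfD i ε y u) := by
  have hb := pr_mem_chartBase h
  have hex : ∃ j, pr y = P j := ⟨j, hy⟩
  have h1 := hb
  rw [hex.choose_spec] at h1
  obtain ⟨h2, h3⟩ := eq_of_mem_chartBase h1
  rw [cof, dif_pos hex]
  simp only [h2, ← h3]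
  rfl

lemma hopfChart_eq_zero (h : y ∈ (hopfChart i ε : OpenPartialHomeomorph (GHSpace P c) E4).source)
    {j : ι} (hy : pr y = P j) : hopfChart i ε y = 0 := by
  have hb := pr_mem_chartBase h
  rw [hy] at hb
  have h2 := pr_eq_hopf h
  rw [hy, (eq_of_mem_chartBase hb).1] at h2
  exact hopf_eq_zero.1 (by simpa using h2)

lemma hopfChart_ne_zero (h : y ∈ (hopfChart i ε : OpenPartialHomeomorph (GHSpace P c) E4).source)
    (hy : ∀ j, pr y ≠ P j) : hopfChart i ε y ≠ 0 := by
  intro h0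
  apply hy i
  rw [pr_eq_hopf h, h0, hopf_eq_zero.2 rfl, add_zero]

lemma pot_eq (h : y ∈ (hopfChart i ε : OpenPartialHomeomorph (GHSpace P c) E4).source) :
    pot P m (pr y) = 1 / (2 * ‖hopfChart i ε y‖ ^ 2) + regPot P m i (pr y) := by
  rw [pot_eq_regPot P m i, ← newton_hopf]
  congr 2
  rw [pr_eq_hopf h]; simp

/-- The Gibbons-Hawking metric. -/
noncomputable def gIn (m : ℝ) (y : GHSpace P c) : TangentSpace I4 y →L[ℝ]
    TangentSpace I4 y →L[ℝ] ℝ :=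
  ∑ k : Fin 4, ((coordL k).comp (cof m y)).smulRight ((coordL k).comp (cof m y))

lemma gIn_apply (u v : TangentSpace I4 y) : gIn m y u v = inner ℝ (cof m y u) (cof m y v) := by
  rw [gIn, inner_E4]
  simp [Fin.sum_univ_four]

lemma gIn_of_ne (hm : 0 ≤ m) (hy : ∀ j, pr y ≠ P j) (u v : TangentSpace I4 y) : gIn m y u v =
    (pot P m (pr y))⁻¹ * (conn y u * conn y v) +
      pot P m (pr y) * inner ℝ (projDeriv pr y u) (projDeriv pr y v) := by
  have hs := Real.mul_self_sqrt (pot_pos hm hy).le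
  rw [gIn_apply, cof_of_ne hy, cof_of_ne hy, inner_E4, inner_E3]
  simp only [Matrix.cons_val]
  rw [show (pot P m (pr y))⁻¹ = (√(pot P m (pr y)))⁻¹ * (√(pot P m (pr y)))⁻¹ by
    rw [← mul_inv, hs]]
  linear_combination (projDeriv pr y u 0 * projDeriv pr y v 0 +
    projDeriv pr y u 1 * projDeriv pr y v 1 + projDeriv pr y u 2 * projDeriv pr y v 2) * hs

/-- The metric in a Hopf chart. -/
lemma gIn_eq_metLoc (hm : 0 ≤ m)
    (h : y ∈ (hopfChart i ε : OpenPartialHomeomorph (GHSpace P c) E4).source)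
    (u v : TangentSpace I4 y) : gIn m y u v = metLoc (regPot P m i (pr y)) (regForm P i ε (pr y))
      (hopfChart i ε y) (hopfD i ε y u) (hopfD i ε y v) := by
  by_cases hy : ∀ j, pr y ≠ P j
  · rw [gIn_of_ne hm hy, metLoc_eq (regPot_nonneg P hm i _) _ (hopfChart_ne_zero h hy), ← pot_eq h,
      conn_eq h hy, conn_eq h hy, projDeriv_pr h, projDeriv_pr h]
  · push Not at hy
    obtain ⟨j, hj⟩ := hy
    rw [gIn_apply, cof_of_eq h hj, cof_of_eq h hj, hopfChart_eq_zero h hj]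
    have h0 : ∀ u, dhopf 0 u = 0 := fun u => by apply E3_ext <;> simp
    simp only [metLoc, h0, angForm_apply, inner_E4, cycL_apply, inner_smul_left, inner_smul_right]
    have := Real.mul_self_sqrt (show (0 : ℝ) ≤ 2 by norm_num)
    simp
    linear_combination (hopfD i ε y u 1 * hopfD i ε y v 1 + hopfD i ε y u 2 * hopfD i ε y v 2 +
      hopfD i ε y u 3 * hopfD i ε y v 3 + hopfD i ε y u 0 * hopfD i ε y v 0) * this

/-- Off the centres a vector killed by `η` and by the derivative of the projection is zero; over a
centre the coframe is a multiple of the Hopf chart itself. -/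
lemma cof_injective (hm : 0 ≤ m) : Function.Injective (cof m y) := by
  rw [injective_iff_map_eq_zero]
  intro u hu
  obtain ⟨i, ε, h⟩ := exists_hopfChart y
  apply injective_hopfD h
  rw [map_zero]
  by_cases hy : ∀ j, pr y ≠ P j
  · have hs : √(pot P m (pr y)) ≠ 0 := (Real.sqrt_pos.2 (pot_pos hm hy)).ne'
    rw [cof_of_ne hy] at hu
    have c0 := congrArg (fun z : E4 => z 0) hu
    have c1 := congrArg (fun z : E4 => z 1) hu
    have c2 := congrArg (fun z : E4 => z 2) hu
    have c3 := congrArg (fun z : E4 => z 3) hu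
    simp [hs] at c0 c1 c2 c3
    have hp : projDeriv pr y u = 0 := by apply E3_ext <;> simp [c1, c2, c3]
    rw [projDeriv_pr h] at hp
    rw [conn_eq h hy, hp, map_zero, add_zero, hopfConn_apply] at c0
    have hq := hopfChart_ne_zero h hy
    have hN : ‖hopfChart i ε y‖ ^ 2 ≠ 0 := by positivity
    have ha : angForm (hopfChart i ε y) (hopfD i ε y u) = 0 := by
      simpa [hN, hq] using c0
    have := inner_dhopf (hopfChart i ε y) (hopfD i ε y u) (hopfD i ε y u)
    rw [hp, ha, inner_zero_left] at this
    have h3 : (inner ℝ (hopfD i ε y u) (hopfD i ε y u) : ℝ) = 0 := by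
      by_contra h4
      have : ‖hopfChart i ε y‖ ^ 2 * inner ℝ (hopfD i ε y u) (hopfD i ε y u) ≠ 0 :=
        mul_ne_zero hN h4
      apply this; linarith
    exact inner_self_eq_zero.1 h3
  · push Not at hy
    obtain ⟨j, hj⟩ := hy
    rw [cof_of_eq h hj, cycL_apply] at hu
    have c0 := congrArg (fun z : E4 => z 0) hu
    have c1 := congrArg (fun z : E4 => z 1) hu
    have c2 := congrArg (fun z : E4 => z 2) hu
    have c3 := congrArg (fun z : E4 => z 3) hu
    simp at c0 c1 c2 c3
    apply E4_ext <;> simp [c0, c1, c2, c3]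

instance : FiniteDimensional ℝ (TangentSpace I4 y) := inferInstanceAs (FiniteDimensional ℝ E4)

variable (y) in
/-- The inverse of the coframe. -/
noncomputable def cofEquiv (hm : 0 ≤ m) : TangentSpace I4 y ≃ₗ[ℝ] E4 :=
  (cof m y).toLinearMap.linearEquivOfInjective (cof_injective hm) rfl

@[simp] lemma cof_cofEquiv_symm (hm : 0 ≤ m) (u : E4) : cof m y ((cofEquiv y hm).symm u) = u :=
  (cofEquiv y hm).apply_symm_apply u

@[simp] lemma cofEquiv_symm_cof (hm : 0 ≤ m) (u : TangentSpace I4 y) :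
    (cofEquiv y hm).symm (cof m y u) = u :=
  (cofEquiv y hm).symm_apply_apply u

/-- The three constant complex structures of `ℝ⁴`. -/
noncomputable def quat (k : Fin 3) : E4 →L[ℝ] E4 := LinearMap.toContinuousLinearMap
  { toFun := fun x => ![!₂[-x 1, x 0, -x 3, x 2], !₂[-x 2, x 3, x 0, -x 1],
      !₂[-x 3, -x 2, x 1, x 0]] k
    map_add' := fun x y => by fin_cases k <;> apply E4_ext <;> simp <;> ring
    map_smul' := fun a x => by fin_cases k <;> apply E4_ext <;> simp }

lemma quat_apply (k : Fin 3) (x : E4) : quat k x = ![!₂[-x 1, x 0, -x 3, x 2],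
    !₂[-x 2, x 3, x 0, -x 1], !₂[-x 3, -x 2, x 1, x 0]] k := rfl

lemma quat_sq (k : Fin 3) (x : E4) : quat k (quat k x) = -x := by
  simp only [quat_apply]; fin_cases k <;> apply E4_ext <;> simp

lemma quat_mul (x : E4) : quat 0 (quat 1 x) = quat 2 x := by
  simp only [quat_apply]; apply E4_ext <;> simp

lemma inner_quat (k : Fin 3) (x y : E4) : inner ℝ (quat k x) (quat k y) = inner ℝ x y := by
  simp only [quat_apply, inner_E4]; fin_cases k <;> simp <;> ring

variable (y) in
/-- The complex structures of the Gibbons-Hawking metric. -/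
noncomputable def cplx (hm : 0 ≤ m) (k : Fin 3) : TangentSpace I4 y →L[ℝ] TangentSpace I4 y :=
  (LinearMap.toContinuousLinearMap (cofEquiv y hm).symm.toLinearMap).comp ((quat k).comp (cof m y))

lemma cplx_apply (hm : 0 ≤ m) (k : Fin 3) (u : TangentSpace I4 y) :
    cplx y hm k u = (cofEquiv y hm).symm (quat k (cof m y u)) := rfl

lemma cof_cplx (hm : 0 ≤ m) (k : Fin 3) (u : TangentSpace I4 y) :
    cof m y (cplx y hm k u) = quat k (cof m y u) := by
  rw [cplx_apply, cof_cofEquiv_symm]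

lemma gIn_cplx_of_ne (hm : 0 ≤ m) (hy : ∀ j, pr y ≠ P j) (k : Fin 3) (u v : TangentSpace I4 y) :
    gIn m y (cplx y hm k u) v =
      (conn y u * projDeriv pr y v k - conn y v * projDeriv pr y u k)
        + pot P m (pr y) * (projDeriv pr y u (k + 1) * projDeriv pr y v (k + 2)
          - projDeriv pr y v (k + 1) * projDeriv pr y u (k + 2)) := by
  have hs := Real.mul_self_sqrt (pot_pos hm hy).le
  have hs0 : √(pot P m (pr y)) ≠ 0 := (Real.sqrt_pos.2 (pot_pos hm hy)).ne'
  rw [gIn_apply, cof_cplx, cof_of_ne hy, cof_of_ne hy, inner_E4, quat_apply]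
  generalize √(pot P m (pr y)) = s at hs hs0 ⊢
  rw [← hs]
  have e01 : (0 : Fin 3) + 1 = 1 := rfl
  have e02 : (0 : Fin 3) + 2 = 2 := rfl
  have e11 : (1 : Fin 3) + 1 = 2 := rfl
  have e12 : (1 : Fin 3) + 2 = 0 := rfl
  have e21 : (2 : Fin 3) + 1 = 0 := rfl
  have e22 : (2 : Fin 3) + 2 = 1 := rfl
  fin_cases k
  · simp only [Fin.zero_eta, e01, e02, Matrix.cons_val]
    field_simp; ring
  · simp only [Fin.mk_one, e11, e12, Matrix.cons_val]
    field_simp; ring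
  · simp only [Fin.reduceFinMk, e21, e22, Matrix.cons_val]
    field_simp; ring

/-- The Kähler forms in a Hopf chart. -/
lemma gIn_cplx_eq_kahlerLoc (hm : 0 ≤ m)
    (h : y ∈ (hopfChart i ε : OpenPartialHomeomorph (GHSpace P c) E4).source) (k : Fin 3)
    (u v : TangentSpace I4 y) : gIn m y (cplx y hm k u) v =
      kahlerLoc k (regPot P m i (pr y)) (regForm P i ε (pr y))
        (hopfChart i ε y) (hopfD i ε y u) (hopfD i ε y v) := by
  by_cases hy : ∀ j, pr y ≠ P j
  · rw [gIn_cplx_of_ne hm hy, kahlerLoc_eq k _ _ (hopfChart_ne_zero h hy), ← pot_eq h,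
      conn_eq h hy, conn_eq h hy, projDeriv_pr h, projDeriv_pr h]
  · push Not at hy
    obtain ⟨j, hj⟩ := hy
    rw [gIn_apply, cof_cplx, cof_of_eq h hj, cof_of_eq h hj, hopfChart_eq_zero h hj, map_smul,
      inner_smul_left, inner_smul_right]
    have h0 : ∀ u, dhopf 0 u = 0 := fun u => by apply E3_ext <;> simp
    simp only [kahlerLoc, h0, inner_E4, cycL_apply, quat_apply]
    have := Real.mul_self_sqrt (show (0 : ℝ) ≤ 2 by norm_num)
    generalize hopfD i ε y u = U
    generalize hopfD i ε y v = W
    rw [RCLike.conj_to_real, ← mul_assoc, this]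
    fin_cases k <;> simp [kahlerForm] <;> ring

end GHSpace


/-! ### Tensors in preferred charts -/

section Charts

variable {X : Type} [TopologicalSpace X] [ChartedSpace E4 X] [IsManifold I4 ∞ X]

lemma contMDiffAt_chart_symm {p : X} {z : E4} (hz : z ∈ (extChartAt I4 p).target) :
    ContMDiffAt 𝓘(ℝ, E4) I4 ∞ (extChartAt I4 p).symm z :=
  (contMDiffOn_extChartAt_symm p).contMDiffAt ((isOpen_extChartAt_target p).mem_nhds hz)

lemma continuousAt_chart_symm {p : X} {z : E4} (hz : z ∈ (extChartAt I4 p).target) :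
    ContinuousAt (extChartAt I4 p).symm z :=
  (contMDiffAt_chart_symm hz).continuousAt

variable {V : Type*} [NormedAddCommGroup V] [NormedSpace ℝ V]

lemma contDiffAt_comp_chart_symm {p : X} {z : E4} (hz : z ∈ (extChartAt I4 p).target) {f : X → V}
    (hf : ContMDiffAt I4 𝓘(ℝ, V) ∞ f ((extChartAt I4 p).symm z)) :
    ContDiffAt ℝ ∞ (f ∘ (extChartAt I4 p).symm) z :=
  (hf.comp z (contMDiffAt_chart_symm hz)).contDiffAt

/-- The differential of a function on a coordinate vector field is a partial derivative. -/
lemma mfderiv_chartSymmDeriv {p : X} {z : E4} (hz : z ∈ (extChartAt I4 p).target) {f : X → V}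
    (hf : MDifferentiableAt I4 𝓘(ℝ, V) f ((extChartAt I4 p).symm z)) (u : E4) :
    mfderiv I4 𝓘(ℝ, V) f ((extChartAt I4 p).symm z) (chartSymmDeriv p z u) =
      fderiv ℝ (f ∘ (extChartAt I4 p).symm) z u := by
  have h1 : MDifferentiableAt 𝓘(ℝ, E4) I4 (extChartAt I4 p).symm z :=
    (contMDiffAt_chart_symm hz).mdifferentiableAt (by simp)
  have h2 := mfderiv_comp z hf h1
  rw [mfderiv_eq_fderiv] at h2
  rw [h2]; rfl

/-- The differential of a function at the centre of a preferred chart. -/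
lemma mfderiv_eq_fderiv_chart {p : X} {f : X → V} (hf : MDifferentiableAt I4 𝓘(ℝ, V) f p)
    (u : TangentSpace I4 p) : mfderiv I4 𝓘(ℝ, V) f p u =
      fderiv ℝ (f ∘ (extChartAt I4 p).symm) (extChartAt I4 p p) (toCoords u) := by
  rw [hf.mfderiv]
  have h1 : Set.range I4 = Set.univ := by simp
  rw [h1, fderivWithin_univ]
  rfl

lemma symm_trivializationAt {p : X} {z : E4} (hz : z ∈ (extChartAt I4 p).target) (u : E4) :
    (trivializationAt E4 (TangentSpace I4 : X → Type) p).symm ((extChartAt I4 p).symm z) u =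
      chartSymmDeriv p z u := by
  have : IsManifold I4 1 X := IsManifold.of_le (n := ∞) (by simp)
  have hs : (extChartAt I4 p).symm z ∈ (chartAt E4 p).source := by
    have := (extChartAt I4 p).map_target hz
    rwa [extChartAt_source] at this
  have h := TangentBundle.symmL_trivializationAt (I := I4) hs
  have h1 : Set.range I4 = Set.univ := by simp
  rw [h1, mfderivWithin_univ, (extChartAt I4 p).right_inv hz] at h
  exact (Bundle.Trivialization.symmL_apply (R := ℝ) _ hs u).symm.trans (congrArg (fun L => L u) h)

/-- A field of bilinear forms with smooth components is smooth. -/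
lemma contMDiff_bilin {B : ∀ x : X, TangentSpace I4 x →L[ℝ] TangentSpace I4 x →L[ℝ] ℝ}
    (h : ∀ (p : X) (u v : E4), ContDiffOn ℝ ∞ (fun z => B ((extChartAt I4 p).symm z)
      (chartSymmDeriv p z u) (chartSymmDeriv p z v)) (extChartAt I4 p).target) :
    ContMDiff I4 (I4.prod 𝓘(ℝ, E4 →L[ℝ] E4 →L[ℝ] ℝ)) ∞
      (fun x => Bundle.TotalSpace.mk' (E4 →L[ℝ] E4 →L[ℝ] ℝ)
        (E := fun x : X => TangentSpace I4 x →L[ℝ] TangentSpace I4 x →L[ℝ] ℝ) x (B x)) := by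
  intro p
  rw [Bundle.contMDiffAt_section]
  set f : X → E4 →L[ℝ] E4 →L[ℝ] ℝ := fun x =>
    ((trivializationAt (E4 →L[ℝ] E4 →L[ℝ] ℝ)
      (fun x : X => TangentSpace I4 x →L[ℝ] TangentSpace I4 x →L[ℝ] ℝ) p)
      ⟨x, B x⟩).2 with hf
  have hcomp : ∀ z ∈ (extChartAt I4 p).target, ∀ u v, f ((extChartAt I4 p).symm z) u v =
      B ((extChartAt I4 p).symm z) (chartSymmDeriv p z u) (chartSymmDeriv p z v) := by
    intro z hz u v
    have hs : (extChartAt I4 p).symm z ∈ (chartAt E4 p).source := by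
      have := (extChartAt I4 p).map_target hz
      rwa [extChartAt_source] at this
    simp only [hf, hom_trivializationAt_apply]
    rw [inCoordinates_apply_eq₂ hs hs (by exact Set.mem_univ _)]
    simp only [symm_trivializationAt hz, Bundle.Trivial.fiberBundle_trivializationAt',
      Bundle.Trivial.linearMapAt_trivialization, LinearMap.id_apply]
  have h1 : ContDiffOn ℝ ∞ (f ∘ (extChartAt I4 p).symm) (extChartAt I4 p).target := by
    rw [contDiffOn_clm_apply]
    intro u
    rw [contDiffOn_clm_apply]
    intro v
    exact (h p u v).congr fun z hz => hcomp z hz u v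
  have h2 : ContDiffAt ℝ ∞ (f ∘ (extChartAt I4 p).symm) (extChartAt I4 p p) :=
    h1.contDiffAt ((isOpen_extChartAt_target p).mem_nhds (mem_extChartAt_target p))
  have h3 : ContMDiffAt I4 𝓘(ℝ, E4 →L[ℝ] E4 →L[ℝ] ℝ) ∞
      ((f ∘ (extChartAt I4 p).symm) ∘ extChartAt I4 p) p :=
    h2.contMDiffAt.comp p (contMDiffAt_extChartAt)
  refine h3.congr_of_eventuallyEq ?_
  filter_upwards [extChartAt_source_mem_nhds (I := I4) p] with x hx
  simp only [Function.comp_apply, (extChartAt I4 p).left_inv hx]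

end Charts

namespace GHSpace

variable {ι : Type} [Fintype ι] [DecidableEq ι] [Nonempty ι]
variable {P : ι ↪ E3} {c : ChartChoice P} {i : ι} {ε : ι → Bool} {y p : GHSpace P c} {m : ℝ}
  {z : E4}

lemma contDiffAt_chart_change (hz : z ∈ (extChartAt I4 p).target)
    (h : (extChartAt I4 p).symm z ∈
        (hopfChart i ε : OpenPartialHomeomorph (GHSpace P c) E4).source) :
    ContDiffAt ℝ ∞ ((hopfChart i ε : OpenPartialHomeomorph (GHSpace P c) E4) ∘
      (extChartAt I4 p).symm) z :=
  contDiffAt_comp_chart_symm hz (contMDiffAt_hopfChart h)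

lemma hopfD_chartSymmDeriv (hz : z ∈ (extChartAt I4 p).target)
    (h : (extChartAt I4 p).symm z ∈ (hopfChart i ε : OpenPartialHomeomorph (GHSpace P c) E4).source)
    (u : E4) : hopfD i ε ((extChartAt I4 p).symm z) (chartSymmDeriv p z u) =
      fderiv ℝ ((hopfChart i ε : OpenPartialHomeomorph (GHSpace P c) E4) ∘
        (extChartAt I4 p).symm) z u :=
  mfderiv_chartSymmDeriv hz ((contMDiffAt_hopfChart h).mdifferentiableAt (by simp)) u

lemma eventually_mem_source (hz : z ∈ (extChartAt I4 p).target)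
    (h : (extChartAt I4 p).symm z ∈
        (hopfChart i ε : OpenPartialHomeomorph (GHSpace P c) E4).source) :
    ∀ᶠ w in 𝓝 z, w ∈ (extChartAt I4 p).target ∧ (extChartAt I4 p).symm w ∈
      (hopfChart i ε : OpenPartialHomeomorph (GHSpace P c) E4).source :=
  ((isOpen_extChartAt_target p).eventually_mem hz).and
    ((continuousAt_chart_symm hz).eventually ((hopfChart i ε).open_source.eventually_mem h))

/-- The metric has smooth components. -/
lemma contDiffAt_gIn (hm : 0 ≤ m) (hz : z ∈ (extChartAt I4 p).target) (u v : E4) :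
    ContDiffAt ℝ ∞ (fun z => gIn m ((extChartAt I4 p).symm z)
      (chartSymmDeriv p z u) (chartSymmDeriv p z v)) z := by
  obtain ⟨i, ε, h⟩ := exists_hopfChart ((extChartAt I4 p).symm z)
  have hF := contDiffAt_chart_change hz h
  have hpr : ContDiffAt ℝ ∞ (pr ∘ (extChartAt I4 p).symm) z :=
    contDiffAt_comp_chart_symm hz contMDiff_pr.contMDiffAt
  have hF' := hF.fderiv_right (m := ∞) (by simp)
  have hu := hF'.clm_apply (contDiffAt_const (c := u))
  have hv := hF'.clm_apply (contDiffAt_const (c := v))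
  have hb := pr_mem_chartBase h
  have hh : ContDiffAt ℝ ∞ (regPot P m i ∘ (pr ∘ (extChartAt I4 p).symm)) z :=
    (contDiffAt_regPot hb).comp z hpr
  have hα : ContDiffAt ℝ ∞ (regForm P i ε ∘ (pr ∘ (extChartAt I4 p).symm)) z :=
    (contDiffAt_regForm hb).comp z hpr
  have key := contDiffAt_metLoc hh (regPot_nonneg P hm i _) hα hF hu hv
  refine key.congr_of_eventuallyEq ?_
  filter_upwards [eventually_mem_source hz h] with w hw
  rw [gIn_eq_metLoc hm hw.2, hopfD_chartSymmDeriv hw.1 hw.2, hopfD_chartSymmDeriv hw.1 hw.2]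
  rfl

/-- The Kähler forms have smooth components. -/
lemma contDiffAt_gIn_cplx (hm : 0 ≤ m) (k : Fin 3) (hz : z ∈ (extChartAt I4 p).target) (u v : E4) :
    ContDiffAt ℝ ∞ (fun z => gIn m ((extChartAt I4 p).symm z)
      (cplx _ hm k (chartSymmDeriv p z u)) (chartSymmDeriv p z v)) z := by
  obtain ⟨i, ε, h⟩ := exists_hopfChart ((extChartAt I4 p).symm z)
  have hF := contDiffAt_chart_change hz h
  have hpr : ContDiffAt ℝ ∞ (pr ∘ (extChartAt I4 p).symm) z :=
    contDiffAt_comp_chart_symm hz contMDiff_pr.contMDiffAt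
  have hF' := hF.fderiv_right (m := ∞) (by simp)
  have hu := hF'.clm_apply (contDiffAt_const (c := u))
  have hv := hF'.clm_apply (contDiffAt_const (c := v))
  have hb := pr_mem_chartBase h
  have hh : ContDiffAt ℝ ∞ (regPot P m i ∘ (pr ∘ (extChartAt I4 p).symm)) z :=
    (contDiffAt_regPot hb).comp z hpr
  have hα : ContDiffAt ℝ ∞ (regForm P i ε ∘ (pr ∘ (extChartAt I4 p).symm)) z :=
    (contDiffAt_regForm hb).comp z hpr
  have key := contDiffAt_kahlerLoc k hh hα hF hu hv
  refine key.congr_of_eventuallyEq ?_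
  filter_upwards [eventually_mem_source hz h] with w hw
  rw [gIn_cplx_eq_kahlerLoc hm hw.2, hopfD_chartSymmDeriv hw.1 hw.2, hopfD_chartSymmDeriv hw.1 hw.2]
  rfl

lemma gIn_self (u : TangentSpace I4 y) : gIn m y u u = ‖cof m y u‖ ^ 2 := by
  rw [gIn_apply, real_inner_self_eq_norm_sq]

lemma isVonNBounded_gIn (hm : 0 ≤ m) :
    Bornology.IsVonNBounded ℝ {u : TangentSpace I4 y | gIn m y u u < 1} := by
  set L : E4 →L[ℝ] TangentSpace I4 y :=
    LinearMap.toContinuousLinearMap (cofEquiv y hm).symm.toLinearMap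
  have hb : Bornology.IsVonNBounded ℝ (Metric.ball (0 : E4) 1) :=
    NormedSpace.isVonNBounded_ball ℝ E4 1
  refine (hb.image L).subset ?_
  intro u hu
  refine ⟨cof m y u, ?_, cofEquiv_symm_cof hm u⟩
  have h : gIn m y u u < 1 := hu
  rw [gIn_self] at h
  rw [mem_ball_zero_iff]
  nlinarith [norm_nonneg (cof m y u)]

variable (P c) in
/-- The Gibbons-Hawking metric, as a smooth Riemannian metric. -/
noncomputable def metric (hm : 0 ≤ m) : Metric4 (GHSpace P c) where
  inner := gIn m
  symm y u v := by rw [gIn_apply, gIn_apply, real_inner_comm]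
  pos y u hu := by
    rw [gIn_self]
    have : cof m y u ≠ 0 := fun h => hu (cof_injective hm (h.trans (map_zero _).symm))
    positivity
  isVonNBounded y := isVonNBounded_gIn hm
  contMDiff := contMDiff_bilin fun p u v z hz =>
    (contDiffAt_gIn hm hz u v).contDiffWithinAt

end GHSpace


/-! ### The monopole equation, the Kähler forms and the moment map -/

lemma fderiv_pot {ι : Type} [Fintype ι] {P : ι ↪ E3} {m : ℝ} {x : E3} (h : ∀ j, x ≠ P j) (v : E3) :
    fderiv ℝ (pot P m) x v = ∑ j, fderiv ℝ newton (x - P j) v := by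
  have h1 : ∀ j, HasFDerivAt (fun z => newton (z - P j)) (fderiv ℝ newton (x - P j)) x := by
    intro j
    have h2 : DifferentiableAt ℝ newton (x - P j) :=
      (contDiffAt_newton (n := 1) (sub_ne_zero.2 (h j))).differentiableAt (by norm_num)
    exact h2.hasFDerivAt.comp x ((hasFDerivAt_id x).sub_const (P j))
  have h3 : fderiv ℝ (pot P m) x = ∑ j, fderiv ℝ newton (x - P j) :=
    ((HasFDerivAt.fun_sum fun j (_ : j ∈ Finset.univ) => h1 j).const_add m).fderiv
  rw [h3, sum_apply]

namespace GHSpace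

variable {ι : Type} [Fintype ι] [DecidableEq ι] [Nonempty ι]
variable {P : ι ↪ E3} {c : ChartChoice P} {i : ι} {ε : ι → Bool} {y p : GHSpace P c} {m : ℝ}
  {z : E4}

lemma eventually_pr_ne (hz : z ∈ (extChartAt I4 p).target)
    (hy : ∀ j, pr ((extChartAt I4 p).symm z) ≠ P j) :
    ∀ᶠ w in 𝓝 z, ∀ j, pr ((extChartAt I4 p).symm w) ≠ P j := by
  rw [Filter.eventually_all]
  intro j
  exact (contMDiff_pr.continuous.continuousAt.comp (continuousAt_chart_symm hz)).eventually_ne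
      (hy j)

/-- The preferred chart around `p`, composed with the `j`-th local lift to `ℂ²`. -/
noncomputable def liftInChart (p : GHSpace P c) (i : ι) (ε : ι → Bool) (j : ι) (z : E4) : E4 :=
  GHBundle.lift P i ε (hopfChart i ε ((extChartAt I4 p).symm z)) j

lemma contDiffAt_liftInChart (hz : z ∈ (extChartAt I4 p).target)
    (h : (extChartAt I4 p).symm z ∈ (hopfChart i ε : OpenPartialHomeomorph (GHSpace P c) E4).source)
    (j : ι) : ContDiffAt ℝ ∞ (liftInChart p i ε j) z := by
  have hb : P i + hopf (hopfChart i ε ((extChartAt I4 p).symm z)) ∈ GHBundle.chartBase P i ε :=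
    (hopfChart (c := c) i ε).map_source h
  exact ContDiffAt.comp (g := fun q => GHBundle.lift P i ε q j) z (GHBundle.contDiffAt_lift hb j)
    (contDiffAt_chart_change hz h)

lemma hopf_liftInChart
    (h : (extChartAt I4 p).symm z ∈ (hopfChart i ε : OpenPartialHomeomorph (GHSpace P c) E4).source)
    (j : ι) : hopf (liftInChart p i ε j z) = pr ((extChartAt I4 p).symm z) - P j := by
  have hb : P i + hopf (hopfChart i ε ((extChartAt I4 p).symm z)) ∈ GHBundle.chartBase P i ε :=
    (hopfChart (c := c) i ε).map_source h
  rw [liftInChart, GHBundle.hopf_lift hb, pr_eq_hopf h]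

lemma oneFormInChart_conn (hz : z ∈ (extChartAt I4 p).target)
    (h : (extChartAt I4 p).symm z ∈ (hopfChart i ε : OpenPartialHomeomorph (GHSpace P c) E4).source)
    (hy : ∀ j, pr ((extChartAt I4 p).symm z) ≠ P j) :
    oneFormInChart conn p z = ∑ j, pullForm (liftInChart p i ε j) hopfConn z := by
  have hb : P i + hopf (hopfChart i ε ((extChartAt I4 p).symm z)) ∈ GHBundle.chartBase P i ε :=
    (hopfChart (c := c) i ε).map_source h
  refine ContinuousLinearMap.ext fun u => ?_
  change conn _ (chartSymmDeriv p z u) = _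
  rw [conn_eq_sum h hy, hopfD_chartSymmDeriv hz h, sum_apply]
  refine Finset.sum_congr rfl fun j _ => ?_
  simp only [pullForm_apply]
  congr 1
  have h1 : DifferentiableAt ℝ (fun q => GHBundle.lift P i ε q j)
      (hopfChart i ε ((extChartAt I4 p).symm z)) :=
    (GHBundle.contDiffAt_lift (n := 1) hb j).differentiableAt (by norm_num)
  have h2 := fderiv_comp z h1 ((contDiffAt_chart_change hz h).differentiableAt (by simp))
  exact congrArg (fun L => L u) h2.symm

lemma eventually_oneFormInChart_conn (hz : z ∈ (extChartAt I4 p).target)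
    (h : (extChartAt I4 p).symm z ∈ (hopfChart i ε : OpenPartialHomeomorph (GHSpace P c) E4).source)
    (hy : ∀ j, pr ((extChartAt I4 p).symm z) ≠ P j) :
    oneFormInChart conn p =ᶠ[𝓝 z] fun w => ∑ j, pullForm (liftInChart p i ε j) hopfConn w := by
  filter_upwards [eventually_mem_source hz h, eventually_pr_ne hz hy] with w hw hw'
  exact oneFormInChart_conn hw.1 hw.2 hw'

lemma contDiffAt_pullForm_lift (hz : z ∈ (extChartAt I4 p).target)
    (h : (extChartAt I4 p).symm z ∈ (hopfChart i ε : OpenPartialHomeomorph (GHSpace P c) E4).source)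
    (hy : ∀ j, pr ((extChartAt I4 p).symm z) ≠ P j) (j : ι) :
    ContDiffAt ℝ ∞ (pullForm (liftInChart p i ε j) hopfConn) z := by
  refine contDiffAt_pullForm (contDiffAt_liftInChart hz h j) (contDiffAt_hopfConn ?_)
  intro h0
  have := hopf_liftInChart h j
  rw [h0, hopf_eq_zero.2 rfl] at this
  exact hy j (sub_eq_zero.1 this.symm)

lemma contDiffAt_conn (hz : z ∈ (extChartAt I4 p).target)
    (hy : ∀ j, pr ((extChartAt I4 p).symm z) ≠ P j) :
    ContDiffAt ℝ ∞ (oneFormInChart conn p) z := by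
  obtain ⟨i, ε, h⟩ := exists_hopfChart ((extChartAt I4 p).symm z)
  refine ContDiffAt.congr_of_eventuallyEq ?_ (eventually_oneFormInChart_conn hz h hy)
  exact ContDiffAt.sum fun j _ => contDiffAt_pullForm_lift hz h hy j

lemma contDiffAt_pr (hz : z ∈ (extChartAt I4 p).target) :
    ContDiffAt ℝ ∞ (pr ∘ (extChartAt I4 p).symm) z :=
  contDiffAt_comp_chart_symm hz contMDiff_pr.contMDiffAt

/-- The monopole equation `dη = -* dφ` in a preferred chart. -/
lemma extD_conn (hz : z ∈ (extChartAt I4 p).target)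
    (hy : ∀ j, pr ((extChartAt I4 p).symm z) ≠ P j) (u v : E4) :
    extD (oneFormInChart conn p) z u v = -fderiv ℝ (pot P m) (pr ((extChartAt I4 p).symm z))
      (cross (fderiv ℝ (pr ∘ (extChartAt I4 p).symm) z u)
        (fderiv ℝ (pr ∘ (extChartAt I4 p).symm) z v)) := by
  obtain ⟨i, ε, h⟩ := exists_hopfChart ((extChartAt I4 p).symm z)
  rw [extD_congr (eventually_oneFormInChart_conn hz h hy), extD_sum _ fun j _ =>
    (contDiffAt_pullForm_lift hz h hy j).differentiableAt (by simp), fderiv_pot hy,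
    ← Finset.sum_neg_distrib]
  refine Finset.sum_congr rfl fun j _ => ?_
  have hl := contDiffAt_liftInChart hz h j
  have h0 : liftInChart p i ε j z ≠ 0 := by
    intro h0
    have := hopf_liftInChart h j
    rw [h0, hopf_eq_zero.2 rfl] at this
    exact hy j (sub_eq_zero.1 this.symm)
  have hd : ∀ w, dhopf (liftInChart p i ε j z) (fderiv ℝ (liftInChart p i ε j) z w) =
      fderiv ℝ (pr ∘ (extChartAt I4 p).symm) z w := by
    intro w
    have h1 : hopf ∘ liftInChart p i ε j =ᶠ[𝓝 z]
        fun w => (pr ∘ (extChartAt I4 p).symm) w - P j := by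
      filter_upwards [eventually_mem_source hz h] with w hw
      exact hopf_liftInChart hw.2 j
    have h2 := h1.fderiv_eq (𝕜 := ℝ)
    rw [fderiv_sub_const, fderiv_comp z ((contDiff_hopf (n := 1)).differentiable (by norm_num) _)
      (hl.differentiableAt (by simp))] at h2
    rw [← h2, ← fderiv_hopf]; rfl
  rw [extD_pullForm (hl.of_le (WithTop.coe_le_coe.2 le_top))
    ((contDiffAt_hopfConn (n := 1) h0).differentiableAt (by norm_num)), extD_hopfConn h0, hd, hd,
    hopf_liftInChart h]

lemma projDeriv_chartSymmDeriv (hz : z ∈ (extChartAt I4 p).target) (u : E4) :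
    projDeriv pr ((extChartAt I4 p).symm z) (chartSymmDeriv p z u) =
      fderiv ℝ (pr ∘ (extChartAt I4 p).symm) z u :=
  mfderiv_chartSymmDeriv hz (contMDiff_pr.mdifferentiableAt (by simp)) u

lemma twoFormComponent_eq (hm : 0 ≤ m) (k : Fin 3) (a b : Fin 4)
    (hz : z ∈ (extChartAt I4 p).target) (hy : ∀ j, pr ((extChartAt I4 p).symm z) ≠ P j) :
    twoFormComponent (metric P c hm) (fun x => cplx x hm k) p a b z =
      wedgeForm k (oneFormInChart conn p) (pr ∘ (extChartAt I4 p).symm) (pot P m) z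
        (coordBasis a) (coordBasis b) := by
  refine (gIn_cplx_of_ne hm hy k _ _).trans ?_
  rw [projDeriv_chartSymmDeriv hz, projDeriv_chartSymmDeriv hz]
  rfl

/-- Centres of the fibration are isolated. -/
lemma eventually_ne_centre (hz : z ∈ (extChartAt I4 p).target) :
    ∀ᶠ w in 𝓝[≠] z, w ∈ (extChartAt I4 p).target ∧ ∀ j, pr ((extChartAt I4 p).symm w) ≠ P j := by
  by_cases hy : ∀ j, pr ((extChartAt I4 p).symm z) ≠ P j
  · exact (((isOpen_extChartAt_target p).eventually_mem hz).and
      (eventually_pr_ne hz hy)).filter_mono nhdsWithin_le_nhds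
  · push Not at hy
    obtain ⟨j, hj⟩ := hy
    obtain ⟨i, ε, h⟩ := exists_hopfChart ((extChartAt I4 p).symm z)
    filter_upwards [(eventually_mem_source hz h).filter_mono nhdsWithin_le_nhds,
      self_mem_nhdsWithin] with w hw hne
    refine ⟨hw.1, fun k hk => hne ?_⟩
    have h1 := (hopfChart_eq_zero hw.2 hk).trans (hopfChart_eq_zero h hj).symm
    exact (extChartAt I4 p).symm.injOn hw.1 hz ((hopfChart i ε).injOn hw.2 h h1)

lemma twoForm_closed (hm : 0 ≤ m) (k : Fin 3) (p : GHSpace P c) (a b d : Fin 4) :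
    pd a (twoFormComponent (metric P c hm) (fun x => cplx x hm k) p b d) (extChartAt I4 p p)
      + pd b (twoFormComponent (metric P c hm) (fun x => cplx x hm k) p d a) (extChartAt I4 p p)
      + pd d (twoFormComponent (metric P c hm) (fun x => cplx x hm k) p a b) (extChartAt I4 p p)
      = 0 := by
  set Ω := twoFormComponent (metric P c hm) (fun x => cplx x hm k) p with hΩ
  have hp := mem_extChartAt_target (I := I4) p
  have hsm : ∀ a b d, ContinuousAt (pd a (Ω b d)) (extChartAt I4 p p) := by
    intro a b d
    have h1 : ContDiffAt ℝ ∞ (Ω b d) (extChartAt I4 p p) := contDiffAt_gIn_cplx hm k hp _ _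
    exact ((h1.fderiv_right (m := ∞) (by simp)).clm_apply contDiffAt_const).continuousAt
  have hcont := ((hsm a b d).add (hsm b d a)).add (hsm d a b)
  refine tendsto_nhds_unique (hcont.tendsto.mono_left nhdsWithin_le_nhds : Filter.Tendsto _
    (𝓝[≠] (extChartAt I4 p p)) _) ?_
  refine (tendsto_const_nhds (x := (0 : ℝ))).congr' ?_
  filter_upwards [eventually_ne_centre hp] with w hw
  have hev : ∀ a b, Ω a b =ᶠ[𝓝 w] fun z => wedgeForm k (oneFormInChart conn p)
      (pr ∘ (extChartAt I4 p).symm) (pot P m) z (coordBasis a) (coordBasis b) := by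
    intro a b
    filter_upwards [(isOpen_extChartAt_target p).eventually_mem hw.1,
      eventually_pr_ne hw.1 hw.2] with z hz hz'
    exact twoFormComponent_eq hm k a b hz hz'
  simp only [Pi.add_apply, pd]
  rw [(hev b d).fderiv_eq, (hev d a).fderiv_eq, (hev a b).fderiv_eq]
  exact (wedgeForm_closed k ((contDiffAt_conn hw.1 hw.2).differentiableAt (by simp))
    ((contDiffAt_pr hw.1).of_le (WithTop.coe_le_coe.2 le_top))
    ((contDiffAt_pot (n := 1) hw.2).differentiableAt (by norm_num))
    (fun u v => extD_conn hw.1 hw.2 u v) _ _ _).symm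

lemma isHyperKahler_metric (hm : 0 ≤ m) :
    IsHyperKahler (metric P c hm) (fun k x => cplx x hm k) where
  smooth k p a b z hz := (contDiffAt_gIn_cplx hm k hz _ _).contDiffWithinAt
  sq k x u := cof_injective hm (by rw [cof_cplx, cof_cplx, quat_sq, map_neg])
  mul x u := cof_injective hm (by rw [cof_cplx, cof_cplx, cof_cplx, quat_mul])
  orthogonal k x u v := by
    change gIn m x _ _ = gIn m x _ _
    rw [gIn_apply, gIn_apply, cof_cplx, cof_cplx, inner_quat]
  closed k p a b d := twoForm_closed hm k p a b d

/-! ### The circle action -/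

lemma contMDiff_orbit (y : GHSpace P c) : ContMDiff 𝓘(ℝ, ℝ) I4 ∞ (fun s => rot s y) :=
  contMDiff_rot.comp (contMDiff_id.prodMk contMDiff_const)

lemma contMDiff_rot_right (t : ℝ) : ContMDiff I4 I4 ∞ (rot t : GHSpace P c → GHSpace P c) :=
  contMDiff_rot.comp (contMDiff_const.prodMk contMDiff_id)

/-- The circle action is generated by the vector field `hopfGen`. -/
lemma hopfD_velocity (h : y ∈ (hopfChart i ε : OpenPartialHomeomorph (GHSpace P c) E4).source)
    (t : ℝ) : hopfD i ε (rot t y) (velocity (fun s => rot s y) t) =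
      hopfGen (hopfRot t (hopfChart i ε y)) := by
  have h1 : MDifferentiableAt I4 𝓘(ℝ, E4) (hopfChart i ε : OpenPartialHomeomorph (GHSpace P c) E4)
    (rot t y) := (contMDiffAt_hopfChart (rot_mem_source t h)).mdifferentiableAt (by simp)
  have h2 : MDifferentiableAt 𝓘(ℝ, ℝ) I4 (fun s => rot s y) t :=
    (contMDiff_orbit y).mdifferentiableAt (by simp)
  have h3 := mfderiv_comp t h1 h2
  have h4 : (hopfChart i ε : OpenPartialHomeomorph (GHSpace P c) E4) ∘ (fun s => rot s y) =
      fun s => hopfRot s (hopfChart i ε y) := by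
    ext1 s; exact hopfChart_rot s y
  rw [h4, mfderiv_eq_fderiv] at h3
  have h5 := congrArg (fun L => L (1 : ℝ)) h3
  rw [(hasDerivAt_hopfRot (hopfChart i ε y) t).hasFDerivAt.fderiv] at h5
  refine Eq.trans ?_ (h5.symm.trans ?_)
  · rfl
  · exact one_smul ℝ (hopfGen (hopfRot t (hopfChart i ε y)))

lemma hopfD_mfderiv_rot (h : y ∈ (hopfChart i ε : OpenPartialHomeomorph (GHSpace P c) E4).source)
    (t : ℝ) (u : TangentSpace I4 y) : hopfD i ε (rot t y) (mfderiv I4 I4 (rot t) y u) =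
      hopfRot t (hopfD i ε y u) := by
  have h1 : MDifferentiableAt I4 𝓘(ℝ, E4) (hopfChart i ε : OpenPartialHomeomorph (GHSpace P c) E4)
    (rot t y) := (contMDiffAt_hopfChart (rot_mem_source t h)).mdifferentiableAt (by simp)
  have h2 : MDifferentiableAt I4 I4 (rot t : GHSpace P c → GHSpace P c) y :=
    (contMDiff_rot_right t).mdifferentiableAt (by simp)
  have h3 := congrArg (fun L => L u) (mfderiv_comp y h1 h2)
  refine h3.symm.trans ?_
  refine (mfderiv_of_eq_comp h (φ := hopfRotL t) (hopfRotL t).differentiableAt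
    (fun z hz => hopfChart_rot t z) u).trans ?_
  rw [ContinuousLinearMap.fderiv]
  rfl

lemma pr_rot (t : ℝ) (y : GHSpace P c) : pr (rot t y) = pr y := rfl

lemma conn_invariant (hy : ∀ j, pr y ≠ P j) (t : ℝ) (u : TangentSpace I4 y) :
    conn (rot t y) (mfderiv I4 I4 (rot t) y u) = conn y u := by
  obtain ⟨i, ε, h⟩ := exists_hopfChart y
  rw [conn_eq (rot_mem_source t h) hy, conn_eq h hy, hopfD_mfderiv_rot h, hopfChart_rot, pr_rot,
    dhopf_hopfRot, hopfConn_apply, hopfConn_apply, angForm_hopfRot, norm_hopfRot]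

lemma conn_velocity (hy : ∀ j, pr y ≠ P j) (t : ℝ) :
    conn (rot t y) (velocity (fun s => rot s y) t) = 1 := by
  obtain ⟨i, ε, h⟩ := exists_hopfChart y
  have hq := hopfChart_ne_zero h hy
  rw [conn_eq (rot_mem_source t h) hy, hopfD_velocity h, hopfChart_rot, dhopf_hopfGen, map_zero,
    add_zero, hopfConn_apply, angForm_hopfGen, norm_hopfRot, div_self (by positivity)]

lemma projDeriv_velocity (y : GHSpace P c) (t : ℝ) :
    projDeriv pr (rot t y) (velocity (fun s => rot s y) t) = 0 := by
  obtain ⟨i, ε, h⟩ := exists_hopfChart y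
  rw [projDeriv_pr (rot_mem_source t h), hopfD_velocity h, hopfChart_rot, dhopf_hopfGen]

lemma moment_pr (hm : 0 ≤ m) (k : Fin 3) (y : GHSpace P c) (t : ℝ)
    (u : TangentSpace I4 (rot t y)) :
    gIn m (rot t y) (cplx _ hm k (velocity (fun s => rot s y) t)) u =
      projDeriv pr (rot t y) u k := by
  by_cases hy : ∀ j, pr y ≠ P j
  · rw [gIn_cplx_of_ne (y := rot t y) hm hy, conn_velocity hy, projDeriv_velocity]
    simp
  · push Not at hy
    obtain ⟨j, hj⟩ := hy
    obtain ⟨i, ε, h⟩ := exists_hopfChart y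
    have h0 : velocity (fun s => rot s y) t = 0 := by
      apply injective_hopfD (rot_mem_source t h)
      rw [hopfD_velocity h, hopfChart_eq_zero h hj, map_zero]
      apply E4_ext <;> simp
    rw [h0, map_zero, map_zero, projDeriv_pr (rot_mem_source t h),
      hopfChart_eq_zero (rot_mem_source t h) hj]
    fin_cases k <;> simp

/-- The Hopf charts around the fixed points of the circle action. -/
lemma exists_hopf_chart (i : ι) : ∃ e ∈ IsManifold.maximalAtlas I4 ∞ (GHSpace P c),
    (0 : E4) ∈ e.target ∧ ∀ x ∈ e.source, pr x = P i + hopf (e x) ∧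
      ∀ t, rot t x ∈ e.source ∧ e (rot t x) = hopfRot t (e x) := by
  refine ⟨hopfChart i (GHBundle.centreGauge P i), hopfChart_mem_maximalAtlas _ _, ?_,
    fun x hx => ⟨pr_eq_hopf hx, fun t => ⟨rot_mem_source t hx, hopfChart_rot t x⟩⟩⟩
  change P i + hopf 0 ∈ GHBundle.chartBase P i _
  rw [hopf_eq_zero.2 rfl, add_zero]
  exact ⟨fun j hj => GHBundle.centreGauge_spec P hj, fun _ => rfl⟩

end GHSpace


/-! ### Completeness -/

section Completeness

variable {X : Type} [TopologicalSpace X] [ChartedSpace E4 X] [IsManifold I4 ∞ X]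

/-- The differential of a real function. -/
noncomputable def scalarDeriv (f : X → ℝ) (x : X) : TangentSpace I4 x →L[ℝ] ℝ :=
  mfderiv I4 𝓘(ℝ, ℝ) f x

/-- A function with bounded gradient is Lipschitz for the Riemannian distance. -/
lemma enorm_sub_le_of_riemannianEDist_lt (g : Metric4 X) {f : X → ℝ}
    (hf : ContMDiff I4 𝓘(ℝ, ℝ) ∞ f) {C : NNReal}
    (hC : ∀ x (u : TangentSpace I4 x), |scalarDeriv f x u| ≤ C * √(g.inner x u u)) {x y : X}
    {r : ENNReal} (hr :
      let _ : Bundle.RiemannianBundle (fun x : X => TangentSpace I4 x) := ⟨g.toRiemannianMetric⟩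
      Manifold.riemannianEDist I4 x y < r) :
    ‖f y - f x‖ₑ ≤ C * r := by
  let _ : Bundle.RiemannianBundle (fun x : X => TangentSpace I4 x) := ⟨g.toRiemannianMetric⟩
  have hnorm : ∀ x (u : TangentSpace I4 x), ‖u‖ = √(g.inner x u u) := fun x u =>
    @norm_eq_sqrt_real_inner _ _ _ u
  obtain ⟨γ, h0, h1, hγ, hlen⟩ := Manifold.exists_lt_of_riemannianEDist_lt hr
  have hfγ : ContDiffOn ℝ 1 (f ∘ γ) (Set.Icc 0 1) := by
    rw [← contMDiffOn_iff_contDiffOn]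
    exact (hf.of_le (by simp)).comp_contMDiffOn hγ
  rw [← h0, ← h1]
  refine (enorm_sub_le_lintegral_derivWithin_Icc_of_contDiffOn_Icc hfγ zero_le_one).trans ?_
  refine le_trans ?_ (mul_le_mul_right hlen.le (C : ENNReal))
  rw [Manifold.pathELength_eq_lintegral_mfderivWithin_Icc,
    ← MeasureTheory.lintegral_const_mul' _ _ ENNReal.coe_ne_top]
  refine MeasureTheory.setLIntegral_mono' measurableSet_Icc fun t ht => ?_
  have hu : UniqueMDiffWithinAt 𝓘(ℝ, ℝ) (Set.Icc (0 : ℝ) 1) t :=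
    ((uniqueDiffOn_Icc zero_lt_one) t ht).uniqueMDiffWithinAt
  have h2 := mfderiv_comp_mfderivWithin t (hf.mdifferentiableAt (by simp))
    (hγ.mdifferentiableOn (by simp) t ht) hu
  rw [mfderivWithin_eq_fderivWithin] at h2
  have key : ∀ (w : TangentSpace I4 (γ t)) (z : ℝ), z = scalarDeriv f (γ t) w →
      ‖z‖ₑ ≤ C * ‖w‖ₑ := by
    rintro w z rfl
    have h4 := hC (γ t) w
    rw [← hnorm] at h4
    rw [← ofReal_norm, ← ofReal_norm, ← ENNReal.ofReal_coe_nnreal]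
    exact (ENNReal.ofReal_le_ofReal h4).trans_eq (ENNReal.ofReal_mul NNReal.zero_le_coe)
  exact key _ _ (congrArg (fun L => L (1 : ℝ)) h2)

/-- A Riemannian metric with a proper function of bounded gradient is complete. -/
lemma isCompleteMetric_of_proper [T3Space X] (g : Metric4 X) {f : X → ℝ}
    (hf : ContMDiff I4 𝓘(ℝ, ℝ) ∞ f) {C : NNReal} (hC : ∀ x (u : TangentSpace I4 x),
      |scalarDeriv f x u| ≤ C * √(g.inner x u u))
    (hK : ∀ R, ∃ K : Set X, IsCompact K ∧ ∀ x, f x ≤ R → x ∈ K) : IsCompleteMetric g := by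
  intro u hu
  let _ : Bundle.RiemannianBundle (fun x : X => TangentSpace I4 x) := ⟨g.toRiemannianMetric⟩
  have : IsContinuousRiemannianBundle E4 (fun x : X => TangentSpace I4 x) := by
    exact ⟨⟨g.inner, g.contMDiff.continuous, fun b v w => rfl⟩⟩
  let _ := PseudoEMetricSpace.ofRiemannianMetric I4 X
  obtain ⟨N, hN⟩ := hu 1 one_pos
  obtain ⟨K, hKc, hK⟩ := hK (f (u N) + C)
  have hmem : ∀ n, u (n + N) ∈ K := by
    intro n
    apply hK
    have h1 := enorm_sub_le_of_riemannianEDist_lt g hf hC (hN N le_rfl (n + N) (by omega))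
    rw [mul_one, ← ofReal_norm, ← ENNReal.ofReal_coe_nnreal] at h1
    have h2 := (ENNReal.ofReal_le_ofReal_iff C.2).1 h1
    have := (le_abs_self _).trans h2
    change f (u (n + N)) - f (u N) ≤ (C : ℝ) at this
    linarith
  have hc : CauchySeq (fun n => u (n + N)) := by
    rw [EMetric.cauchySeq_iff]
    intro ε hε
    obtain ⟨M, hM⟩ := hu ε hε
    exact ⟨M, fun i hi j hj => hM _ (by omega) _ (by omega)⟩
  obtain ⟨x, -, hx⟩ := cauchySeq_tendsto_of_isComplete hKc.isComplete hmem hc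
  exact ⟨x, (Filter.tendsto_add_atTop_iff_nat N).1 hx⟩

end Completeness

namespace GHSpace

variable {ι : Type} [Fintype ι] [DecidableEq ι] [Nonempty ι]
variable {P : ι ↪ E3} {c : ChartChoice P} {y : GHSpace P c} {m : ℝ}

lemma scalarDeriv_log_pr (u : TangentSpace I4 y) :
    scalarDeriv (fun y : GHSpace P c => Real.log (1 + ‖pr y‖ ^ 2)) y u =
      2 * inner ℝ (pr y) (projDeriv pr y u) / (1 + ‖pr y‖ ^ 2) := by
  have hpos : 1 + ‖pr y‖ ^ 2 ≠ 0 := by positivity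
  have h0 : HasFDerivAt (fun x : E3 => ‖x‖ ^ 2) (2 • innerSL ℝ (pr y)) (pr y) :=
    (hasStrictFDerivAt_norm_sq (pr y)).hasFDerivAt
  have h1 := (h0.const_add 1).log hpos
  have h2 : MDifferentiableAt I4 𝓘(ℝ, E3) (pr : GHSpace P c → E3) y :=
    contMDiff_pr.mdifferentiableAt (by simp)
  have h3 := mfderiv_comp y h1.differentiableAt.mdifferentiableAt h2
  rw [mfderiv_eq_fderiv, h1.fderiv] at h3
  refine (congrArg (fun L => L u) h3).trans ?_
  change (1 + ‖pr y‖ ^ 2)⁻¹ • ((2 • innerSL ℝ (pr y)) (projDeriv pr y u)) = _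
  simp [innerSL_apply_apply]
  ring

/-- The projection stretches lengths at most by a factor of order `|x|^{1/2}`. -/
lemma norm_projDeriv_sq_le (hm : 0 ≤ m) (i : ι) (u : TangentSpace I4 y) :
    ‖projDeriv pr y u‖ ^ 2 ≤ 2 * (‖pr y‖ + ‖P i‖) * gIn m y u u := by
  have hg : 0 ≤ gIn m y u u := by rw [gIn_self]; positivity
  by_cases hy : ∀ j, pr y ≠ P j
  · have hd : 0 < ‖pr y - P i‖ := norm_pos_iff.2 (sub_ne_zero.2 (hy i))
    have hle : ‖pr y - P i‖ ≤ ‖pr y‖ + ‖P i‖ := norm_sub_le _ _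
    have h1 : pot P m (pr y) * ‖projDeriv pr y u‖ ^ 2 ≤ gIn m y u u := by
      rw [gIn_of_ne hm hy, real_inner_self_eq_norm_sq]
      have : 0 ≤ (pot P m (pr y))⁻¹ * (conn y u * conn y u) :=
        mul_nonneg (inv_nonneg.2 (pot_pos hm hy).le) (mul_self_nonneg _)
      linarith
    have h2 : 1 / (2 * ‖pr y - P i‖) ≤ pot P m (pr y) := by
      rw [pot_eq_regPot P m i]
      have := regPot_nonneg P hm i (pr y)
      rw [newton]; linarith
    have h3 : ‖projDeriv pr y u‖ ^ 2 ≤ 2 * ‖pr y - P i‖ * gIn m y u u := by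
      have h4 := (mul_le_mul_of_nonneg_right h2 (sq_nonneg ‖projDeriv pr y u‖)).trans h1
      rw [one_div, inv_mul_le_iff₀ (by positivity)] at h4
      exact h4
    refine h3.trans (mul_le_mul_of_nonneg_right (by linarith) hg)
  · push Not at hy
    obtain ⟨j, hj⟩ := hy
    obtain ⟨i', ε, h⟩ := exists_hopfChart y
    have : projDeriv pr y u = 0 := by
      rw [projDeriv_pr h, hopfChart_eq_zero h hj]
      apply E3_ext <;> simp
    rw [this]
    simp only [norm_zero, ne_eq, OfNat.ofNat_ne_zero, not_false_eq_true, zero_pow]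
    positivity

lemma contMDiff_log_pr :
    ContMDiff I4 𝓘(ℝ, ℝ) ∞ (fun y : GHSpace P c => Real.log (1 + ‖pr y‖ ^ 2)) := by
  have h : ContDiff ℝ ∞ (fun x : E3 => Real.log (1 + ‖x‖ ^ 2)) :=
    (contDiff_const.add (contDiff_norm_sq ℝ)).log fun x => by positivity
  exact h.contMDiff.comp contMDiff_pr

/-- The function `log (1 + |x|²)` is proper and has bounded gradient. -/
lemma isComplete_metric (hm : 0 ≤ m) : IsCompleteMetric (metric P c hm) := by
  let i := Classical.arbitrary ι
  have hpos : (0 : ℝ) ≤ 8 * (1 + ‖P i‖) := by positivity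
  refine isCompleteMetric_of_proper (metric P c hm) contMDiff_log_pr
    (C := Real.toNNReal √(8 * (1 + ‖P i‖))) ?_ ?_
  · intro y u
    have hg : 0 ≤ gIn m y u u := by rw [gIn_self]; positivity
    rw [Real.coe_toNNReal _ (Real.sqrt_nonneg _), ← Real.sqrt_mul hpos]
    change _ ≤ √(8 * (1 + ‖P i‖) * gIn m y u u)
    apply Real.le_sqrt_of_sq_le
    rw [sq_abs, scalarDeriv_log_pr]
    have h1 := norm_projDeriv_sq_le hm i u
    have h2 : (inner ℝ (pr y) (projDeriv pr y u)) ^ 2 ≤ ‖pr y‖ ^ 2 * ‖projDeriv pr y u‖ ^ 2 := by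
      rw [← mul_pow, ← sq_abs (inner ℝ _ _)]
      exact pow_le_pow_left₀ (abs_nonneg _) (abs_real_inner_le_norm _ _) 2
    have ha := norm_nonneg (P i)
    have hx := norm_nonneg (pr y)
    generalize ‖P i‖ = a at *
    generalize ‖pr y‖ = x at *
    generalize gIn m y u u = G at *
    generalize (inner ℝ (pr y) (projDeriv pr y u) : ℝ) = s at *
    generalize ‖projDeriv pr y u‖ ^ 2 = T at *
    have h3 : x + a ≤ (1 + a) * (1 + x ^ 2) := by
      nlinarith [sq_nonneg (x - 1), mul_nonneg ha (sq_nonneg x)]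
    have h4 : x ^ 2 * T ≤ (1 + x ^ 2) * (2 * ((1 + a) * (1 + x ^ 2)) * G) := by
      have h5 : 2 * (x + a) * G ≤ 2 * ((1 + a) * (1 + x ^ 2)) * G :=
        mul_le_mul_of_nonneg_right (by linarith) hg
      have h6 : 0 ≤ 2 * ((1 + a) * (1 + x ^ 2)) * G := by positivity
      nlinarith [mul_le_mul_of_nonneg_left (h1.trans h5) (sq_nonneg x)]
    rw [div_pow, div_le_iff₀ (by positivity)]
    nlinarith
  · intro R
    refine ⟨pr ⁻¹' Metric.closedBall 0 (Real.exp R),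
      GHBundle.isCompact_preimage_pr (isCompact_closedBall _ _), fun y hy => ?_⟩
    rw [Set.mem_preimage, mem_closedBall_zero_iff]
    have h1 : 1 + ‖pr y‖ ^ 2 ≤ Real.exp R := by
      rw [← Real.log_le_iff_le_exp (by positivity)]; exact hy
    nlinarith [sq_nonneg (‖pr y‖ - 1)]

lemma pr_notMem_centres (hy : pr y ∉ Finset.univ.map P) (j : ι) : pr y ≠ P j := fun h =>
  hy (by simp [h])

variable (P c) in
/-- The Gibbons-Hawking manifold of the potential `m + ∑ 1 / (2 |x - P j|)`. -/
noncomputable def gibbonsHawking (hm : 0 ≤ m) :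
    GibbonsHawking (GHSpace P c) m (Finset.univ.map P) where
  g := metric P c hm
  proj := pr
  rot := rot
  η := conn
  J k x := cplx x hm k
  proj_smooth := contMDiff_pr
  proj_surjective := GHBundle.pr_surjective
  rot_smooth := contMDiff_rot
  rot_zero := GHBundle.rot_zero
  rot_add := GHBundle.rot_add
  rot_two_pi := GHBundle.rot_two_pi
  fibre := GHBundle.pr_eq_iff
  free y hy t ht := GHBundle.rot_free y (pr_notMem_centres hy) t ht
  hopf_chart p hp := by
    obtain ⟨i, -, rfl⟩ := Finset.mem_map.1 hp
    exact exists_hopf_chart i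
  η_smooth p z hz := (contDiffAt_conn hz.1 (pr_notMem_centres hz.2)).contDiffWithinAt
  η_invariant y hy t u := conn_invariant (pr_notMem_centres hy) t u
  η_generator y hy t := conn_velocity (pr_notMem_centres hy) t
  monopole y hy u v := by
    have hp := mem_extChartAt_target (I := I4) y
    have hy' : ∀ j, pr ((extChartAt I4 y).symm (extChartAt I4 y y)) ≠ P j := by
      rw [extChartAt_to_inv]; exact pr_notMem_centres hy
    have h1 := extD_conn (m := m) hp hy' (toCoords u) (toCoords v)
    have h2 : ∀ u, projDeriv pr y u = fderiv ℝ (pr ∘ (extChartAt I4 y).symm) (extChartAt I4 y y)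
        (toCoords u) := fun u =>
      mfderiv_eq_fderiv_chart (contMDiff_pr.mdifferentiableAt (by simp)) u
    rw [extChartAt_to_inv] at h1
    rw [h2, h2, potential_map]
    exact h1
  metric_eq y hy u v := by
    rw [potential_map]
    exact gIn_of_ne hm (pr_notMem_centres hy) u v
  complete := isComplete_metric hm
  hyperKahler := isHyperKahler_metric hm
  moment k y t u := moment_pr hm k y t u

end GHSpace


/-! ### Metrics that are flat to second order at a point -/

section Flat

set_option synthInstance.maxHeartbeats 200000

variable {U V W : Type*} [NormedAddCommGroup U] [NormedSpace ℝ U] [NormedAddCommGroup V]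
  [NormedSpace ℝ V] [NormedAddCommGroup W] [NormedSpace ℝ W]

/-- A function whose first and second derivatives vanish at a point. -/
structure FlatAt (f : V → W) (x : V) : Prop where
  contDiffAt : ContDiffAt ℝ 2 f x
  fderiv_eq : fderiv ℝ f x = 0
  fderiv_fderiv_eq : fderiv ℝ (fderiv ℝ f) x = 0

lemma ContDiffAt.eventually_differentiableAt {f : V → W} {x : V} (h : ContDiffAt ℝ 2 f x) :
    ∀ᶠ y in 𝓝 x, DifferentiableAt ℝ f y :=
  (h.eventually (by simp)).mono fun _ hy => hy.differentiableAt (by norm_num)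

lemma FlatAt.hasFDerivAt_fderiv {f : V → W} {x : V} (h : FlatAt f x) :
    HasFDerivAt (fderiv ℝ f) (0 : V →L[ℝ] V →L[ℝ] W) x := by
  rw [← h.fderiv_fderiv_eq]; exact h.contDiffAt.differentiableAt_fderiv.hasFDerivAt

lemma FlatAt.congr {f g : V → W} {x : V} (h : FlatAt f x) (hfg : g =ᶠ[𝓝 x] f) : FlatAt g x where
  contDiffAt := h.contDiffAt.congr_of_eventuallyEq hfg
  fderiv_eq := hfg.fderiv_eq.trans h.fderiv_eq
  fderiv_fderiv_eq := hfg.fderiv.fderiv_eq.trans h.fderiv_fderiv_eq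

lemma FlatAt.add {f g : V → W} {x : V} (hf : FlatAt f x) (hg : FlatAt g x) :
    FlatAt (fun y => f y + g y) x where
  contDiffAt := hf.contDiffAt.add hg.contDiffAt
  fderiv_eq := by
    rw [fderiv_fun_add (hf.contDiffAt.differentiableAt (by norm_num))
      (hg.contDiffAt.differentiableAt (by norm_num)), hf.fderiv_eq, hg.fderiv_eq, add_zero]
  fderiv_fderiv_eq := by
    have h : fderiv ℝ (fun y => f y + g y) =ᶠ[𝓝 x] fun y => fderiv ℝ f y + fderiv ℝ g y := by
      filter_upwards [hf.contDiffAt.eventually_differentiableAt,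
        hg.contDiffAt.eventually_differentiableAt] with y h1 h2
      exact fderiv_fun_add h1 h2
    rw [h.fderiv_eq, (hf.hasFDerivAt_fderiv.fun_add hg.hasFDerivAt_fderiv).fderiv, add_zero]

lemma fderiv_comp_eventuallyEq {h : V → W} {f : U → V} {x : U} (hh : ContDiffAt ℝ 2 h (f x))
    (hf : ContDiffAt ℝ 2 f x) :
    fderiv ℝ (fun y => h (f y)) =ᶠ[𝓝 x] fun y => (fderiv ℝ h (f y)).comp (fderiv ℝ f y) := by
  filter_upwards [hf.eventually_differentiableAt,
    hf.continuousAt.eventually hh.eventually_differentiableAt] with y h1 h2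
  exact fderiv_comp y h2 h1

lemma FlatAt.comp_left {h : V → W} {f : U → V} {x : U} (hf : FlatAt f x)
    (hh : ContDiffAt ℝ 2 h (f x)) : FlatAt (fun y => h (f y)) x where
  contDiffAt := hh.comp x hf.contDiffAt
  fderiv_eq := by
    rw [(fderiv_comp_eventuallyEq hh hf.contDiffAt).self_of_nhds]
    simp only [hf.fderiv_eq, ContinuousLinearMap.comp_zero]
  fderiv_fderiv_eq := by
    have h1 : HasFDerivAt (fun y => fderiv ℝ h (f y)) _ x :=
      hh.differentiableAt_fderiv.hasFDerivAt.comp x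
        (hf.contDiffAt.differentiableAt (by norm_num)).hasFDerivAt
    rw [(fderiv_comp_eventuallyEq hh hf.contDiffAt).fderiv_eq,
      (h1.clm_comp hf.hasFDerivAt_fderiv).fderiv, hf.fderiv_eq]
    simp

lemma FlatAt.comp_right {h : V → W} {f : U → V} {x : U} (hh : FlatAt h (f x))
    (hf : ContDiffAt ℝ 2 f x) : FlatAt (fun y => h (f y)) x where
  contDiffAt := hh.contDiffAt.comp x hf
  fderiv_eq := by
    rw [(fderiv_comp_eventuallyEq hh.contDiffAt hf).self_of_nhds]
    simp only [hh.fderiv_eq, ContinuousLinearMap.zero_comp]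
  fderiv_fderiv_eq := by
    have h1 : HasFDerivAt (fun y => fderiv ℝ h (f y)) _ x :=
      hh.hasFDerivAt_fderiv.comp x (hf.differentiableAt (by norm_num)).hasFDerivAt
    rw [(fderiv_comp_eventuallyEq hh.contDiffAt hf).fderiv_eq,
      (h1.clm_comp hf.differentiableAt_fderiv.hasFDerivAt).fderiv, hh.fderiv_eq]
    simp

lemma FlatAt.prodMk {f : U → V} {g : U → W} {x : U} (hf : FlatAt f x) (hg : FlatAt g x) :
    FlatAt (fun y => (f y, g y)) x := by
  have h1 := hf.comp_left (h := ContinuousLinearMap.inl ℝ V W)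
    (ContinuousLinearMap.contDiff _).contDiffAt
  have h2 := hg.comp_left (h := ContinuousLinearMap.inr ℝ V W)
    (ContinuousLinearMap.contDiff _).contDiffAt
  simpa using! h1.add h2

lemma FlatAt.pd_eq_zero {f : E4 → ℝ} {x : E4} (h : FlatAt f x) (i : Fin 4) : pd i f x = 0 := by
  rw [pd, h.fderiv_eq]; rfl

lemma FlatAt.hasFDerivAt_pd {f : E4 → ℝ} {x : E4} (h : FlatAt f x) (i : Fin 4) :
    HasFDerivAt (pd i f) (0 : E4 →L[ℝ] ℝ) x := by
  have := h.hasFDerivAt_fderiv.clm_apply (hasFDerivAt_const (coordBasis i) x)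
  simpa using! this

/-- The product of a continuous function with a function that vanishes to second order. -/
lemma hasFDerivAt_mul_zero {f h : E4 → ℝ} {x : E4} (hf : ContinuousAt f x) (h0 : h x = 0)
    (hh : HasFDerivAt h (0 : E4 →L[ℝ] ℝ) x) :
    HasFDerivAt (fun y => f y * h y) (0 : E4 →L[ℝ] ℝ) x := by
  rw [hasFDerivAt_iff_isLittleO_nhds_zero] at hh ⊢
  simp only [h0, mul_zero, zero_apply, sub_zero] at hh ⊢
  have hb : (fun v => f (x + v)) =O[𝓝 0] fun _ => (1 : ℝ) := by
    have : Filter.Tendsto (fun v => f (x + v)) (𝓝 0) (𝓝 (f x)) := by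
      have h1 : Filter.Tendsto (fun v : E4 => x + v) (𝓝 0) (𝓝 x) := by
        simpa using! (continuous_const.add continuous_id : Continuous fun v : E4 => x + v).tendsto 0
      exact hf.tendsto.comp h1
    exact this.isBigO_one ℝ
  have := hb.mul_isLittleO hh.norm_right
  simp only [one_mul] at this
  exact this.of_norm_right

end Flat

section Curvature

variable {X : Type} [TopologicalSpace X] [ChartedSpace E4 X] [IsManifold I4 ∞ X]

/-- The Christoffel symbols involve first derivatives of the metric only. -/
lemma christoffel_eq_zero (g : Metric4 X) {p : X} {z : E4}
    (h : ∀ i j, FlatAt (fun z => metricMatrix g p z i j) z) (k i j : Fin 4) :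
    christoffel g p k i j z = 0 := by
  simp only [christoffel, (h _ _).pd_eq_zero]
  simp

/-- A metric that is flat to second order at a point has Christoffel symbols with vanishing
derivatives there, since these are linear in the first and second derivatives of the metric. -/
lemma riemannComponent_eq_zero (g : Metric4 X) {p : X} {z : E4}
    (h : ∀ i j, FlatAt (fun z => metricMatrix g p z i j) z)
    (hdet : (metricMatrix g p z).det ≠ 0) (l i j k : Fin 4) :
    riemannComponent g p l i j k z = 0 := by
  have hcont : ContinuousAt (metricMatrix g p) z :=
    continuousAt_pi.2 fun i => continuousAt_pi.2 fun j => (h i j).contDiffAt.continuousAt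
  have hinv : ∀ k l, ContinuousAt (fun y => (metricMatrix g p y)⁻¹ k l) z := by
    intro k l
    have h1 : ContinuousAt (fun y => (metricMatrix g p y).det) z :=
      (continuous_id.matrix_det.continuousAt (x := metricMatrix g p z)).comp hcont
    have h2 : ContinuousAt (fun y => (metricMatrix g p y).adjugate k l) z :=
      ((continuous_id.matrix_adjugate.matrix_elem k l).continuousAt
        (x := metricMatrix g p z)).comp hcont
    simp only [Matrix.inv_def, Ring.inverse_eq_inv', Matrix.smul_apply, smul_eq_mul]
    exact (h1.inv₀ hdet).mul h2
  have hΓ : ∀ k i j, HasFDerivAt (christoffel g p k i j) (0 : E4 →L[ℝ] ℝ) z := by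
    intro k i j
    have h3 : ∀ l, HasFDerivAt (fun y => (metricMatrix g p y)⁻¹ k l *
        (pd i (fun z => metricMatrix g p z j l) y + pd j (fun z => metricMatrix g p z i l) y
          - pd l (fun z => metricMatrix g p z i j) y)) (0 : E4 →L[ℝ] ℝ) z := by
      intro l
      refine hasFDerivAt_mul_zero (hinv k l) ?_ ?_
      · simp only [(h _ _).pd_eq_zero]; simp
      · simpa using! (((h j l).hasFDerivAt_pd i).add ((h i l).hasFDerivAt_pd j)).sub
          ((h i j).hasFDerivAt_pd l)
    have h4 := (HasFDerivAt.fun_sum fun l (_ : l ∈ Finset.univ) => h3 l).const_mul (1 / 2 : ℝ)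
    rw [Finset.sum_const_zero, smul_zero] at h4
    exact h4
  have hpd : ∀ a k i j, pd a (christoffel g p k i j) z = 0 := by
    intro a k i j
    rw [pd, (hΓ k i j).fderiv]; rfl
  simp only [riemannComponent, hpd, christoffel_eq_zero g h]
  simp

end Curvature

/-! ### Primitives of the jets of one-forms -/

section Jets

set_option synthInstance.maxHeartbeats 200000
set_option maxHeartbeats 1000000

variable {V : Type*} [NormedAddCommGroup V] [NormedSpace ℝ V]

/-- The cubic polynomial with the given symmetric Taylor coefficients. -/
noncomputable def cubic (L : V →L[ℝ] ℝ) (M : V →L[ℝ] V →L[ℝ] ℝ) (T : V →L[ℝ] V →L[ℝ] V →L[ℝ] ℝ)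
    (h : V) : ℝ := L h + (1 / 2) * M h h + (1 / 6) * T h h h

lemma contDiff_cubic {n : WithTop ℕ∞} (L : V →L[ℝ] ℝ) (M : V →L[ℝ] V →L[ℝ] ℝ)
    (T : V →L[ℝ] V →L[ℝ] V →L[ℝ] ℝ) : ContDiff ℝ n (cubic L M T) := by
  have hM : ContDiff ℝ n (fun h => M h h) := M.contDiff.clm_apply contDiff_id
  have hT : ContDiff ℝ n (fun h => T h h h) :=
    (T.contDiff.clm_apply contDiff_id).clm_apply contDiff_id
  exact (L.contDiff.add (contDiff_const.mul hM)).add (contDiff_const.mul hT)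

lemma fderiv_cubic (L : V →L[ℝ] ℝ) {M : V →L[ℝ] V →L[ℝ] ℝ} {T : V →L[ℝ] V →L[ℝ] V →L[ℝ] ℝ}
    (hM : ∀ u v, M u v = M v u) (h1 : ∀ u v w, T u v w = T v u w)
    (h2 : ∀ u v w, T u v w = T u w v) (h : V) :
    fderiv ℝ (cubic L M T) h = L + M h + (1 / 2 : ℝ) • T h h := by
  have hid := hasFDerivAt_id (𝕜 := ℝ) h
  have hMd : HasFDerivAt (fun y => M y y) _ h := M.hasFDerivAt.clm_apply hid
  have hTd : HasFDerivAt (fun y => T y y y) _ h := (T.hasFDerivAt.clm_apply hid).clm_apply hid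
  have := (L.hasFDerivAt.fun_add (hMd.const_mul (1 / 2))).fun_add (hTd.const_mul (1 / 6))
  have e : fderiv ℝ (cubic L M T) h = _ := this.fderiv
  rw [e]
  refine ContinuousLinearMap.ext fun v => ?_
  simp
  rw [hM v h, h1 v h h, h2 h v h]
  ring

lemma fderiv_fderiv_cubic (L : V →L[ℝ] ℝ) {M : V →L[ℝ] V →L[ℝ] ℝ}
    {T : V →L[ℝ] V →L[ℝ] V →L[ℝ] ℝ}
    (hM : ∀ u v, M u v = M v u) (h1 : ∀ u v w, T u v w = T v u w)
    (h2 : ∀ u v w, T u v w = T u w v) (h : V) :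
    HasFDerivAt (fderiv ℝ (cubic L M T)) (M + T h) h := by
  have hid := hasFDerivAt_id (𝕜 := ℝ) h
  have e : fderiv ℝ (cubic L M T) = fun h => L + M h + (1 / 2 : ℝ) • T h h :=
    funext fun h => fderiv_cubic L hM h1 h2 h
  rw [e]
  have hTd : HasFDerivAt (fun y => T y y) _ h := T.hasFDerivAt.clm_apply hid
  have := (M.hasFDerivAt.const_add L).fun_add (hTd.const_smul (1 / 2 : ℝ))
  convert! this using 1
  refine ContinuousLinearMap.ext fun v => ContinuousLinearMap.ext fun w => ?_
  simp
  rw [h1 v h w]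
  ring

lemma hasFDerivAt_affine {W : Type*} [NormedAddCommGroup W] [NormedSpace ℝ W] (w : W)
    (T : V →L[ℝ] W)
    (a x : V) : HasFDerivAt (fun x => w + T (x - a)) T x := by
  have := (T.hasFDerivAt.comp x ((hasFDerivAt_id x).sub_const a)).const_add w
  rwa [ContinuousLinearMap.comp_id] at this

/-- If the exterior derivative of a one-form vanishes to first order at a point, then the one-form
agrees to second order with the differential of a cubic polynomial. -/
lemma exists_flatAt_add_fderiv {A : V → V →L[ℝ] ℝ} {a : V} (hA : ContDiffAt ℝ ∞ A a)
    (h0 : ∀ u v, extD A a u v = 0)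
    (h1 : ∀ u v, fderiv ℝ (fun x => extD A x u v) a = 0) :
    ∃ χ : V → ℝ, ContDiff ℝ ∞ χ ∧ χ a = 0 ∧ FlatAt (fun x => A x + fderiv ℝ χ x) a ∧
      A a + fderiv ℝ χ a = 0 := by
  have hA2 : ContDiffAt ℝ 2 A a := hA.of_le (WithTop.coe_le_coe.2 le_top)
  have hA' : ContDiffAt ℝ 2 (fderiv ℝ A) a :=
      (hA.fderiv_right (m := ∞) (by simp)).of_le (WithTop.coe_le_coe.2 le_top)
  have hd := hA2.differentiableAt_fderiv
  set M := fderiv ℝ A a with hM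
  set T := fderiv ℝ (fderiv ℝ A) a with hT
  have hMs : ∀ u v, M u v = M v u := fun u v => sub_eq_zero.1 (h0 u v)
  have hT1 : ∀ u v w, T u v w = T v u w := fun u v w => by
    rw [hT, hA2.fderiv_fderiv_symm u v]
  have hT2 : ∀ u v w, T u v w = T u w v := by
    intro u v w
    have e1 := fun v w : V => (hd.hasFDerivAt.clm_apply (hasFDerivAt_const v a)).clm_apply
      (hasFDerivAt_const w a)
    have e2 := ((e1 v w).fun_sub (e1 w v)).fderiv
    have e3 := h1 v w
    unfold extD at e3
    rw [e3] at e2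
    have e4 := congrArg (fun L => L u) e2
    simp at e4
    linarith
  have hχ : ∀ x, HasFDerivAt (fun x => -cubic (A a) M T (x - a))
      (-(fderiv ℝ (cubic (A a) M T) (x - a))) x := fun x => by
    have h3 : HasFDerivAt (cubic (A a) M T) (fderiv ℝ (cubic (A a) M T) (x - a)) (x - a) :=
      ((contDiff_cubic (n := 1) _ _ _).differentiable (by norm_num) _).hasFDerivAt
    have h4 := (h3.comp x ((hasFDerivAt_id x).sub_const a)).fun_neg
    simpa using! h4
  have hχ' : fderiv ℝ (fun x => -cubic (A a) M T (x - a)) =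
      fun x => -(fderiv ℝ (cubic (A a) M T) (x - a)) := funext fun x => (hχ x).fderiv
  have hc : ContDiff ℝ ∞ (fun x => -cubic (A a) M T (x - a)) :=
    ((contDiff_cubic _ _ _).comp (contDiff_id.sub contDiff_const)).neg
  have hval : A a + fderiv ℝ (fun x => -cubic (A a) M T (x - a)) a = 0 := by
    rw [hχ']
    simp only [sub_self]
    rw [fderiv_cubic _ hMs hT1 hT2]
    simp
  have hcd : ContDiff ℝ ∞ (fderiv ℝ (fun x => -cubic (A a) M T (x - a))) :=
    hc.fderiv_right (by simp)
  have hB1 : ∀ x, HasFDerivAt (fun x => -(fderiv ℝ (cubic (A a) M T) (x - a)))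
      (-(M + T (x - a))) x := fun x => by
    have h3 := fderiv_fderiv_cubic (A a) hMs hT1 hT2 (x - a)
    have h4 := (h3.comp x ((hasFDerivAt_id x).sub_const a)).fun_neg
    rw [ContinuousLinearMap.comp_id] at h4
    exact h4
  refine ⟨fun x => -cubic (A a) M T (x - a), hc, by simp [cubic], ⟨?_, ?_, ?_⟩, hval⟩
  · exact hA2.add (hcd.of_le (WithTop.coe_le_coe.2 le_top)).contDiffAt
  · rw [hχ', ((hA2.differentiableAt (by norm_num)).hasFDerivAt.fun_add (hB1 a)).fderiv]
    simp [hM]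
  · have h5 : fderiv ℝ (fun x => A x + fderiv ℝ (fun x => -cubic (A a) M T (x - a)) x) =ᶠ[𝓝 a]
        fun x => fderiv ℝ A x - (M + T (x - a)) := by
      filter_upwards [hA2.eventually_differentiableAt] with x hx
      rw [hχ', (hx.hasFDerivAt.fun_add (hB1 x)).fderiv]
      exact (sub_eq_add_neg (fderiv ℝ A x) (M + T (x - a))).symm
    have h6 := hasFDerivAt_affine M T a a
    rw [h5.fderiv_eq]
    refine (hd.hasFDerivAt.fun_sub h6).fderiv.trans ?_
    refine ContinuousLinearMap.ext fun u => ?_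
    exact sub_self (T u)

end Jets


/-! ### Charts adapted to a fibre -/

section GaugeChart

/-- The point of `ℝ⁴` with first coordinate `s` and remaining coordinates `x`. -/
noncomputable def joinE4 (s : ℝ) (x : E3) : E4 := !₂[s, x 0, x 1, x 2]

/-- The last three coordinates of a point of `ℝ⁴`. -/
noncomputable def spatial : E4 →L[ℝ] E3 := LinearMap.toContinuousLinearMap
  { toFun := fun z => !₂[z 1, z 2, z 3]
    map_add' := fun x y => by apply E3_ext <;> simp
    map_smul' := fun a x => by apply E3_ext <;> simp }

lemma spatial_apply (z : E4) : spatial z = !₂[z 1, z 2, z 3] := rfl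

@[simp] lemma joinE4_zero (s : ℝ) (x : E3) : joinE4 s x 0 = s := rfl

@[simp] lemma spatial_joinE4 (s : ℝ) (x : E3) : spatial (joinE4 s x) = x := by
  apply E3_ext <;> simp [spatial_apply, joinE4]

@[simp] lemma joinE4_spatial (z : E4) : joinE4 (z 0) (spatial z) = z := by
  apply E4_ext <;> simp [spatial_apply, joinE4]

lemma contDiff_joinE4 {n : WithTop ℕ∞} : ContDiff ℝ n fun p : ℝ × E3 => joinE4 p.1 p.2 := by
  rw [contDiff_euclidean]
  have h := fun j : Fin 3 => (contDiff_coord (n := n) j).comp (contDiff_snd (E := ℝ) (F := E3))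
  intro i
  fin_cases i
  · exact contDiff_fst
  · exact h 0
  · exact h 1
  · exact h 2

lemma spinor_ext {q r : E4} (h : ∀ b, spinor b q = spinor b r) : q = r := by
  rw [← ofSpinor_spinor q, ← ofSpinor_spinor r, funext h]

lemma hopfRot_congr {s t : ℝ} (h : Complex.exp (s * Complex.I) = Complex.exp (t * Complex.I))
    (q : E4) : hopfRot s q = hopfRot t q :=
  spinor_ext fun b => by rw [spinor_hopfRot, spinor_hopfRot, h]

/-- The phase of a spinor coordinate, relative to `t`. -/
noncomputable def phase (e : Bool) (t : ℝ) (q : E4) : ℝ := (spinor e (hopfRot (-t) q)).arg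

lemma contDiff_hopfRot_right {n : WithTop ℕ∞} (t : ℝ) : ContDiff ℝ n (hopfRot t) :=
  ContDiff.comp (g := fun p : ℝ × E4 => hopfRot p.1 p.2) (f := fun q : E4 => (t, q))
    contDiff_hopfRot (contDiff_const.prodMk contDiff_id)

lemma contDiffAt_arg {w : ℂ} (h : w ∈ Complex.slitPlane) : ContDiffAt ℝ ∞ Complex.arg w := by
  have h1 : ContDiffAt ℝ ∞ Complex.log w := (Complex.contDiffAt_log (n := ∞) h).restrict_scalars ℝ
  have h2 : ContDiff ℝ ∞ Complex.imCLM := Complex.imCLM.contDiff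
  have h3 : ContDiffAt ℝ ∞ (fun z => Complex.imCLM (Complex.log z)) w := h2.comp_contDiffAt w h1
  have h4 : (fun z => Complex.imCLM (Complex.log z)) = Complex.arg := by
    funext z; rw [Complex.imCLM_apply, Complex.log_im]
  rw [h4] at h3
  exact h3

lemma contDiffAt_phase {e : Bool} {t : ℝ} {q : E4}
    (h : spinor e (hopfRot (-t) q) ∈ Complex.slitPlane) : ContDiffAt ℝ ∞ (phase e t) q := by
  have h2 : ContDiffAt ℝ ∞ (fun q => spinor e (hopfRot (-t) q)) q :=
    (ContDiff.comp (g := spinor e) (spinor e).contDiff (contDiff_hopfRot_right (-t))).contDiffAt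
  exact ContDiffAt.comp (g := Complex.arg) (f := fun q => spinor e (hopfRot (-t) q)) q
    (contDiffAt_arg h) h2

lemma hopfRot_phase {e : Bool} {t : ℝ} {q : E4} (h : spinor e (hopfRot (-t) q) ≠ 0) :
    hopfRot (t + phase e t q) (hopfSec e (hopf q)) = q := by
  have hq : spinor e q ≠ 0 := by
    rw [spinor_hopfRot] at h; exact right_ne_zero_of_mul h
  have hx := hopf_mem_offAxis.2 hq
  obtain ⟨s, hs⟩ := exists_hopfRot_of_hopf_eq (hopf_hopfSec hx)
  have hpos := secMod_pos hx
  have h1 : spinor e (hopfRot (-t) q) =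
      (secMod e (hopf q) : ℂ) * Complex.exp (((s - t : ℝ) : ℂ) * Complex.I) := by
    conv_lhs => rw [hs]
    rw [← hopfRot_add, spinor_hopfRot, spinor_hopfSec, mul_comm]
    congr 4; ring
  have h2 : Complex.exp ((phase e t q : ℂ) * Complex.I) =
      Complex.exp (((s - t : ℝ) : ℂ) * Complex.I) := by
    have h3 := Complex.norm_mul_exp_arg_mul_I (spinor e (hopfRot (-t) q))
    rw [← phase] at h3
    have h4 : ‖spinor e (hopfRot (-t) q)‖ = secMod e (hopf q) := by
      rw [h1, norm_mul, Complex.norm_exp_ofReal_mul_I, mul_one, Complex.norm_real,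
        Real.norm_of_nonneg hpos.le]
    rw [h4, h1] at h3
    exact mul_left_cancel₀ (Complex.ofReal_ne_zero.2 hpos.ne') h3
  conv_rhs => rw [hs]
  apply hopfRot_congr
  rw [Complex.ofReal_add, add_mul, Complex.exp_add, h2, ← Complex.exp_add]
  congr 1; push_cast; ring

lemma spinor_hopfRot_hopfSec (e : Bool) (t s : ℝ) (x : E3) :
    spinor e (hopfRot (-t) (hopfRot (t + s) (hopfSec e x))) =
      (secMod e x : ℂ) * (Complex.cos s + Complex.sin s * Complex.I) := by
  rw [← hopfRot_add, spinor_hopfRot, spinor_hopfSec, mul_comm, ← Complex.exp_mul_I]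
  congr 4; ring

lemma phase_hopfRot_hopfSec {e : Bool} {t s : ℝ} {x : E3} (hx : x ∈ offAxis e)
    (hs : s ∈ Set.Ioo (-Real.pi) Real.pi) : phase e t (hopfRot (t + s) (hopfSec e x)) = s := by
  rw [phase, spinor_hopfRot_hopfSec,
    Complex.arg_mul_cos_add_sin_mul_I (secMod_pos hx) ⟨hs.1, hs.2.le⟩]

/-- The parametrization of `ℂ²` by the angle from the gauge-transformed section and by the base. -/
noncomputable def gaugeSec (p : E3) (e : Bool) (χ : E3 → ℝ) (t : ℝ) (z : E4) : E4 :=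
  hopfRot (t + (z 0 + χ (spatial z))) (hopfSec e (spatial z - p))

/-- The angle from the gauge-transformed section, together with the shifted Hopf map. -/
noncomputable def gaugeFun (p : E3) (e : Bool) (χ : E3 → ℝ) (t : ℝ) (q : E4) : E4 :=
  joinE4 (phase e t q - χ (p + hopf q)) (p + hopf q)

lemma contDiffAt_gaugeSec {e : Bool} {χ : E3 → ℝ} (hχ : ContDiff ℝ ∞ χ) {p : E3} {t : ℝ} {z : E4}
    (h : spatial z - p ∈ offAxis e) : ContDiffAt ℝ ∞ (gaugeSec p e χ t) z := by
  have h1 : ContDiffAt ℝ ∞ (fun z : E4 => hopfSec e (spatial z - p)) z :=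
    ContDiffAt.comp (g := hopfSec e) (f := fun z => spatial z - p) z (contDiffAt_hopfSec h)
      (spatial.contDiff.contDiffAt.sub contDiffAt_const)
  have h2 : ContDiffAt ℝ ∞ (fun z : E4 => t + (z 0 + χ (spatial z))) z :=
    contDiffAt_const.add ((contDiff_coord 0).contDiffAt.add (hχ.comp spatial.contDiff).contDiffAt)
  exact ContDiffAt.comp (g := fun p : ℝ × E4 => hopfRot p.1 p.2)
    (f := fun z : E4 => (t + (z 0 + χ (spatial z)), hopfSec e (spatial z - p))) z
    contDiff_hopfRot.contDiffAt (h2.prodMk h1)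

lemma contDiffAt_gaugeFun {e : Bool} {χ : E3 → ℝ} (hχ : ContDiff ℝ ∞ χ) {p : E3} {t : ℝ} {q : E4}
    (h : spinor e (hopfRot (-t) q) ∈ Complex.slitPlane) : ContDiffAt ℝ ∞ (gaugeFun p e χ t) q := by
  have h1 : ContDiffAt ℝ ∞ (fun q => p + hopf q) q := contDiffAt_const.add contDiff_hopf.contDiffAt
  have h3 : ContDiffAt ℝ ∞ (fun q => χ (p + hopf q)) q :=
    ContDiffAt.comp (g := χ) (f := fun q => p + hopf q) q hχ.contDiffAt h1
  have h2 := (contDiffAt_phase h).sub h3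
  exact ContDiffAt.comp (g := fun p : ℝ × E3 => joinE4 p.1 p.2)
    (f := fun q : E4 => (phase e t q - χ (p + hopf q), p + hopf q)) q
    contDiff_joinE4.contDiffAt (h2.prodMk h1)

lemma gaugeSec_gaugeFun {p : E3} {e : Bool} {χ : E3 → ℝ} {t : ℝ} {q : E4}
    (h : spinor e (hopfRot (-t) q) ≠ 0) : gaugeSec p e χ t (gaugeFun p e χ t q) = q := by
  rw [gaugeSec, gaugeFun, spatial_joinE4, joinE4_zero, sub_add_cancel, add_sub_cancel_left]
  exact hopfRot_phase h

lemma gaugeFun_gaugeSec {p : E3} {e : Bool} {χ : E3 → ℝ} {t : ℝ} {z : E4}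
    (h : spatial z - p ∈ offAxis e) (h' : z 0 + χ (spatial z) ∈ Set.Ioo (-Real.pi) Real.pi) :
    gaugeFun p e χ t (gaugeSec p e χ t z) = z := by
  rw [gaugeSec, gaugeFun, hopf_hopfRot, hopf_hopfSec h, add_sub_cancel, phase_hopfRot_hopfSec h h',
    add_sub_cancel_right, joinE4_spatial]

/-- The chart of `ℂ²` given by the fibre coordinate `phase - χ`, counted from the section
`hopfSec` rotated by `t`, and by the Hopf map shifted by `p`. -/
noncomputable def gaugeChart (p : E3) (e : Bool) (χ : E3 → ℝ) (hχ : ContDiff ℝ ∞ χ) (t : ℝ) :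
    OpenPartialHomeomorph E4 E4 where
  toFun := gaugeFun p e χ t
  invFun := gaugeSec p e χ t
  source := {q | spinor e (hopfRot (-t) q) ∈ Complex.slitPlane}
  target := {z | spatial z - p ∈ offAxis e ∧ z 0 + χ (spatial z) ∈ Set.Ioo (-Real.pi) Real.pi}
  map_source' q hq := by
    have hq : spinor e (hopfRot (-t) q) ∈ Complex.slitPlane := hq
    have h0 := Complex.slitPlane_ne_zero hq
    have h1 : spinor e q ≠ 0 := by rw [spinor_hopfRot] at h0; exact right_ne_zero_of_mul h0
    refine ⟨?_, ?_⟩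
    · rw [gaugeFun, spatial_joinE4, add_sub_cancel_left]; exact hopf_mem_offAxis.2 h1
    · rw [gaugeFun, spatial_joinE4, joinE4_zero, sub_add_cancel]
      exact ⟨Complex.neg_pi_lt_arg _, lt_of_le_of_ne (Complex.arg_le_pi _)
        (Complex.mem_slitPlane_iff_arg.1 hq).1⟩
  map_target' z hz := by
    have h1 := spinor_hopfRot_hopfSec e t (z 0 + χ (spatial z)) (spatial z - p)
    have h2 := phase_hopfRot_hopfSec (t := t) hz.1 hz.2
    refine Complex.mem_slitPlane_iff_arg.2 ⟨?_, ?_⟩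
    · exact fun h => hz.2.2.ne (h2.symm.trans h)
    · rw [gaugeSec, h1, Complex.cos_add_sin_I]
      exact mul_ne_zero (Complex.ofReal_ne_zero.2 (secMod_pos hz.1).ne') (Complex.exp_ne_zero _)
  left_inv' q hq := gaugeSec_gaugeFun (Complex.slitPlane_ne_zero hq)
  right_inv' z hz := gaugeFun_gaugeSec hz.1 hz.2
  open_source := by
    have h0 : Continuous (hopfRot (-t)) := (contDiff_hopfRot_right (n := 0) (-t)).continuous
    exact Complex.isOpen_slitPlane.preimage ((spinor e).continuous.comp h0)
  open_target := by
    have h1 : IsOpen {z : E4 | spatial z - p ∈ offAxis e} :=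
      (isOpen_offAxis e).preimage (spatial.continuous.sub continuous_const)
    have h2 : Continuous fun z : E4 => z 0 + χ (spatial z) :=
      (contDiff_coord (n := 0) 0).continuous.add (hχ.continuous.comp spatial.continuous)
    exact h1.inter (isOpen_Ioo.preimage h2)
  continuousOn_toFun q hq := (contDiffAt_gaugeFun hχ hq).continuousAt.continuousWithinAt
  continuousOn_invFun z hz := (contDiffAt_gaugeSec hχ hz.1).continuousAt.continuousWithinAt

variable {p : E3} {e : Bool} {χ : E3 → ℝ} {hχ : ContDiff ℝ ∞ χ} {t : ℝ}

lemma gaugeChart_mem_groupoid : gaugeChart p e χ hχ t ∈ contDiffGroupoid ∞ I4 := by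
  rw [contDiffGroupoid, mem_groupoid_of_pregroupoid]
  constructor
  · have : ContDiffOn ℝ ∞ (gaugeChart p e χ hχ t) (gaugeChart p e χ hχ t).source :=
      fun q hq => (contDiffAt_gaugeFun hχ hq).contDiffWithinAt
    simpa [contDiffPregroupoid] using! this
  · have : ContDiffOn ℝ ∞ (gaugeChart p e χ hχ t).symm (gaugeChart p e χ hχ t).target :=
      fun z hz => (contDiffAt_gaugeSec hχ hz.1).contDiffWithinAt
    simpa [contDiffPregroupoid] using! this

lemma StructureGroupoid.trans_mem_maximalAtlas {H M : Type*} [TopologicalSpace H]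
    [TopologicalSpace M] [ChartedSpace H M] {G : StructureGroupoid H} [HasGroupoid M G]
    {f : OpenPartialHomeomorph M H} {τ : OpenPartialHomeomorph H H} (hf : f ∈ G.maximalAtlas M)
    (hτ : τ ∈ G) : f ≫ₕ τ ∈ G.maximalAtlas M := by
  rw [mem_maximalAtlas_iff] at hf ⊢
  intro e' he'
  obtain ⟨h1, h2⟩ := hf e' he'
  refine ⟨?_, ?_⟩
  · rw [OpenPartialHomeomorph.trans_symm_eq_symm_trans_symm, OpenPartialHomeomorph.trans_assoc]
    exact G.trans (G.symm hτ) h1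
  · rw [← OpenPartialHomeomorph.trans_assoc]
    exact G.trans h2 hτ

end GaugeChart


/-! ### Flat gauges -/

section FibreGauge

lemma hopfRot_eq (t : ℝ) (q : E4) :
    hopfRot t q = Real.cos t • q + Real.sin t • hopfGen q := by
  apply E4_ext <;> simp <;> ring

lemma hopfGen_hopfRot (t : ℝ) (q : E4) :
    hopfGen (hopfRot t q) = -Real.sin t • q + Real.cos t • hopfGen q := by
  apply E4_ext <;> simp <;> ring

/-- `hopfGen` as a continuous linear map. -/
noncomputable def hopfGenL : E4 →L[ℝ] E4 := LinearMap.toContinuousLinearMap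
  { toFun := hopfGen
    map_add' := fun x y => by apply E4_ext <;> simp <;> ring
    map_smul' := fun c x => by apply E4_ext <;> simp }

lemma hopfConn_add_smul_hopfGen {q : E4} (hq : q ≠ 0) (t s : ℝ) (v : E4) :
    hopfConn (hopfRot t q) (s • hopfGen (hopfRot t q) + hopfRot t v) = s + hopfConn q v := by
  have h : ‖q‖ ≠ 0 := norm_ne_zero_iff.2 hq
  rw [hopfConn_apply, hopfConn_apply, map_add, map_smul, angForm_hopfGen, angForm_hopfRot,
    norm_hopfRot, smul_eq_mul]
  field_simp

/-- The Hopf connection form in a rotated section. -/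
lemma hopfConn_fderiv_hopfRot {V : Type*} [NormedAddCommGroup V] [NormedSpace ℝ V] {s : V → ℝ}
    {σ : V → E4} {x : V} (hs : DifferentiableAt ℝ s x) (hσ : DifferentiableAt ℝ σ x) (h0 : σ x ≠ 0)
    (u : V) : hopfConn (hopfRot (s x) (σ x)) (fderiv ℝ (fun x => hopfRot (s x) (σ x)) x u) =
      fderiv ℝ s x u + hopfConn (σ x) (fderiv ℝ σ x u) := by
  have h1 : HasFDerivAt (fun x => hopfGenL (σ x)) (hopfGenL.comp (fderiv ℝ σ x)) x :=
    hopfGenL.hasFDerivAt.comp x hσ.hasFDerivAt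
  have h2 := (hs.hasFDerivAt.cos.fun_smul hσ.hasFDerivAt).fun_add (hs.hasFDerivAt.sin.fun_smul h1)
  have h3 : (fun x => hopfRot (s x) (σ x)) =
      fun x => Real.cos (s x) • σ x + Real.sin (s x) • hopfGenL (σ x) :=
    funext fun x => hopfRot_eq _ _
  rw [← hopfConn_add_smul_hopfGen h0 (s x), h3, h2.fderiv, hopfGen_hopfRot,
    hopfRot_eq _ (fderiv ℝ σ x u)]
  congr 1
  apply E4_ext <;> simp [hopfGenL] <;> ring

variable {ι : Type} [Fintype ι] [DecidableEq ι] [Nonempty ι]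

/-- The connection form in the gauge given by the sections `hopfSec (ε j)` and the phase `χ`. -/
noncomputable def gaugeForm (P : ι ↪ E3) (ε : ι → Bool) (χ : E3 → ℝ) (x : E3) : E3 →L[ℝ] ℝ :=
  ∑ j, diracForm (ε j) (x - P j) + fderiv ℝ χ x

/-- A gauge around a point `a` in which the connection form and its first two derivatives vanish
at `a`. -/
structure FlatGauge (P : ι ↪ E3) (a : E3) where
  /-- the choice of a half-axis for each centre -/
  ε : ι → Bool
  /-- the phase -/
  χ : E3 → ℝ
  mem_offAxis : ∀ j, a - P j ∈ offAxis (ε j)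
  contDiff : ContDiff ℝ ∞ χ
  eq_zero : χ a = 0
  flatAt : FlatAt (gaugeForm P ε χ) a
  gaugeForm_eq : gaugeForm P ε χ a = 0

/-- If the potential is constant to second order at `a`, then the curvature `-∗dφ` of the connection
vanishes to first order there, and a change of phase flattens the connection form. -/
lemma exists_flatGauge {P : ι ↪ E3} {a : E3} {m : ℝ} (ha : ∀ j, a ≠ P j)
    (h1 : fderiv ℝ (pot P m) a = 0) (h2 : fderiv ℝ (fderiv ℝ (pot P m)) a = 0) :
    Nonempty (FlatGauge P a) := by
  choose ε hε using fun j => exists_mem_offAxis (sub_ne_zero.2 (ha j))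
  have hcd : ∀ j x, x - P j ∈ offAxis (ε j) →
      ContDiffAt ℝ ∞ (fun x => diracForm (ε j) (x - P j)) x := fun j x hx =>
    ContDiffAt.comp (g := diracForm (ε j)) (f := fun x => x - P j) x (contDiffAt_diracForm hx)
      (contDiffAt_id.sub contDiffAt_const)
  have hA : ContDiffAt ℝ ∞ (fun x => ∑ j, diracForm (ε j) (x - P j)) a :=
    ContDiffAt.sum fun j _ => hcd j a (hε j)
  have hE : ∀ x, (∀ j, x - P j ∈ offAxis (ε j)) → ∀ u v,
      extD (fun x => ∑ j, diracForm (ε j) (x - P j)) x u v =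
        -fderiv ℝ (pot P m) x (cross u v) := by
    intro x hx u v
    rw [extD_sum _ fun j _ => (hcd j x (hx j)).differentiableAt (by simp),
      fderiv_pot fun j => sub_ne_zero.1 (ne_zero_of_mem_offAxis (hx j)), ← Finset.sum_neg_distrib]
    refine Finset.sum_congr rfl fun j _ => ?_
    rw [← extD_diracForm (hx j), extD, extD, fderiv_comp_sub]
  have hev : ∀ᶠ x in 𝓝 a, ∀ j, x - P j ∈ offAxis (ε j) := by
    rw [Filter.eventually_all]
    intro j
    have h : ContinuousAt (fun x : E3 => x - P j) a := continuousAt_id.sub continuousAt_const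
    exact h.eventually ((isOpen_offAxis (ε j)).eventually_mem (hε j))
  obtain ⟨χ, hχ, h0, hflat, hval⟩ := exists_flatAt_add_fderiv hA
    (fun u v => by rw [hE a hε, h1, zero_apply, neg_zero])
    (fun u v => by
      have h3 : (fun x => extD (fun x => ∑ j, diracForm (ε j) (x - P j)) x u v) =ᶠ[𝓝 a]
          fun x => -fderiv ℝ (pot P m) x (cross u v) := by
        filter_upwards [hev] with x hx using hE x hx u v
      have h4 : DifferentiableAt ℝ (fderiv ℝ (pot P m)) a :=
        (contDiffAt_pot (n := 2) ha).differentiableAt_fderiv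
      rw [h3.fderiv_eq, fderiv_fun_neg]
      refine ContinuousLinearMap.ext fun w => ?_
      rw [neg_apply, fderiv_clm_apply_const h4, h2]
      simp)
  exact ⟨⟨ε, χ, hε, hχ, h0, hflat, hval⟩⟩

namespace FlatGauge

variable {P : ι ↪ E3} {a : E3} (G : FlatGauge P a) (i : ι)

lemma mem_chartBase : a ∈ GHBundle.chartBase P i G.ε :=
  ⟨fun j _ => G.mem_offAxis j, fun h =>
    absurd (sub_eq_zero.2 h) (ne_zero_of_mem_offAxis (G.mem_offAxis i))⟩

lemma exists_hopfRot (y : GHBundle P) (h : GHBundle.pr y = a) :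
    ∃ t, GHBundle.hopfChart P i G.ε y = hopfRot t (hopfSec (G.ε i) (a - P i)) := by
  have hy : y ∈ (GHBundle.hopfChart P i G.ε).source := by
    change GHBundle.pr y ∈ GHBundle.chartBase P i G.ε; rw [h]; exact G.mem_chartBase i
  have h2 := GHBundle.pr_eq_hopf hy
  apply exists_hopfRot_of_hopf_eq
  rw [hopf_hopfSec (G.mem_offAxis i), sub_eq_iff_eq_add', ← h2, h]

/-- The position of a point of the fibre over `a`, relative to the section `hopfSec`. -/
noncomputable def time (y : GHBundle P) (h : GHBundle.pr y = a) : ℝ :=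
  (G.exists_hopfRot i y h).choose

lemma hopfChart_eq (y : GHBundle P) (h : GHBundle.pr y = a) : GHBundle.hopfChart P i G.ε y =
    hopfRot (G.time i y h) (hopfSec (G.ε i) (a - P i)) :=
  (G.exists_hopfRot i y h).choose_spec

/-- The chart adapted to a point of the fibre over `a`: the angle from that point, in the flat
gauge, and the projection to `ℝ³`. -/
noncomputable def chart (y : GHBundle P) (h : GHBundle.pr y = a) :
    OpenPartialHomeomorph (GHBundle P) E4 :=
  GHBundle.hopfChart P i G.ε ≫ₕ
    gaugeChart (P i) (G.ε i) G.χ G.contDiff (G.time i y h)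

lemma mem_chart_source (y : GHBundle P) (h : GHBundle.pr y = a) : y ∈ (G.chart i y h).source := by
  rw [chart, OpenPartialHomeomorph.trans_source]
  refine ⟨?_, ?_⟩
  · change GHBundle.pr y ∈ GHBundle.chartBase P i G.ε; rw [h]; exact G.mem_chartBase i
  · change spinor (G.ε i) (hopfRot (-G.time i y h)
      (GHBundle.hopfChart P i G.ε y)) ∈ Complex.slitPlane
    rw [G.hopfChart_eq i y h, ← hopfRot_add, neg_add_cancel, hopfRot_zero, spinor_hopfSec]
    exact Complex.ofReal_mem_slitPlane.2 (secMod_pos (G.mem_offAxis i))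

open Classical in
/-- The choice of preferred charts that are adapted to the fibre over `a`. -/
noncomputable def chartChoice : ChartChoice P where
  chart y := if h : GHBundle.pr y = a then G.chart i y h else chartAt E4 y
  mem_atlas y := by
    split_ifs with h
    · exact StructureGroupoid.trans_mem_maximalAtlas
        (IsManifold.subset_maximalAtlas (GHBundle.hopfChart_mem_atlas i G.ε))
            gaugeChart_mem_groupoid
    · exact IsManifold.chart_mem_maximalAtlas y
  mem_source y := by
    split_ifs with h
    · exact G.mem_chart_source i y h
    · exact _root_.mem_chart_source E4 y

end FlatGauge

end FibreGauge


/-! ### The metric in adapted charts -/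

section AdaptedChart

variable {ι : Type} [Fintype ι] [DecidableEq ι] [Nonempty ι]

namespace FlatGauge

variable {P : ι ↪ E3} {a : E3} (G : FlatGauge P a) (i : ι)

/-- The total space with charts adapted to the fibre over `a`. -/
abbrev Space : Type := GHSpace P (G.chartChoice i)

variable {G i} {y : G.Space i} {z : E4}

lemma chartAt_eq (h : GHSpace.pr y = a) : chartAt E4 y = G.chart i y h := dif_pos h

lemma extChartAt_apply (h : GHSpace.pr y = a) (x : G.Space i) : extChartAt I4 y x =
    gaugeFun (P i) (G.ε i) G.χ (G.time i y h) (GHSpace.hopfChart i G.ε x) := by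
  rw [extChartAt_coe, chartAt_eq h]; rfl

lemma extChartAt_symm_apply (h : GHSpace.pr y = a) (z : E4) : (extChartAt I4 y).symm z =
    (GHSpace.hopfChart i G.ε).symm (gaugeSec (P i) (G.ε i) G.χ (G.time i y h) z) := by
  rw [extChartAt_coe_symm, chartAt_eq h]; rfl

lemma mem_target_iff (h : GHSpace.pr y = a) : z ∈ (extChartAt I4 y).target ↔
    ((∀ j, spatial z - P j ∈ offAxis (G.ε j)) ∧
      z 0 + G.χ (spatial z) ∈ Set.Ioo (-Real.pi) Real.pi) := by
  have h1 : z ∈ (extChartAt I4 y).target ↔ (spatial z - P i ∈ offAxis (G.ε i) ∧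
      z 0 + G.χ (spatial z) ∈ Set.Ioo (-Real.pi) Real.pi) ∧
      P i + hopf (gaugeSec (P i) (G.ε i) G.χ (G.time i y h) z) ∈ GHBundle.chartBase P i G.ε := by
    rw [extChartAt_target, chartAt_eq h]
    simp only [modelWithCornersSelf_coe_symm, Set.preimage_id, Set.range_id, Set.inter_univ,
      modelWithCornersSelf_coe]
    rfl
  rw [h1]
  constructor
  · rintro ⟨⟨h2, h3⟩, h4⟩
    rw [gaugeSec, hopf_hopfRot, hopf_hopfSec h2, add_sub_cancel] at h4
    refine ⟨fun j => ?_, h3⟩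
    by_cases hj : j = i
    · rw [hj]; exact h2
    · exact h4.1 j hj
  · rintro ⟨h2, h3⟩
    refine ⟨⟨h2 i, h3⟩, ?_⟩
    rw [gaugeSec, hopf_hopfRot, hopf_hopfSec (h2 i), add_sub_cancel]
    exact ⟨fun j _ => h2 j, fun h => absurd (sub_eq_zero.2 h) (ne_zero_of_mem_offAxis (h2 i))⟩

lemma gaugeSec_mem_target (h : GHSpace.pr y = a) (hz : z ∈ (extChartAt I4 y).target) :
    gaugeSec (P i) (G.ε i) G.χ (G.time i y h) z ∈
      (GHSpace.hopfChart i G.ε : OpenPartialHomeomorph (G.Space i) E4).target := by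
  obtain ⟨h2, h3⟩ := (mem_target_iff h).1 hz
  change P i + hopf _ ∈ GHBundle.chartBase P i G.ε
  rw [gaugeSec, hopf_hopfRot, hopf_hopfSec (h2 i), add_sub_cancel]
  exact ⟨fun j _ => h2 j, fun h => absurd (sub_eq_zero.2 h) (ne_zero_of_mem_offAxis (h2 i))⟩

lemma mem_hopfChart_source (h : GHSpace.pr y = a) (hz : z ∈ (extChartAt I4 y).target) :
    (extChartAt I4 y).symm z ∈
    (GHSpace.hopfChart i G.ε : OpenPartialHomeomorph (G.Space i) E4).source := by
  rw [extChartAt_symm_apply h]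
  exact (GHSpace.hopfChart i G.ε).map_target (gaugeSec_mem_target h hz)

lemma hopfChart_extChartAt_symm (h : GHSpace.pr y = a) (hz : z ∈ (extChartAt I4 y).target) :
    GHSpace.hopfChart i G.ε ((extChartAt I4 y).symm z) =
      gaugeSec (P i) (G.ε i) G.χ (G.time i y h) z := by
  rw [extChartAt_symm_apply h]
  exact (GHSpace.hopfChart i G.ε).right_inv (gaugeSec_mem_target h hz)

lemma pr_extChartAt_symm (h : GHSpace.pr y = a) (hz : z ∈ (extChartAt I4 y).target) :
    GHSpace.pr ((extChartAt I4 y).symm z) = spatial z := by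
  rw [GHSpace.pr_eq_hopf (mem_hopfChart_source h hz), hopfChart_extChartAt_symm h hz, gaugeSec,
    hopf_hopfRot, hopf_hopfSec (((mem_target_iff h).1 hz).1 i), add_sub_cancel]

lemma pr_ne (h : GHSpace.pr y = a) (hz : z ∈ (extChartAt I4 y).target) (j : ι) :
    GHSpace.pr ((extChartAt I4 y).symm z) ≠ P j := by
  rw [pr_extChartAt_symm h hz]
  exact sub_ne_zero.1 (ne_zero_of_mem_offAxis (((mem_target_iff h).1 hz).1 j))

lemma projDeriv_chartSymmDeriv (h : GHSpace.pr y = a) (hz : z ∈ (extChartAt I4 y).target) (u : E4) :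
    projDeriv GHSpace.pr ((extChartAt I4 y).symm z) (chartSymmDeriv y z u) = spatial u := by
  have h1 : GHSpace.pr ∘ (extChartAt I4 y).symm =ᶠ[𝓝 z] spatial := by
    filter_upwards [(isOpen_extChartAt_target y).eventually_mem hz] with w hw
    exact pr_extChartAt_symm h hw
  rw [GHSpace.projDeriv_chartSymmDeriv hz, h1.fderiv_eq, ContinuousLinearMap.fderiv]

lemma hasFDerivAt_coordL (j : Fin 4) (z : E4) :
    HasFDerivAt (fun z : E4 => z j) (EuclideanSpace.proj (𝕜 := ℝ) j) z :=
  (EuclideanSpace.proj (𝕜 := ℝ) j : E4 →L[ℝ] ℝ).hasFDerivAt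

/-- The connection form in the gauge `gaugeSec`. -/
lemma hopfConn_gaugeSec (hoff : ∀ j, spatial z - P j ∈ offAxis (G.ε j)) (t : ℝ) (u : E4) :
    hopfConn (gaugeSec (P i) (G.ε i) G.χ t z) (fderiv ℝ (gaugeSec (P i) (G.ε i) G.χ t) z u) +
      regForm P i G.ε (spatial z) (spatial u) =
          u 0 + gaugeForm P G.ε G.χ (spatial z) (spatial u) := by
  have hsec : ContDiffAt ℝ 1 (hopfSec (G.ε i)) (spatial z - P i) := contDiffAt_hopfSec (hoff i)
  have d1 : HasFDerivAt (fun z : E4 => spatial z - P i) spatial z :=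
    spatial.hasFDerivAt.sub_const _
  have d2 : HasFDerivAt (fun z : E4 => hopfSec (G.ε i) (spatial z - P i))
      ((fderiv ℝ (hopfSec (G.ε i)) (spatial z - P i)).comp spatial) z :=
    HasFDerivAt.comp (g := hopfSec (G.ε i)) (f := fun z : E4 => spatial z - P i) z
      (hsec.differentiableAt (by norm_num)).hasFDerivAt d1
  have d3 : HasFDerivAt (fun z : E4 => G.χ (spatial z))
      ((fderiv ℝ G.χ (spatial z)).comp spatial) z :=
    HasFDerivAt.comp (g := G.χ) (f := spatial) z
      (G.contDiff.differentiable (by simp) _).hasFDerivAt spatial.hasFDerivAt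
  have d4 := ((hasFDerivAt_coordL 0 z).fun_add d3).const_add t
  have key := hopfConn_fderiv_hopfRot d4.differentiableAt d2.differentiableAt
    (hopfSec_ne_zero (hoff i)) u
  have h5 : gaugeSec (P i) (G.ε i) G.χ t =
      fun z => hopfRot (t + (z 0 + G.χ (spatial z))) (hopfSec (G.ε i) (spatial z - P i)) := rfl
  rw [h5]
  refine (congrArg (· + _) key).trans ?_
  rw [d4.fderiv, d2.fderiv, gaugeForm, ← Finset.add_sum_erase _ _ (Finset.mem_univ i)]
  simp only [add_apply, ContinuousLinearMap.comp_apply, diracForm, pullForm_apply, regForm]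
  change u 0 + _ + _ + _ = _
  ring

lemma eventuallyEq_gaugeSec (h : GHSpace.pr y = a) (hz : z ∈ (extChartAt I4 y).target) :
    (GHSpace.hopfChart i G.ε : OpenPartialHomeomorph (G.Space i) E4) ∘
      (extChartAt I4 y).symm =ᶠ[𝓝 z] gaugeSec (P i) (G.ε i) G.χ (G.time i y h) := by
  filter_upwards [(isOpen_extChartAt_target y).eventually_mem hz] with w hw
  exact hopfChart_extChartAt_symm h hw

/-- The connection form in the adapted chart. -/
lemma conn_chartSymmDeriv (h : GHSpace.pr y = a) (hz : z ∈ (extChartAt I4 y).target) (u : E4) :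
    GHSpace.conn ((extChartAt I4 y).symm z) (chartSymmDeriv y z u) =
      u 0 + gaugeForm P G.ε G.χ (spatial z) (spatial u) := by
  have hs := mem_hopfChart_source h hz
  have h2 := GHSpace.projDeriv_pr hs (chartSymmDeriv y z u)
  rw [projDeriv_chartSymmDeriv h hz] at h2
  rw [GHSpace.conn_eq hs (pr_ne h hz), ← h2, GHSpace.hopfD_chartSymmDeriv hz hs,
    (eventuallyEq_gaugeSec h hz).fderiv_eq, hopfChart_extChartAt_symm h hz,
    pr_extChartAt_symm h hz, hopfConn_gaugeSec ((mem_target_iff h).1 hz).1]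

/-- The matrix `φ⁻¹ (du₀ + B) ⊗ (du₀ + B) + φ g_E` as a function of `φ` and `B`. -/
noncomputable def ghMatrix (k l : Fin 4) (p : ℝ × (E3 →L[ℝ] ℝ)) : ℝ :=
  p.1⁻¹ * ((coordBasis k 0 + p.2 (spatial (coordBasis k))) *
    (coordBasis l 0 + p.2 (spatial (coordBasis l)))) +
      p.1 * inner ℝ (spatial (coordBasis k)) (spatial (coordBasis l))

lemma contDiffAt_ghMatrix (k l : Fin 4) {p : ℝ × (E3 →L[ℝ] ℝ)} (hp : p.1 ≠ 0) :
    ContDiffAt ℝ 2 (ghMatrix k l) p := by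
  have h1 : ContDiffAt ℝ 2 (fun p : ℝ × (E3 →L[ℝ] ℝ) => p.1) p := contDiffAt_fst
  have h2 : ∀ w : E3, ContDiffAt ℝ 2 (fun p : ℝ × (E3 →L[ℝ] ℝ) => p.2 w) p := fun w =>
    contDiffAt_snd.clm_apply contDiffAt_const
  exact ((h1.inv hp).mul ((contDiffAt_const.add (h2 _)).mul (contDiffAt_const.add (h2 _)))).add
    (h1.mul contDiffAt_const)

variable {m : ℝ}

lemma metricMatrix_eq (hm : 0 ≤ m) (h : GHSpace.pr y = a) (hz : z ∈ (extChartAt I4 y).target)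
    (k l : Fin 4) : metricMatrix (GHSpace.metric P (G.chartChoice i) hm) y z k l =
      ghMatrix k l (pot P m (spatial z), gaugeForm P G.ε G.χ (spatial z)) := by
  change GHSpace.gIn m _ _ _ = _
  rw [GHSpace.gIn_of_ne hm (pr_ne h hz), conn_chartSymmDeriv h hz, conn_chartSymmDeriv h hz,
    projDeriv_chartSymmDeriv h hz, projDeriv_chartSymmDeriv h hz, pr_extChartAt_symm h hz]
  rfl

/-- The origin of the adapted charts. -/
lemma extChartAt_self (h : GHSpace.pr y = a) : extChartAt I4 y y = joinE4 0 a := by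
  have h1 : GHSpace.hopfChart i G.ε y = _ := G.hopfChart_eq i y h
  rw [extChartAt_apply h, h1, gaugeFun, hopf_hopfRot, hopf_hopfSec (G.mem_offAxis i),
    add_sub_cancel, G.eq_zero]
  have h2 := phase_hopfRot_hopfSec (e := G.ε i) (t := G.time i y h) (s := 0) (G.mem_offAxis i)
    ⟨by linarith [Real.pi_pos], Real.pi_pos⟩
  rw [add_zero] at h2
  rw [h2, sub_zero]

lemma joinE4_mem_target (h : GHSpace.pr y = a) {s : ℝ} (hs : s ∈ Set.Ioo (-Real.pi) Real.pi) :
    joinE4 s a ∈ (extChartAt I4 y).target := by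
  rw [mem_target_iff h, spatial_joinE4, joinE4_zero, G.eq_zero, add_zero]
  exact ⟨G.mem_offAxis, hs⟩

lemma ne_centre (G : FlatGauge P a) (j : ι) : a ≠ P j :=
  sub_ne_zero.1 (ne_zero_of_mem_offAxis (G.mem_offAxis j))

lemma flatAt_metricMatrix (hm : 0 ≤ m) (h1 : fderiv ℝ (pot P m) a = 0)
    (h2 : fderiv ℝ (fderiv ℝ (pot P m)) a = 0) (h : GHSpace.pr y = a) (k l : Fin 4) :
    FlatAt (fun z => metricMatrix (GHSpace.metric P (G.chartChoice i) hm) y z k l)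
      (extChartAt I4 y y) := by
  have hp : FlatAt (pot P m) a := ⟨contDiffAt_pot G.ne_centre, h1, h2⟩
  have h3 : FlatAt (fun x => ghMatrix k l (pot P m x, gaugeForm P G.ε G.χ x)) a :=
    (hp.prodMk G.flatAt).comp_left (contDiffAt_ghMatrix k l (pot_pos hm G.ne_centre).ne')
  have h4 : spatial (extChartAt I4 y y) = a := by rw [extChartAt_self h, spatial_joinE4]
  have h3' : ∀ b, b = a → FlatAt (fun x => ghMatrix k l (pot P m x, gaugeForm P G.ε G.χ x)) b := by
    rintro b rfl; exact h3
  have h5 : FlatAt (fun z => ghMatrix k l (pot P m (spatial z), gaugeForm P G.ε G.χ (spatial z)))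
      (extChartAt I4 y y) :=
    FlatAt.comp_right (h := fun x => ghMatrix k l (pot P m x, gaugeForm P G.ε G.χ x)) (f := spatial)
      (h3' _ h4) spatial.contDiff.contDiffAt
  refine h5.congr ?_
  filter_upwards [(isOpen_extChartAt_target y).eventually_mem (mem_extChartAt_target (I := I4) y)]
      with w hw
  exact metricMatrix_eq hm h hw k l

lemma projDeriv_eq (h : GHSpace.pr y = a) (u : TangentSpace I4 y) :
    projDeriv GHSpace.pr y u = spatial (toCoords u) := by
  have h1 : GHSpace.pr ∘ (extChartAt I4 y).symm =ᶠ[𝓝 (extChartAt I4 y y)] spatial := by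
    filter_upwards [(isOpen_extChartAt_target y).eventually_mem
      (mem_extChartAt_target (I := I4) y)] with w hw
    exact pr_extChartAt_symm h hw
  refine (mfderiv_eq_fderiv_chart (GHSpace.contMDiff_pr.mdifferentiableAt (by simp)) u).trans ?_
  rw [h1.fderiv_eq, ContinuousLinearMap.fderiv]

lemma conn_eq (h : GHSpace.pr y = a) (u : TangentSpace I4 y) :
    GHSpace.conn y u = toCoords u 0 := by
  have hz := mem_extChartAt_target (I := I4) y
  have hs : y ∈ (GHSpace.hopfChart i G.ε : OpenPartialHomeomorph (G.Space i) E4).source := by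
    have := mem_hopfChart_source h hz
    rwa [extChartAt_to_inv] at this
  have hy : ∀ j, GHSpace.pr y ≠ P j := by rw [h]; exact G.ne_centre
  have h2 := GHSpace.projDeriv_pr hs u
  rw [projDeriv_eq h] at h2
  have h3 : GHSpace.hopfD i G.ε y u =
      fderiv ℝ (gaugeSec (P i) (G.ε i) G.χ (G.time i y h)) (extChartAt I4 y y) (toCoords u) := by
    refine (mfderiv_eq_fderiv_chart
      ((GHSpace.contMDiffAt_hopfChart hs).mdifferentiableAt (by simp)) u).trans ?_
    rw [(eventuallyEq_gaugeSec h hz).fderiv_eq]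
  have h4 := hopfChart_extChartAt_symm h hz
  rw [extChartAt_to_inv] at h4
  have h5 := pr_extChartAt_symm h hz
  rw [extChartAt_to_inv] at h5
  rw [GHSpace.conn_eq hs hy, ← h2, h3, h4, h5, hopfConn_gaugeSec ((mem_target_iff h).1 hz).1,
      ← h5, h,
    G.gaugeForm_eq, zero_apply, add_zero]

/-- The metric along the fibre over `a`, in adapted coordinates. -/
lemma metric_inner (hm : 0 ≤ m) (h : GHSpace.pr y = a) (u v : TangentSpace I4 y) :
    (GHSpace.metric P (G.chartChoice i) hm).inner y u v =
      (pot P m a)⁻¹ * (toCoords u 0 * toCoords v 0) + pot P m a * (toCoords u 1 * toCoords v 1 +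
        toCoords u 2 * toCoords v 2 + toCoords u 3 * toCoords v 3) := by
  have hy : ∀ j, GHSpace.pr y ≠ P j := by rw [h]; exact G.ne_centre
  change GHSpace.gIn m y u v = _
  rw [GHSpace.gIn_of_ne hm hy, conn_eq h, conn_eq h, projDeriv_eq h, projDeriv_eq h, h, inner_E3]
  rfl

/-- At the origin of an adapted chart the metric is `φ⁻¹ du₀² + φ g_E`. -/
lemma metricMatrix_self (hm : 0 ≤ m) (h : GHSpace.pr y = a) :
    metricMatrix (GHSpace.metric P (G.chartChoice i) hm) y (extChartAt I4 y y) =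
      Matrix.diagonal ![(pot P m a)⁻¹, pot P m a, pot P m a, pot P m a] := by
  ext k l
  rw [metricMatrix_eq hm h (mem_extChartAt_target (I := I4) y), extChartAt_self h, spatial_joinE4,
    G.gaugeForm_eq, ghMatrix, inner_E3]
  fin_cases k <;> fin_cases l <;>
    simp [coordBasis, spatial_apply]

end FlatGauge
end AdaptedChart


/-! ### Second variation along the fibre -/

section SecondVariation

variable {ι : Type} [Fintype ι] [DecidableEq ι] [Nonempty ι]

lemma GHSpace.rot_rot {P : ι ↪ E3} {c : ChartChoice P} (s t : ℝ) (y : GHSpace P c) :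
    rot s (rot t y) = rot (s + t) y := (GHBundle.rot_add s t y).symm

/-- The orbit of a point under the circle action. -/
noncomputable def GHSpace.orbit {P : ι ↪ E3} {c : ChartChoice P} (y : GHSpace P c) :
    SmoothLoop (GHSpace P c) where
  toFun t := rot t y
  smooth := contMDiff_orbit y
  periodic t := (GHBundle.rot_add t (2 * Real.pi) y).trans
    (congrArg (GHBundle.rot t) (GHBundle.rot_two_pi y))

namespace FlatGauge

variable {P : ι ↪ E3} {a : E3} {G : FlatGauge P a} {i : ι} {y : G.Space i} {z : E4}

lemma gaugeSec_rot (h : GHSpace.pr y = a) (σ : ℝ) (z : E4) :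
    gaugeSec (P i) (G.ε i) G.χ (G.time i (GHSpace.rot σ y) h) z =
      gaugeSec (P i) (G.ε i) G.χ (G.time i y h) (z + σ • coordBasis 0) := by
  have h1 := G.hopfChart_eq i (GHSpace.rot σ y) h
  have h2 : GHBundle.hopfChart P i G.ε (GHSpace.rot σ y) =
      hopfRot σ (GHBundle.hopfChart P i G.ε y) := GHSpace.hopfChart_rot σ y
  rw [h2, G.hopfChart_eq i y h, ← hopfRot_add] at h1
  have h3 := congrArg (spinor (G.ε i)) h1
  rw [spinor_hopfRot, spinor_hopfRot, spinor_hopfSec] at h3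
  have h4 := mul_right_cancel₀
    (Complex.ofReal_ne_zero.2 (secMod_pos (G.mem_offAxis i)).ne') h3
  have h5 : spatial (z + σ • coordBasis 0) = spatial z := by
    apply E3_ext <;> simp [spatial_apply, coordBasis]
  have h6 : (z + σ • coordBasis 0) 0 = z 0 + σ := by simp [coordBasis]
  rw [gaugeSec, gaugeSec, h5, h6]
  apply hopfRot_congr
  rw [Complex.ofReal_add, add_mul, Complex.exp_add, ← h4, ← Complex.exp_add]
  congr 1; push_cast; ring

/-- The adapted charts around the points of the fibre differ by translations. -/
lemma chartDeriv_rot (h : GHSpace.pr y = a) {σ : ℝ} (hσ : σ ∈ Set.Ioo (-Real.pi) Real.pi)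
    (u : TangentSpace I4 (GHSpace.rot σ y)) : chartDeriv y (GHSpace.rot σ y) u = toCoords u := by
  have h' : GHSpace.pr (GHSpace.rot σ y) = a := h
  have hz := mem_extChartAt_target (I := I4) (GHSpace.rot σ y)
  have hshift : joinE4 0 a + σ • coordBasis 0 = joinE4 σ a := by
    apply E4_ext <;> simp [joinE4, coordBasis]
  have hmem : extChartAt I4 (GHSpace.rot σ y) (GHSpace.rot σ y) + σ • coordBasis 0 ∈
      (extChartAt I4 y).target := by
    rw [extChartAt_self h', hshift]; exact joinE4_mem_target h hσ
  have hsrc : GHSpace.rot σ y ∈ (extChartAt I4 y).source := by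
    have h1 := (extChartAt I4 y).map_target hmem
    have h2 : (extChartAt I4 y).symm (extChartAt I4 (GHSpace.rot σ y) (GHSpace.rot σ y) +
        σ • coordBasis 0) = GHSpace.rot σ y := by
      rw [extChartAt_symm_apply h, ← gaugeSec_rot h, ← extChartAt_symm_apply h', extChartAt_to_inv]
    rwa [h2] at h1
  have hd : MDifferentiableAt I4 (modelWithCornersSelf ℝ E4) (extChartAt I4 y) (GHSpace.rot σ y) :=
    mdifferentiableAt_extChartAt (by rwa [extChartAt_source] at hsrc)
  refine (mfderiv_eq_fderiv_chart hd u).trans ?_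
  have h1 : extChartAt I4 y ∘ (extChartAt I4 (GHSpace.rot σ y)).symm
      =ᶠ[𝓝 (extChartAt I4 (GHSpace.rot σ y) (GHSpace.rot σ y))] fun z => z + σ • coordBasis 0 := by
    have hc : ContinuousAt (fun z : E4 => z + σ • coordBasis 0)
      (extChartAt I4 (GHSpace.rot σ y) (GHSpace.rot σ y)) := continuousAt_id.add continuousAt_const
    filter_upwards [hc.eventually ((isOpen_extChartAt_target y).eventually_mem hmem)] with w hw
    change extChartAt I4 y ((extChartAt I4 (GHSpace.rot σ y)).symm w) = _
    rw [extChartAt_symm_apply h', gaugeSec_rot h, ← extChartAt_symm_apply h]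
    exact (extChartAt I4 y).right_inv hw
  rw [h1.fderiv_eq, fderiv_add_const, fderiv_fun_id]
  rfl

lemma toCoords_velocity (h : GHSpace.pr y = a) (t : ℝ) :
    toCoords (velocity (GHSpace.orbit y).toFun t) = coordBasis 0 := by
  have h' : GHSpace.pr (GHSpace.rot t y) = a := h
  have hy : ∀ j, GHSpace.pr y ≠ P j := by rw [h]; exact G.ne_centre
  have h1 := GHSpace.conn_velocity hy t
  have h2 := GHSpace.projDeriv_velocity y t
  rw [conn_eq h'] at h1
  rw [projDeriv_eq h'] at h2
  have h3 : ∀ j, spatial (toCoords (velocity (fun s => GHSpace.rot s y) t)) j = 0 := fun j => by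
    rw [h2]; rfl
  apply E4_ext
  · exact h1.trans (by simp [coordBasis])
  · exact (h3 0).trans (by simp [coordBasis])
  · exact (h3 1).trans (by simp [coordBasis])
  · exact (h3 2).trans (by simp [coordBasis])

lemma chartDeriv_orbit (h : GHSpace.pr y = a) {s t : ℝ} (hs : s - t ∈ Set.Ioo (-Real.pi) Real.pi)
    (u : TangentSpace I4 ((GHSpace.orbit y).toFun s)) :
    chartDeriv ((GHSpace.orbit y).toFun t) ((GHSpace.orbit y).toFun s) u = toCoords u := by
  have h1 : (GHSpace.orbit y).toFun s = GHSpace.rot (s - t) (GHSpace.rot t y) := by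
    rw [GHSpace.rot_rot, sub_add_cancel]; rfl
  have h2 : ∀ (w : G.Space i) (hw : w = GHSpace.rot (s - t) (GHSpace.rot t y))
      (u : TangentSpace I4 w), chartDeriv (GHSpace.rot t y) w u = toCoords u := by
    rintro w rfl u
    exact chartDeriv_rot (y := GHSpace.rot t y) h hs u
  exact h2 _ h1 u

variable {m : ℝ}

/-- In the adapted charts the Christoffel symbols vanish along the fibre, and passing from one of
these charts to the next along the fibre is a translation, so that the covariant derivative along
the fibre is the derivative of the components. -/
lemma covDeriv_apply (hm : 0 ≤ m) (h1 : fderiv ℝ (pot P m) a = 0)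
    (h2 : fderiv ℝ (fderiv ℝ (pot P m)) a = 0) (h : GHSpace.pr y = a)
    (V : ∀ t, TangentSpace I4 ((GHSpace.orbit y).toFun t)) (t : ℝ) (k : Fin 4) :
    toCoords (covDeriv (GHSpace.metric P (G.chartChoice i) hm) (GHSpace.orbit y).toFun V t) k =
      deriv (fun s => toCoords (V s) k) t := by
  have hev : (fun s => chartDeriv ((GHSpace.orbit y).toFun t) ((GHSpace.orbit y).toFun s) (V s) k)
      =ᶠ[𝓝 t] fun s => toCoords (V s) k := by
    have hc : ContinuousAt (fun s : ℝ => s - t) t := continuousAt_id.sub continuousAt_const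
    have hmem : t - t ∈ Set.Ioo (-Real.pi) Real.pi := by
      rw [sub_self]; exact ⟨by linarith [Real.pi_pos], Real.pi_pos⟩
    filter_upwards [hc.eventually (isOpen_Ioo.eventually_mem hmem)] with s hs
    rw [chartDeriv_orbit h hs]
  have hΓ : ∀ i' j, christoffel (GHSpace.metric P (G.chartChoice i) hm)
      ((GHSpace.orbit y).toFun t) k
      i' j (extChartAt I4 ((GHSpace.orbit y).toFun t) ((GHSpace.orbit y).toFun t)) = 0 :=
    fun i' j => christoffel_eq_zero _
      (flatAt_metricMatrix (y := GHSpace.rot t y) hm h1 h2 h) k i' j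
  have h3 : toCoords (covDeriv (GHSpace.metric P (G.chartChoice i) hm) (GHSpace.orbit y).toFun V
      t) k =
      deriv (fun s => chartDeriv ((GHSpace.orbit y).toFun t) ((GHSpace.orbit y).toFun s) (V s) k) t
      + ∑ i' : Fin 4, ∑ j : Fin 4, christoffel (GHSpace.metric P (G.chartChoice i) hm)
          ((GHSpace.orbit y).toFun t) k i' j
          (extChartAt I4 ((GHSpace.orbit y).toFun t) ((GHSpace.orbit y).toFun t)) *
          toCoords (velocity (GHSpace.orbit y).toFun t) i' * toCoords (V t) j := rfl
  rw [h3, hev.deriv_eq]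
  simp only [hΓ, zero_mul, Finset.sum_const_zero, add_zero]

/-- The fibre over a point where the potential is constant to second order is a geodesic. -/
lemma isClosedGeodesic_orbit (hm : 0 ≤ m) (h1 : fderiv ℝ (pot P m) a = 0)
    (h2 : fderiv ℝ (fderiv ℝ (pot P m)) a = 0) (h : GHSpace.pr y = a) :
    IsClosedGeodesic (GHSpace.metric P (G.chartChoice i) hm) (GHSpace.orbit y) := by
  refine ⟨fun t h0 => ?_, fun t => ?_⟩
  · have h3 := toCoords_velocity h t
    rw [h0] at h3
    have h4 : (0 : ℝ) = coordBasis 0 0 := congrArg (fun v : E4 => v 0) h3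
    simp [coordBasis] at h4
  · have h3 := covDeriv_apply hm h1 h2 h (velocity (GHSpace.orbit y).toFun) t
    simp only [toCoords_velocity h, deriv_const] at h3
    apply E4_ext
    exacts [h3 0, h3 1, h3 2, h3 3]

/-- The curvature vanishes along the fibre, so that the Jacobi operator is `d²/dt²`. -/
lemma jacobiOperator_apply (hm : 0 ≤ m) (h1 : fderiv ℝ (pot P m) a = 0)
    (h2 : fderiv ℝ (fderiv ℝ (pot P m)) a = 0) (h : GHSpace.pr y = a)
    (V : ∀ t, TangentSpace I4 ((GHSpace.orbit y).toFun t)) (t : ℝ) (k : Fin 4) :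
    toCoords (jacobiOperator (GHSpace.metric P (G.chartChoice i) hm) (GHSpace.orbit y) V t) k =
      deriv (deriv fun s => toCoords (V s) k) t := by
  have hdet : (metricMatrix (GHSpace.metric P (G.chartChoice i) hm) (GHSpace.rot t y)
      (extChartAt I4 (GHSpace.rot t y) (GHSpace.rot t y))).det ≠ 0 := by
    have hp := pot_pos hm G.ne_centre
    rw [metricMatrix_self (y := GHSpace.rot t y) hm h, Matrix.det_diagonal, Fin.prod_univ_four]
    simp [hp.ne']
  have hR : ∀ l i' j k, riemannComponent (GHSpace.metric P (G.chartChoice i) hm)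
      ((GHSpace.orbit y).toFun t) l i' j k
      (extChartAt I4 ((GHSpace.orbit y).toFun t) ((GHSpace.orbit y).toFun t)) = 0 :=
    fun l i' j k => riemannComponent_eq_zero _
      (flatAt_metricMatrix (y := GHSpace.rot t y) hm h1 h2 h) hdet l i' j k
  have h3 : toCoords (jacobiOperator (GHSpace.metric P (G.chartChoice i) hm)
      (GHSpace.orbit y) V t) k =
      toCoords (covDeriv (GHSpace.metric P (G.chartChoice i) hm) (GHSpace.orbit y).toFun
        (covDeriv (GHSpace.metric P (G.chartChoice i) hm) (GHSpace.orbit y).toFun V) t) k -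
      ∑ i' : Fin 4, ∑ j : Fin 4, ∑ k' : Fin 4,
        riemannComponent (GHSpace.metric P (G.chartChoice i) hm)
            ((GHSpace.orbit y).toFun t) k i' j k'
          (extChartAt I4 ((GHSpace.orbit y).toFun t) ((GHSpace.orbit y).toFun t)) *
          toCoords (velocity (GHSpace.orbit y).toFun t) i' * toCoords (V t) j *
          toCoords (velocity (GHSpace.orbit y).toFun t) k' := rfl
  rw [h3, covDeriv_apply hm h1 h2 h]
  simp only [hR, zero_mul, Finset.sum_const_zero, sub_zero]
  congr 1
  funext s
  exact covDeriv_apply hm h1 h2 h V s k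

/-- In the adapted charts a normal field is a smooth periodic map to `ℝ⁴`. -/
lemma contDiff_normalField {g : Metric4 (G.Space i)} (h : GHSpace.pr y = a)
    {V : ∀ t, TangentSpace I4 ((GHSpace.orbit y).toFun t)}
    (hV : IsNormalField g (GHSpace.orbit y) V) (k : Fin 4) :
    ContDiff ℝ ∞ fun s => toCoords (V s) k := by
  rw [contDiff_iff_contDiffAt]
  intro t
  have h1 := (Bundle.contMDiffAt_totalSpace.1 (hV.1 t)).2
  have hc : ContinuousAt (GHSpace.orbit y).toFun t :=
      (GHSpace.orbit y).smooth.continuous.continuousAt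
  have hsrc : ∀ᶠ s in 𝓝 t, (GHSpace.orbit y).toFun s ∈
      (chartAt E4 ((GHSpace.orbit y).toFun t)).source :=
    hc.eventually ((chartAt E4 _).open_source.eventually_mem (_root_.mem_chart_source E4 _))
  have hs : ContinuousAt (fun s : ℝ => s - t) t := continuousAt_id.sub continuousAt_const
  have hmem : t - t ∈ Set.Ioo (-Real.pi) Real.pi := by
    rw [sub_self]; exact ⟨by linarith [Real.pi_pos], Real.pi_pos⟩
  have h2 : ContDiffAt ℝ ∞ (fun s => toCoords (V s)) t := by
    refine h1.contDiffAt.congr_of_eventuallyEq ?_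
    filter_upwards [hsrc, hs.eventually (isOpen_Ioo.eventually_mem hmem)] with s h3 h4
    rw [← chartDeriv_orbit h h4, chartDeriv,
      ← TangentBundle.continuousLinearMapAt_trivializationAt h3]
    exact Bundle.Trivialization.continuousLinearMapAt_apply_of_mem _ _ (by simpa using h3) _
  exact (contDiff_coord k).contDiffAt.comp t h2

lemma periodic_normalField {g : Metric4 (G.Space i)}
    {V : ∀ t, TangentSpace I4 ((GHSpace.orbit y).toFun t)}
    (hV : IsNormalField g (GHSpace.orbit y) V) (k : Fin 4) (t : ℝ) :
    toCoords (V (t + 2 * Real.pi)) k = toCoords (V t) k :=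
  congrArg (fun v : TangentBundle I4 (G.Space i) => toCoords v.2 k) (hV.2.1 t)

end FlatGauge

/-- Integration by parts for periodic functions. -/
lemma integral_mul_deriv_deriv_nonpos {f : ℝ → ℝ} {T : ℝ} (hT : 0 ≤ T) (hf : ContDiff ℝ ∞ f)
    (hp : ∀ t, f (t + T) = f t) : ∫ t in (0 : ℝ)..T, f t * deriv (deriv f) t ≤ 0 := by
  have h1 : ContDiff ℝ ∞ (deriv f) := (contDiff_infty_iff_deriv.1 hf).2
  have h2 : ContDiff ℝ ∞ (deriv (deriv f)) := (contDiff_infty_iff_deriv.1 h1).2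
  have e1 : deriv f T = deriv f 0 := by
    have h3 : (fun t => f (t + T)) = f := funext hp
    have h4 := deriv_comp_add_const f T 0
    rw [h3, zero_add] at h4
    exact h4.symm
  have e2 : f T = f 0 := by simpa using hp 0
  have key := intervalIntegral.integral_mul_deriv_eq_deriv_mul (a := 0) (b := T)
    (u := f) (u' := deriv f) (v := deriv f) (v' := deriv (deriv f))
    (fun x _ => (hf.differentiable (by simp) x).hasDerivAt)
    (fun x _ => (h1.differentiable (by simp) x).hasDerivAt)
    (h1.continuous.intervalIntegrable _ _) (h2.continuous.intervalIntegrable _ _)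
  rw [key, e1, e2, sub_self, zero_sub, neg_nonpos]
  exact intervalIntegral.integral_nonneg hT fun t _ => mul_self_nonneg _

namespace FlatGauge

variable {P : ι ↪ E3} {a : E3} {G : FlatGauge P a} {i : ι} {y : G.Space i} {m : ℝ}

/-- Along such a fibre the curvature vanishes, so `-J` is a nonnegative operator. -/
lemma indexForm_nonneg (hm : 0 ≤ m) (h1 : fderiv ℝ (pot P m) a = 0)
    (h2 : fderiv ℝ (fderiv ℝ (pot P m)) a = 0) (h : GHSpace.pr y = a)
    {V : ∀ t, TangentSpace I4 ((GHSpace.orbit y).toFun t)}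
    (hV : IsNormalField (GHSpace.metric P (G.chartChoice i) hm) (GHSpace.orbit y) V) :
    0 ≤ indexForm (GHSpace.metric P (G.chartChoice i) hm) (GHSpace.orbit y) V := by
  have hp := pot_pos hm G.ne_centre
  set f : Fin 4 → ℝ → ℝ := fun k s => toCoords (V s) k
  have hcd : ∀ k, ContDiff ℝ ∞ (f k) := contDiff_normalField h hV
  have hc : ∀ k, Continuous fun t => f k t * deriv (deriv (f k)) t := fun k =>
    (hcd k).continuous.mul
      (contDiff_infty_iff_deriv.1 (contDiff_infty_iff_deriv.1 (hcd k)).2).2.continuous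
  have hI : ∀ k, ∫ t in (0 : ℝ)..(2 * Real.pi), f k t * deriv (deriv (f k)) t ≤ 0 := fun k =>
    integral_mul_deriv_deriv_nonpos (by positivity) (hcd k) (periodic_normalField hV k)
  have key : ∀ t, (GHSpace.metric P (G.chartChoice i) hm).inner ((GHSpace.orbit y).toFun t) (V t)
      (-jacobiOperator (GHSpace.metric P (G.chartChoice i) hm) (GHSpace.orbit y) V t) =
      -((pot P m a)⁻¹ * (f 0 t * deriv (deriv (f 0)) t) +
        pot P m a * (f 1 t * deriv (deriv (f 1)) t + f 2 t * deriv (deriv (f 2)) t +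
          f 3 t * deriv (deriv (f 3)) t)) := by
    intro t
    rw [map_neg]
    refine congrArg Neg.neg ((metric_inner (y := GHSpace.rot t y) hm h _ _).trans ?_)
    have h3 := jacobiOperator_apply hm h1 h2 h V t
    exact congr_arg₂ (· + ·) (congrArg _ (congrArg _ (h3 0)))
      (congrArg _ (congr_arg₂ (· + ·) (congr_arg₂ (· + ·) (congrArg _ (h3 1)) (congrArg _ (h3 2)))
        (congrArg _ (h3 3))))
  rw [indexForm]
  simp only [key]
  have hi := fun k => (hc k).intervalIntegrable (μ := MeasureTheory.volume) 0 (2 * Real.pi)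
  rw [intervalIntegral.integral_neg, intervalIntegral.integral_add ((hi 0).const_mul _)
    ((((hi 1).add (hi 2)).add (hi 3)).const_mul _), intervalIntegral.integral_const_mul,
    intervalIntegral.integral_const_mul, intervalIntegral.integral_add ((hi 1).add (hi 2)) (hi 3),
    intervalIntegral.integral_add (hi 1) (hi 2)]
  have h4 : 0 < (pot P m a)⁻¹ := inv_pos.2 hp
  nlinarith [hI 0, hI 1, hI 2, hI 3, mul_nonneg h4.le (neg_nonneg.2 (hI 0)),
    mul_nonneg hp.le (neg_nonneg.2 (hI 1)), mul_nonneg hp.le (neg_nonneg.2 (hI 2)),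
    mul_nonneg hp.le (neg_nonneg.2 (hI 3))]

lemma isStableToSecondOrder_orbit (hm : 0 ≤ m) (h1 : fderiv ℝ (pot P m) a = 0)
    (h2 : fderiv ℝ (fderiv ℝ (pot P m)) a = 0) (h : GHSpace.pr y = a) :
    IsStableToSecondOrder (GHSpace.metric P (G.chartChoice i) hm) (GHSpace.orbit y) := by
  refine le_antisymm (iSup₂_le fun W hW => ?_) bot_le
  have hbot : W = ⊥ := by
    refine (Submodule.eq_bot_iff W).2 fun V hV => ?_
    by_contra h0
    exact absurd (hW.2 V hV h0) (not_lt.2 (indexForm_nonneg hm h1 h2 h (hW.1 V hV)))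
  subst hbot
  simp

end FlatGauge

end SecondVariation


/-! ### Lengths of the fibres -/

section FibreLength

variable {ι : Type} [Fintype ι] [DecidableEq ι] [Nonempty ι] {P : ι ↪ E3} {c : ChartChoice P}
  {m : ℝ}

namespace GHSpace

/-- The fibre over `x` has length `2π φ(x)^{-1/2}`. -/
lemma loopLength_orbit (hm : 0 ≤ m) {y : GHSpace P c} (hy : ∀ j, pr y ≠ P j) :
    loopLength (metric P c hm) (orbit y) = 2 * Real.pi * √(pot P m (pr y))⁻¹ := by
  have h : ∀ t, (metric P c hm).inner ((orbit y).toFun t) (velocity (orbit y).toFun t)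
      (velocity (orbit y).toFun t) = (pot P m (pr y))⁻¹ := by
    intro t
    change gIn m (rot t y) (velocity (fun s => rot s y) t) (velocity (fun s => rot s y) t) = _
    rw [gIn_of_ne (y := rot t y) hm hy, conn_velocity hy, projDeriv_velocity, inner_zero_left,
        pr_rot]
    ring
  simp only [loopLength, h]
  simp

lemma continuous_velocity_section : Continuous fun a : ℝ × GHSpace P c =>
    (⟨a, ((1 : ℝ), (0 : E4))⟩ : TangentBundle (𝓘(ℝ, ℝ).prod I4) (ℝ × GHSpace P c)) := by
  have h1 : Continuous fun t : ℝ => (⟨t, (1 : ℝ)⟩ : TangentBundle 𝓘(ℝ, ℝ) ℝ) := by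
    have h3 : Continuous fun t : ℝ =>
        (tangentBundleModelSpaceHomeomorph (modelWithCornersSelf ℝ ℝ)).symm (t, (1 : ℝ)) :=
      (Homeomorph.continuous _).comp (by fun_prop)
    exact h3
  have h2 : Continuous fun y : GHSpace P c => (⟨y, (0 : E4)⟩ : TangentBundle I4 (GHSpace P c)) :=
    (Bundle.contMDiff_zeroSection ℝ (fun y : GHSpace P c => TangentSpace I4 y) (n := ∞)
      (IB := I4) (F := E4)).continuous
  exact (contMDiff_equivTangentBundleProd_symm (I := 𝓘(ℝ, ℝ)) (M := ℝ) (I' := I4)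
    (M' := GHSpace P c) (n := 0)).continuous.comp
        ((h1.comp continuous_fst).prodMk (h2.comp continuous_snd))

lemma velocity_orbit (y : GHSpace P c) (t : ℝ) : velocity (orbit y).toFun t =
    mfderiv (𝓘(ℝ, ℝ).prod I4) I4 (fun a : ℝ × GHSpace P c => rot a.1 a.2) (t, y)
      ((1 : ℝ), (0 : E4)) := by
  have h1 : MDifferentiableAt (𝓘(ℝ, ℝ).prod I4) I4 (fun a : ℝ × GHSpace P c => rot a.1 a.2)
      (t, y) :=
    contMDiff_rot.mdifferentiableAt (by simp)
  have h2 : HasMFDerivAt 𝓘(ℝ, ℝ) (𝓘(ℝ, ℝ).prod I4) (fun s : ℝ => (s, y)) t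
      (ContinuousLinearMap.inl ℝ ℝ E4) := by
    have := (hasMFDerivAt_id (I := 𝓘(ℝ, ℝ)) t).prodMk
        (hasMFDerivAt_const (I := 𝓘(ℝ, ℝ)) (I' := I4) y t)
    exact this
  have h3 := (h1.hasMFDerivAt.comp t h2).mfderiv
  exact congrArg (fun L => L (1 : ℝ)) h3

/-- The orbits of the circle action form a continuous family of loops in the `C¹` topology. -/
lemma continuous_orbit : Continuous (orbit : GHSpace P c → SmoothLoop (GHSpace P c)) := by
  rw [continuous_induced_rng]
  refine ContinuousMap.continuous_of_continuous_uncurry _ ?_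
  have h1 : Continuous (tangentMap (𝓘(ℝ, ℝ).prod I4) I4
      fun a : ℝ × GHSpace P c => rot a.1 a.2) :=
    contMDiff_rot.continuous_tangentMap (by simp)
  have h2 := (h1.comp continuous_velocity_section).comp
    (continuous_swap : Continuous (Prod.swap : GHSpace P c × ℝ → ℝ × GHSpace P c))
  refine h2.congr fun a => ?_
  obtain ⟨y, t⟩ := a
  exact congrArg (fun v => (⟨rot t y, v⟩ : TangentBundle I4 (GHSpace P c)))
      (velocity_orbit y t).symm

end GHSpace

/-- If a fibre is stable then the potential has a local maximum below it. -/
lemma FlatGauge.isLocalMax_of_isStable {a : E3} {G : FlatGauge P a} {i : ι} {y : G.Space i}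
    (hm : 0 ≤ m) (h : GHSpace.pr y = a)
    (hs : IsStable (GHSpace.metric P (G.chartChoice i) hm) (GHSpace.orbit y)) :
    IsLocalMax (pot P m) a := by
  have h1 : ∀ᶠ w in 𝓝 y, loopLength (GHSpace.metric P (G.chartChoice i) hm) (GHSpace.orbit y) ≤
      loopLength (GHSpace.metric P (G.chartChoice i) hm) (GHSpace.orbit w) :=
    GHSpace.continuous_orbit.continuousAt.eventually hs
  -- the orbits through the points `(0, x)` of the chart at `y` are the fibres near that over `a`
  have hz := joinE4_mem_target h (s := 0) ⟨by linarith [Real.pi_pos], Real.pi_pos⟩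
  have h2 : (extChartAt I4 y).symm (joinE4 0 a) = y := by
    rw [← extChartAt_self h, extChartAt_to_inv]
  have h3 : Continuous fun x : E3 => joinE4 0 x :=
    (contDiff_joinE4 (n := 0)).continuous.comp (continuous_const.prodMk continuous_id)
  have h4 : ContinuousAt (fun x : E3 => (extChartAt I4 y).symm (joinE4 0 x)) a :=
    ContinuousAt.comp (g := (extChartAt I4 y).symm) (f := fun x : E3 => joinE4 0 x)
      (continuousAt_chart_symm hz) h3.continuousAt
  have h5 : ∀ᶠ x in 𝓝 a, joinE4 0 x ∈ (extChartAt I4 y).target :=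
    h3.continuousAt.eventually ((isOpen_extChartAt_target y).eventually_mem hz)
  have h6 : Filter.Tendsto (fun x : E3 => (extChartAt I4 y).symm (joinE4 0 x)) (𝓝 a) (𝓝 y) := by
    have := h4.tendsto
    rwa [h2] at this
  filter_upwards [h6.eventually h1, h5] with x hx hx'
  have h7 := pr_extChartAt_symm h hx'
  rw [spatial_joinE4] at h7
  have hne := pr_ne h hx'
  rw [GHSpace.loopLength_orbit hm (by rw [h]; exact G.ne_centre),
      GHSpace.loopLength_orbit hm hne, h7,
    h] at hx
  rw [h7] at hne
  have h8 := le_of_mul_le_mul_left hx (by positivity)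
  have h9 := (Real.sqrt_le_sqrt_iff (inv_nonneg.2 (pot_pos hm hne).le)).1 h8
  exact (inv_le_inv₀ (pot_pos hm G.ne_centre) (pot_pos hm hne)).1 h9

end FibreLength


/-! ### Second derivatives of the potential and the maximum principle -/

section Hessian

lemma fderiv_fderiv_fun_add {V W : Type*} [NormedAddCommGroup V] [NormedSpace ℝ V]
    [NormedAddCommGroup W] [NormedSpace ℝ W] {f g : V → W} {x : V} (hf : ContDiffAt ℝ 2 f x)
    (hg : ContDiffAt ℝ 2 g x) : fderiv ℝ (fderiv ℝ fun y => f y + g y) x =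
      fderiv ℝ (fderiv ℝ f) x + fderiv ℝ (fderiv ℝ g) x := by
  have h : fderiv ℝ (fun y => f y + g y) =ᶠ[𝓝 x] fun y => fderiv ℝ f y + fderiv ℝ g y := by
    filter_upwards [hf.eventually_differentiableAt, hg.eventually_differentiableAt] with y h1 h2
    exact fderiv_fun_add h1 h2
  rw [h.fderiv_eq, fderiv_fun_add hf.differentiableAt_fderiv hg.differentiableAt_fderiv]

lemma fderiv_fderiv_comp_sub {V W : Type*} [NormedAddCommGroup V] [NormedSpace ℝ V]
    [NormedAddCommGroup W] [NormedSpace ℝ W] (f : V → W) (p x : V) :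
    fderiv ℝ (fderiv ℝ fun y => f (y - p)) x = fderiv ℝ (fderiv ℝ f) (x - p) := by
  have h : (fderiv ℝ fun y => f (y - p)) = fun y => fderiv ℝ f (y - p) :=
    funext fun y => fderiv_comp_sub _
  rw [h, fderiv_comp_sub]

/-- The Hessian of a radial function. -/
lemma fderiv_fderiv_radial {F ψ : ℝ → ℝ} {χ : ℝ} {x : E3} (hx : x ≠ 0)
    (hF : ∀ r, 0 < r → HasDerivAt F (r * ψ r) r) (hψ : HasDerivAt ψ (‖x‖ * χ) ‖x‖) (u v : E3) :
    fderiv ℝ (fderiv ℝ fun y : E3 => F ‖y‖) x u v =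
      ψ ‖x‖ * inner ℝ u v + χ * (inner ℝ x u * inner ℝ x v) := by
  have h1 : (fderiv ℝ fun y : E3 => F ‖y‖) =ᶠ[𝓝 x] fun y => ψ ‖y‖ • innerSL ℝ y := by
    filter_upwards [isOpen_ne.eventually_mem hx] with y hy
    have hy' : 0 < ‖y‖ := norm_pos_iff.2 hy
    have h2 := (hF ‖y‖ hy').comp_hasFDerivAt y (hasFDerivAt_norm_E hy)
    refine h2.fderiv.trans ?_
    rw [smul_smul]
    congr 1
    field_simp
  have h3 : HasFDerivAt (fun y : E3 => ψ ‖y‖) ((‖x‖ * χ) • (‖x‖⁻¹ • innerSL ℝ x)) x :=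
    hψ.comp_hasFDerivAt x (hasFDerivAt_norm_E hx)
  have h4 : HasFDerivAt (fun y : E3 => innerSL ℝ y) (innerSL ℝ : E3 →L[ℝ] E3 →L[ℝ] ℝ) x :=
    (innerSL ℝ : E3 →L[ℝ] E3 →L[ℝ] ℝ).hasFDerivAt
  rw [h1.fderiv_eq, (h3.fun_smul h4).fderiv]
  have hx' : ‖x‖ ≠ 0 := norm_ne_zero_iff.2 hx
  have h5 : (innerSL ℝ u) v = inner ℝ u v := rfl
  simp
  field_simp
  rw [h5]

lemma fderiv_fderiv_newton {x : E3} (hx : x ≠ 0) (u v : E3) :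
    fderiv ℝ (fderiv ℝ newton) x u v =
      -1 / (2 * ‖x‖ ^ 3) * inner ℝ u v + 3 / (2 * ‖x‖ ^ 5) * (inner ℝ x u * inner ℝ x v) := by
  have hx' : ‖x‖ ≠ 0 := norm_ne_zero_iff.2 hx
  refine fderiv_fderiv_radial (F := fun r => 1 / (2 * r)) (ψ := fun r => -1 / (2 * r ^ 3)) hx
    (fun r hr => ?_) ?_ u v
  · have := ((hasDerivAt_id r).const_mul 2).inv (by simpa using hr.ne')
    simp only [one_div]
    convert! this using 1
    simp; field_simp
  · have := (((hasDerivAt_pow 3 ‖x‖).const_mul 2).fun_inv (by simpa using hx)).const_mul (-1)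
    simp only [div_eq_mul_inv]
    convert! this using 1
    field_simp
    norm_num
    ring

/-- The strictly subharmonic barrier `|x|⁻²`. -/
lemma fderiv_fderiv_inv_sq {x : E3} (hx : x ≠ 0) (u v : E3) :
    fderiv ℝ (fderiv ℝ fun y : E3 => (‖y‖ ^ 2)⁻¹) x u v =
      -2 / ‖x‖ ^ 4 * inner ℝ u v + 8 / ‖x‖ ^ 6 * (inner ℝ x u * inner ℝ x v) := by
  have hx' : ‖x‖ ≠ 0 := norm_ne_zero_iff.2 hx
  refine fderiv_fderiv_radial (F := fun r => (r ^ 2)⁻¹) (ψ := fun r => -2 / r ^ 4) hx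
    (fun r hr => ?_) ?_ u v
  · have := (hasDerivAt_pow 2 r).fun_inv (by simpa using hr.ne')
    convert! this using 1
    simp; field_simp
  · have := ((hasDerivAt_pow 4 ‖x‖).fun_inv (by simpa using hx)).const_mul (-2)
    simp only [div_eq_mul_inv]
    convert! this using 1
    field_simp
    norm_num
    ring

/-- The Laplacian. -/
noncomputable def laplacian3 (f : E3 → ℝ) (x : E3) : ℝ :=
  ∑ j : Fin 3, fderiv ℝ (fderiv ℝ f) x (EuclideanSpace.single j 1) (EuclideanSpace.single j 1)

lemma laplacian3_eq {f : E3 → ℝ} {x : E3} {α β : ℝ} (h : ∀ u v, fderiv ℝ (fderiv ℝ f) x u v =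
    α * inner ℝ u v + β * (inner ℝ x u * inner ℝ x v)) :
    laplacian3 f x = 3 * α + β * ‖x‖ ^ 2 := by
  simp only [laplacian3, h, Fin.sum_univ_three, inner_E3, norm_sq_E3]
  simp
  ring

lemma laplacian3_newton {x : E3} (hx : x ≠ 0) : laplacian3 newton x = 0 := by
  have hx' : ‖x‖ ≠ 0 := norm_ne_zero_iff.2 hx
  rw [laplacian3_eq (fderiv_fderiv_newton hx)]
  field_simp; ring

lemma laplacian3_inv_sq_pos {x : E3} (hx : x ≠ 0) :
    0 < laplacian3 (fun y : E3 => (‖y‖ ^ 2)⁻¹) x := by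
  have hx' : 0 < ‖x‖ := norm_pos_iff.2 hx
  rw [laplacian3_eq (fderiv_fderiv_inv_sq hx)]
  have : 3 * (-2 / ‖x‖ ^ 4) + 8 / ‖x‖ ^ 6 * ‖x‖ ^ 2 = 2 / ‖x‖ ^ 4 := by field_simp; ring
  rw [this]; positivity

lemma laplacian3_add {f g : E3 → ℝ} {x : E3} (hf : ContDiffAt ℝ 2 f x) (hg : ContDiffAt ℝ 2 g x) :
    laplacian3 (fun y => f y + g y) x = laplacian3 f x + laplacian3 g x := by
  simp only [laplacian3, fderiv_fderiv_fun_add hf hg, add_apply, Finset.sum_add_distrib]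

lemma laplacian3_const_mul {f : E3 → ℝ} {x : E3} (c : ℝ) (hf : ContDiffAt ℝ 2 f x) :
    laplacian3 (fun y => c * f y) x = c * laplacian3 f x := by
  have h : fderiv ℝ (fun y => c * f y) =ᶠ[𝓝 x] fun y => c • fderiv ℝ f y := by
    filter_upwards [hf.eventually_differentiableAt] with y h1
    exact fderiv_const_mul h1 c
  simp only [laplacian3, h.fderiv_eq, fderiv_fun_const_smul hf.differentiableAt_fderiv, smul_apply,
    smul_eq_mul, Finset.mul_sum]

lemma laplacian3_comp_sub (f : E3 → ℝ) (p x : E3) :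
    laplacian3 (fun y => f (y - p)) x = laplacian3 f (x - p) := by
  simp only [laplacian3, fderiv_fderiv_comp_sub]

variable {ι : Type} [Fintype ι] [DecidableEq ι] {P : ι ↪ E3} {m : ℝ}

lemma contDiffAt_newton_sub {n : WithTop ℕ∞} {x p : E3} (h : x ≠ p) :
    ContDiffAt ℝ n (fun z => newton (z - p)) x :=
  ContDiffAt.comp (g := newton) (f := fun z => z - p) x
    (contDiffAt_newton (sub_ne_zero.2 h)) (contDiffAt_id.sub contDiffAt_const)

lemma fderiv_fderiv_pot {x : E3} (h : ∀ j, x ≠ P j) :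
    fderiv ℝ (fderiv ℝ (pot P m)) x = ∑ j, fderiv ℝ (fderiv ℝ newton) (x - P j) := by
  have key : ∀ s : Finset ι, fderiv ℝ (fderiv ℝ fun x => m + ∑ j ∈ s, newton (x - P j)) x =
      ∑ j ∈ s, fderiv ℝ (fderiv ℝ newton) (x - P j) := by
    intro s
    induction s using Finset.induction_on with
    | empty => simp
    | insert j s hj ih =>
      have h1 : (fun x => m + ∑ j ∈ insert j s, newton (x - P j)) =
          fun x => newton (x - P j) + (m + ∑ j ∈ s, newton (x - P j)) := by
        funext x; rw [Finset.sum_insert hj]; ring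
      have h2 : ContDiffAt ℝ 2 (fun x => m + ∑ j ∈ s, newton (x - P j)) x :=
        contDiffAt_const.add (ContDiffAt.sum fun j _ => contDiffAt_newton_sub (h j))
      rw [h1, fderiv_fderiv_fun_add (contDiffAt_newton_sub (h j)) h2, ih, Finset.sum_insert hj,
        fderiv_fderiv_comp_sub]
  exact key Finset.univ

lemma laplacian3_pot {x : E3} (h : ∀ j, x ≠ P j) : laplacian3 (pot P m) x = 0 := by
  rw [laplacian3, fderiv_fderiv_pot h]
  simp only [sum_apply]
  rw [Finset.sum_comm]
  exact Finset.sum_eq_zero fun j _ => laplacian3_newton (sub_ne_zero.2 (h j))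

lemma fderiv_fderiv_nonpos_of_isLocalMax {V : Type*} [NormedAddCommGroup V] [NormedSpace ℝ V]
    {f : V → ℝ} {x : V} (hf : ContDiffAt ℝ 2 f x) (h : IsLocalMax f x) (v : V) :
    fderiv ℝ (fderiv ℝ f) x v v ≤ 0 := by
  by_contra! hpos
  have hl : ∀ t : ℝ, HasDerivAt (fun t : ℝ => x + t • v) v t := fun t => by
    simpa using ((hasDerivAt_id t).smul_const v).const_add x
  have hx : x + (0 : ℝ) • v = x := by simp
  have hc : Filter.Tendsto (fun t : ℝ => x + t • v) (𝓝 0) (𝓝 x) := by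
    have := (hl 0).continuousAt.tendsto
    rwa [hx] at this
  set g : ℝ → ℝ := fun t => f (x + t • v) with hg
  have h1 : deriv g =ᶠ[𝓝 0] fun t => fderiv ℝ f (x + t • v) v := by
    filter_upwards [hc.eventually hf.eventually_differentiableAt] with t ht
    exact (ht.hasFDerivAt.comp_hasDerivAt t (hl t)).deriv
  have h2 : HasDerivAt (fun t : ℝ => fderiv ℝ f (x + t • v) v) (fderiv ℝ (fderiv ℝ f) x v v) 0 := by
    have h3 : HasFDerivAt (fderiv ℝ f) (fderiv ℝ (fderiv ℝ f) x) (x + (0 : ℝ) • v) := by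
      rw [hx]; exact hf.differentiableAt_fderiv.hasFDerivAt
    have h4 := h3.comp_hasDerivAt (0 : ℝ) (hl 0)
    have h5 := h4.clm_apply (hasDerivAt_const (0 : ℝ) v)
    simpa using! h5
  have h3 : deriv (deriv g) 0 = fderiv ℝ (fderiv ℝ f) x v v := by
    rw [h1.deriv_eq, h2.deriv]
  have h4 : IsLocalMax g 0 := by
    have : ∀ᶠ t in 𝓝 (0 : ℝ), f (x + t • v) ≤ f x := hc.eventually h
    filter_upwards [this] with t ht
    simpa [hg] using ht
  have h5 : ContinuousAt g 0 := by
    have h6 : ContinuousAt f (x + (0 : ℝ) • v) := by rw [hx]; exact hf.continuousAt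
    exact ContinuousAt.comp (g := f) (f := fun t : ℝ => x + t • v) h6 (hl 0).continuousAt
  have h6 : IsLocalMin g 0 := isLocalMin_of_deriv_deriv_pos (h3 ▸ hpos) h4.deriv_eq_zero h5
  have h7 : g =ᶠ[𝓝 0] fun _ => g 0 := by
    filter_upwards [h4, h6] with t a b using le_antisymm a b
  have h8 : deriv (deriv g) 0 = 0 := by
    rw [h7.deriv.deriv_eq]; simp
  linarith

lemma laplacian3_nonpos_of_isLocalMax {f : E3 → ℝ} {x : E3} (hf : ContDiffAt ℝ 2 f x)
    (h : IsLocalMax f x) : laplacian3 f x ≤ 0 :=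
  Finset.sum_nonpos fun _ _ => fderiv_fderiv_nonpos_of_isLocalMax hf h _

lemma contDiffAt_inv_sq {n : WithTop ℕ∞} {x b : E3} (h : x ≠ b) :
    ContDiffAt ℝ n (fun y : E3 => (‖y - b‖ ^ 2)⁻¹) x :=
  ((contDiffAt_id.sub contDiffAt_const).norm_sq ℝ).inv (by simpa [sub_eq_zero] using h)

/-- A potential with a local maximum off the charges is constant nearby: otherwise compare it on an
annulus around a nearby point `b`, where it is smaller, with the barrier `|x - b|⁻²`. -/
lemma eventually_eq_of_isLocalMax {a : E3} (ha : ∀ j, a ≠ P j) (h : IsLocalMax (pot P m) a) :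
    ∀ᶠ x in 𝓝 a, pot P m x = pot P m a := by
  by_contra hne
  have hS : ∀ᶠ x in 𝓝 a, ∀ j, x ≠ P j :=
    Filter.eventually_all.2 fun j => isOpen_ne.eventually_mem (ha j)
  obtain ⟨r, hr, hball⟩ := Metric.eventually_nhds_iff_ball.1 (h.and hS)
  obtain ⟨b, hb, hbne⟩ : ∃ b ∈ Metric.ball a (r / 3), pot P m b ≠ pot P m a := by
    by_contra! hc
    exact hne (Filter.mem_of_superset (Metric.ball_mem_nhds a (by positivity)) hc)
  have hba : dist b a < r / 3 := hb
  have hsub : ∀ x, dist x b ≤ r / 2 → pot P m x ≤ pot P m a ∧ ∀ j, x ≠ P j := fun x hx =>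
    hball x (by
      have := dist_triangle x b a
      rw [Metric.mem_ball]; linarith)
  have hb' := hsub b (by rw [dist_self]; positivity)
  set δ := (pot P m a - pot P m b) / 2 with hδ
  have hδ0 : 0 < δ := by
    have := lt_of_le_of_ne hb'.1 hbne
    rw [hδ]; linarith
  have hcb : ContinuousAt (pot P m) b := (contDiffAt_pot (n := 0) hb'.2).continuousAt
  obtain ⟨s, hs, hsb⟩ := Metric.nhds_basis_closedBall.eventually_iff.1
    (hcb.eventually (gt_mem_nhds (show pot P m b < pot P m a - δ by rw [hδ]; linarith)))
  have hsa : s < dist a b := by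
    by_contra! hle
    have := hsb (Metric.mem_closedBall.2 hle)
    linarith
  have haR : dist a b < r / 2 := by rw [dist_comm]; linarith
  have hgpos : 0 < δ * s ^ 2 := by positivity
  set u : E3 → ℝ := fun x => pot P m x + δ * s ^ 2 * (‖x - b‖ ^ 2)⁻¹ with hu
  have hcd : ∀ x, dist x b ≤ r / 2 → x ≠ b → ContDiffAt ℝ 2 u x := fun x hx hxb =>
    (contDiffAt_pot (hsub x hx).2).add (contDiffAt_const.mul (contDiffAt_inv_sq hxb))
  have hK : IsCompact (Metric.closedBall b (r / 2) \ Metric.ball b s) :=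
    (isCompact_closedBall b _).diff Metric.isOpen_ball
  have hne' : ∀ x, s ≤ dist x b → x ≠ b := fun x hx h0 => by
    rw [h0, dist_self] at hx; linarith
  obtain ⟨x, hx, hmax⟩ := hK.exists_isMaxOn
    ⟨a, Metric.mem_closedBall.2 haR.le, fun h0 => absurd (Metric.mem_ball.1 h0) (not_lt.2 hsa.le)⟩
    (f := u) (fun x hx => (hcd x (Metric.mem_closedBall.1 hx.1)
      (hne' x (not_lt.1 fun h0 => hx.2 (Metric.mem_ball.2 h0)))).continuousAt.continuousWithinAt)
  have hxR : dist x b ≤ r / 2 := Metric.mem_closedBall.1 hx.1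
  have hxs : s ≤ dist x b := not_lt.1 fun h0 => hx.2 (Metric.mem_ball.2 h0)
  have hua : u a ≤ u x :=
    hmax ⟨Metric.mem_closedBall.2 haR.le, fun h0 => absurd (Metric.mem_ball.1 h0) (not_lt.2 hsa.le)⟩
  have hinv : ∀ y : E3, (‖y - b‖ ^ 2)⁻¹ = (dist y b ^ 2)⁻¹ := fun y => by rw [dist_eq_norm]
  simp only [hu, hinv] at hua
  rcases hxs.eq_or_lt with h1 | h1
  · -- on the inner sphere the potential is below its value at `a` by at least `δ`
    have h2 := hsb (Metric.mem_closedBall.2 h1.symm.le)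
    rw [← h1, mul_assoc δ (s ^ 2) (s ^ 2)⁻¹, mul_inv_cancel₀ (by positivity), mul_one] at hua
    have : 0 < δ * s ^ 2 * (dist a b ^ 2)⁻¹ := mul_pos hgpos (by
      have : 0 < dist a b := hs.trans hsa
      positivity)
    linarith
  rcases hxR.eq_or_lt with h2 | h2
  · -- on the outer sphere the barrier is smaller than at `a`
    have h3 := (hsub x hxR).1
    have h4 : (dist x b ^ 2)⁻¹ < (dist a b ^ 2)⁻¹ := by
      have h5 : 0 < dist a b := hs.trans hsa
      rw [h2]
      gcongr
    have h6 := mul_lt_mul_of_pos_left h4 hgpos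
    linarith
  · -- in the interior the sum is strictly subharmonic
    have hloc : IsLocalMax u x := by
      have ho : IsOpen {y | s < dist y b ∧ dist y b < r / 2} :=
        (isOpen_lt continuous_const (continuous_id.dist continuous_const)).inter
          (isOpen_lt (continuous_id.dist continuous_const) continuous_const)
      filter_upwards [ho.eventually_mem (show s < dist x b ∧ dist x b < r / 2 from ⟨h1, h2⟩)]
        with y hy
      exact hmax ⟨Metric.mem_closedBall.2 hy.2.le, fun h0 =>
        absurd (Metric.mem_ball.1 h0) (not_lt.2 hy.1.le)⟩
    have hxb := hne' x hxs
    have h3 := laplacian3_nonpos_of_isLocalMax (hcd x hxR hxb) hloc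
    have h4 := laplacian3_inv_sq_pos (sub_ne_zero.2 hxb)
    rw [hu, laplacian3_add (contDiffAt_pot (hsub x hxR).2)
      (contDiffAt_const.mul (contDiffAt_inv_sq hxb)), laplacian3_pot (hsub x hxR).2,
      laplacian3_const_mul _ (contDiffAt_inv_sq hxb),
      laplacian3_comp_sub (fun y : E3 => (‖y‖ ^ 2)⁻¹)] at h3
    have := mul_pos hgpos h4
    linarith

/-- The strong maximum principle for the potential: it has no local maxima off the charges. -/
lemma not_isLocalMax_pot [Nonempty ι] {a : E3} (ha : ∀ j, a ≠ P j) : ¬ IsLocalMax (pot P m) a := by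
  intro h
  have h1 := eventually_eq_of_isLocalMax ha h
  have hfin : (Set.range P).Finite := Set.finite_range P
  have hmem : ∀ {x : E3}, x ∈ (Set.range P)ᶜ → ∀ j, x ≠ P j := fun hx j h0 => hx ⟨j, h0.symm⟩
  -- by analytic continuation the potential would be constant off the charges
  have hconn : IsPreconnected (Set.range P)ᶜ :=
    (hfin.countable.isConnected_compl_of_one_lt_rank (by
      rw [← Module.finrank_eq_rank]; simp)).isPreconnected
  have hanal : AnalyticOnNhd ℝ (pot P m) (Set.range P)ᶜ := fun x hx =>
    (contDiffAt_pot (n := ω) (hmem hx)).analyticAt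
  have h2 := hanal.eqOn_of_preconnected_of_eventuallyEq analyticOnNhd_const hconn
    (z₀ := a) (fun ⟨j, hj⟩ => ha j hj.symm) h1
  -- but it is unbounded near each of them
  obtain ⟨j⟩ := ‹Nonempty ι›
  have h3 : ∀ᶠ x in 𝓝[≠] (P j), x ∈ (Set.range P)ᶜ := by
    have h4 : (Set.range P \ {P j})ᶜ ∈ 𝓝 (P j) :=
      (hfin.subset Set.sdiff_subset).isClosed.isOpen_compl.mem_nhds fun h0 => h0.2 rfl
    filter_upwards [nhdsWithin_le_nhds h4, self_mem_nhdsWithin] with x hx hx' hx''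
    exact hx ⟨hx'', hx'⟩
  have h5 : Filter.Tendsto (fun x : E3 => newton (x - P j)) (𝓝[≠] (P j)) Filter.atTop := by
    have h6 : Filter.Tendsto (fun x : E3 => 2 * ‖x - P j‖) (𝓝[≠] (P j)) (𝓝[>] 0) := by
      refine tendsto_nhdsWithin_iff.2 ⟨?_, ?_⟩
      · have : Continuous fun x : E3 => 2 * ‖x - P j‖ := by fun_prop
        have h7 := this.tendsto (P j)
        rw [sub_self, norm_zero, mul_zero] at h7
        exact h7.mono_left nhdsWithin_le_nhds
      · filter_upwards [self_mem_nhdsWithin] with x hx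
        have : 0 < ‖x - P j‖ := norm_pos_iff.2 (sub_ne_zero.2 hx)
        exact mul_pos two_pos this
    refine (tendsto_inv_nhdsGT_zero.comp h6).congr fun x => ?_
    rw [newton, one_div]; rfl
  obtain ⟨x, hx, hx'⟩ := (h3.and (h5.eventually_gt_atTop (pot P m a - m))).exists
  have h6 : pot P m x = pot P m a := h2 hx
  have h7 : newton (x - P j) ≤ ∑ j, newton (x - P j) :=
    Finset.single_le_sum (fun j _ => newton_nonneg (x - P j)) (Finset.mem_univ j)
  rw [pot] at h6
  linarith

end Hessian


/-! ### Vertex sets of Platonic solids -/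

section PlatonicVertices

/-- The half-turn around the `k`-th coordinate axis. -/
noncomputable def halfTurn (k : Fin 3) (x : E3) : E3 :=
  WithLp.toLp 2 fun j => if j = k then x j else -x j

/-- The cyclic permutation of the coordinate axes. -/
noncomputable def cycPerm (x : E3) : E3 := WithLp.toLp 2 fun j => x (j + 1)

@[simp] lemma halfTurn_apply (k : Fin 3) (x : E3) (j : Fin 3) :
    halfTurn k x j = if j = k then x j else -x j := rfl

@[simp] lemma cycPerm_apply (x : E3) (j : Fin 3) : cycPerm x j = x (j + 1) := rfl

lemma halfTurn_halfTurn (k : Fin 3) (x : E3) : halfTurn k (halfTurn k x) = x := by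
  ext j; simp only [halfTurn_apply]; split_ifs <;> simp

lemma cycPerm_cycPerm_cycPerm (x : E3) : cycPerm (cycPerm (cycPerm x)) = x := by
  ext j; exact congrArg x.ofLp (by fin_cases j <;> rfl : j + 1 + 1 + 1 = j)

lemma abs_halfTurn (k : Fin 3) (x : E3) (j : Fin 3) : |halfTurn k x j| = |x j| := by
  rw [halfTurn_apply]; split_ifs <;> simp

/-- Sets of points of norm `R` that are invariant under the rotations of the tetrahedron. -/
structure IsTetrahedral (R : ℝ) (V : Set E3) : Prop where
  halfTurn_mem : ∀ k, ∀ v ∈ V, halfTurn k v ∈ V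
  cycPerm_mem : ∀ v ∈ V, cycPerm v ∈ V
  norm_eq : ∀ v ∈ V, ‖v‖ = R

lemma norm_eq_sqrt {v : E3} {c : ℝ} (h : v 0 ^ 2 + v 1 ^ 2 + v 2 ^ 2 = c) : ‖v‖ = √c := by
  rw [← h, ← norm_sq_E3, Real.sqrt_sq (norm_nonneg v)]

/-- The vertices of three mutually orthogonal rectangles. -/
def rectangles (α β : ℝ) : Set E3 := {x | ∃ i : Fin 3, x i = 0 ∧ |x (i + 1)| = α ∧ |x (i + 2)| = β}

lemma isTetrahedral_rectangles (α β : ℝ) : IsTetrahedral (√(α ^ 2 + β ^ 2)) (rectangles α β) where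
  halfTurn_mem := by
    rintro k v ⟨i, h0, h1, h2⟩
    refine ⟨i, ?_, by rw [abs_halfTurn, h1], by rw [abs_halfTurn, h2]⟩
    rw [halfTurn_apply, h0]; simp
  cycPerm_mem := by
    rintro v ⟨i, h0, h1, h2⟩
    refine ⟨i + 2, ?_, ?_, ?_⟩
    · rw [cycPerm_apply, ← h0]; exact congrArg v.ofLp (by fin_cases i <;> rfl)
    · rw [cycPerm_apply, ← h1]; exact congrArg (fun i => |v.ofLp i|) (by fin_cases i <;> rfl)
    · rw [cycPerm_apply, ← h2]; exact congrArg (fun i => |v.ofLp i|) (by fin_cases i <;> rfl)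
  norm_eq := by
    rintro v ⟨i, h0, h1, h2⟩
    apply norm_eq_sqrt
    rw [← h1, ← h2, sq_abs, sq_abs]
    fin_cases i
    · simpa using h0
    · simp at h0 ⊢; rw [h0]; ring
    · simpa using h0

/-- The vertices of the cube. -/
def cubeVertices : Set E3 := {x | ∀ i, |x i| = 1}

lemma norm_of_mem_cube {v : E3} (h : ∀ i, |v i| = 1) : ‖v‖ = √3 := by
  apply norm_eq_sqrt
  rw [← sq_abs, h, ← sq_abs (v 1), h, ← sq_abs (v 2), h]; norm_num

lemma isTetrahedral_cube : IsTetrahedral √3 cubeVertices where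
  halfTurn_mem k v hv i := by rw [abs_halfTurn, hv i]
  cycPerm_mem v hv i := hv (i + 1)
  norm_eq v hv := norm_of_mem_cube hv

lemma golden_sq_add : Real.goldenRatio⁻¹ ^ 2 + Real.goldenRatio ^ 2 = 3 := by
  have h := Real.goldenRatio_sq
  have h1 : Real.goldenRatio⁻¹ = Real.goldenRatio - 1 :=
    inv_eq_of_mul_eq_one_right (by linear_combination h)
  rw [h1]; linear_combination 2 * h

namespace PlatonicSolid

/-- The circumradius of the standard copy. -/
noncomputable def radius : PlatonicSolid → ℝ
  | tetrahedron => √3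
  | octahedron => 1
  | cube => √3
  | icosahedron => √(1 ^ 2 + Real.goldenRatio ^ 2)
  | dodecahedron => √3

lemma radius_pos (s : PlatonicSolid) : 0 < s.radius := by
  cases s <;> simp only [radius] <;> positivity

lemma isTetrahedral_vertices (s : PlatonicSolid) : IsTetrahedral s.radius s.vertices := by
  cases s with
  | tetrahedron =>
    refine ⟨fun k v hv => ⟨fun i => ?_, ?_⟩, fun v hv => ⟨fun i => hv.1 (i + 1), ?_⟩,
      fun v hv => norm_of_mem_cube hv.1⟩
    · rw [abs_halfTurn]; exact hv.1 i
    · rw [← hv.2]; fin_cases k <;> simp [halfTurn]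
    · rw [← hv.2]; simp only [cycPerm_apply]; simp; ring
  | octahedron =>
    refine ⟨?_, ?_, ?_⟩
    · rintro k v ⟨i, s, hs, rfl⟩
      refine ⟨i, if i = k then s else -s, by split_ifs <;> simpa using hs, ?_⟩
      ext j
      by_cases hj : j = i
      · subst hj; simp
      · simp [hj]
    · rintro v ⟨i, s, hs, rfl⟩
      refine ⟨i + 2, s, hs, ?_⟩
      ext j
      fin_cases i <;> fin_cases j <;> simp
    · rintro v ⟨i, s, hs, rfl⟩
      simpa [radius] using hs
  | cube => exact isTetrahedral_cube
  | icosahedron => exact isTetrahedral_rectangles _ _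
  | dodecahedron =>
    have h1 := isTetrahedral_cube
    have h2 := isTetrahedral_rectangles Real.goldenRatio⁻¹ Real.goldenRatio
    rw [golden_sq_add] at h2
    exact ⟨fun k v hv => hv.imp (h1.halfTurn_mem k v) (h2.halfTurn_mem k v),
      fun v hv => hv.imp (h1.cycPerm_mem v) (h2.cycPerm_mem v),
      fun v hv => hv.elim (h1.norm_eq v) (h2.norm_eq v)⟩

end PlatonicSolid

/-- Finite sets of points of norm `R` whose first and second moments are those of the sphere
(spherical designs of strength two). -/
structure IsDesign (R : ℝ) (F : Finset E3) : Prop where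
  norm_eq : ∀ v ∈ F, ‖v‖ = R
  sum_inner : ∀ u : E3, ∑ v ∈ F, inner ℝ v u = 0
  sum_inner_mul : ∀ u w : E3,
    ∑ v ∈ F, inner ℝ v u * inner ℝ v w = F.card * R ^ 2 / 3 * inner ℝ u w

/-- Tetrahedral symmetry makes the first moments and the mixed second moments vanish (half-turns)
and the remaining second moments equal (the cyclic permutation of the coordinates). -/
lemma IsTetrahedral.isDesign {R : ℝ} {F : Finset E3} (h : IsTetrahedral R (F : Set E3)) :
    IsDesign R F := by
  have hflip : ∀ (k : Fin 3) (f : E3 → ℝ), ∑ v ∈ F, f (halfTurn k v) = ∑ v ∈ F, f v := fun k f =>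
    Finset.sum_nbij' (halfTurn k) (halfTurn k) (fun v hv => h.halfTurn_mem k v hv)
      (fun v hv => h.halfTurn_mem k v hv) (fun v _ => halfTurn_halfTurn k v)
      (fun v _ => halfTurn_halfTurn k v) (fun _ _ => rfl)
  have hcyc : ∀ f : E3 → ℝ, ∑ v ∈ F, f (cycPerm v) = ∑ v ∈ F, f v := fun f =>
    Finset.sum_nbij' cycPerm (fun v => cycPerm (cycPerm v)) (fun v hv => h.cycPerm_mem v hv)
      (fun v hv => h.cycPerm_mem _ (h.cycPerm_mem v hv)) (fun v _ => cycPerm_cycPerm_cycPerm v)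
      (fun v _ => cycPerm_cycPerm_cycPerm v) (fun _ _ => rfl)
  have h1 : ∀ i, ∑ v ∈ F, v i = 0 := by
    intro i
    have := hflip (i + 1) fun v => v i
    have hne : i ≠ i + 1 := by fin_cases i <;> decide
    simp only [halfTurn_apply, if_neg hne, Finset.sum_neg_distrib] at this
    linarith
  have h2 : ∀ i j, i ≠ j → ∑ v ∈ F, v i * v j = 0 := by
    intro i j hij
    have := hflip i fun v => v i * v j
    simp only [halfTurn_apply, if_neg hij.symm, if_true, mul_neg, Finset.sum_neg_distrib] at this
    linarith
  have h3 : ∀ i, ∑ v ∈ F, v (i + 1) * v (i + 1) = ∑ v ∈ F, v i * v i := fun i =>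
    hcyc fun v => v i * v i
  have h4 : ∑ v ∈ F, v 0 * v 0 + ∑ v ∈ F, v 1 * v 1 + ∑ v ∈ F, v 2 * v 2 = F.card * R ^ 2 := by
    rw [← Finset.sum_add_distrib, ← Finset.sum_add_distrib, Finset.sum_congr rfl fun v hv => ?_,
      Finset.sum_const, nsmul_eq_mul]
    rw [← h.norm_eq v hv, norm_sq_E3]; ring
  have h5 : ∑ v ∈ F, v 1 * v 1 = ∑ v ∈ F, v 0 * v 0 := h3 0
  have h6 : ∑ v ∈ F, v 2 * v 2 = ∑ v ∈ F, v 1 * v 1 := h3 1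
  refine ⟨h.norm_eq, fun u => ?_, fun u w => ?_⟩
  · simp only [inner_E3, Finset.sum_add_distrib, ← Finset.sum_mul, h1, zero_mul, add_zero]
  · have e : ∀ v : E3, inner ℝ v u * inner ℝ v w =
        v 0 * v 0 * (u 0 * w 0) + v 1 * v 1 * (u 1 * w 1) + v 2 * v 2 * (u 2 * w 2) +
        v 0 * v 1 * (u 0 * w 1 + u 1 * w 0) + v 0 * v 2 * (u 0 * w 2 + u 2 * w 0) +
        v 1 * v 2 * (u 1 * w 2 + u 2 * w 1) := fun v => by rw [inner_E3, inner_E3]; ring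
    simp only [e, Finset.sum_add_distrib, ← Finset.sum_mul]
    rw [h2 0 1 (by decide), h2 0 2 (by decide), h2 1 2 (by decide), inner_E3]
    have h7 : ∑ v ∈ F, v 0 * v 0 = F.card * R ^ 2 / 3 := by linarith
    rw [h6, h5, h7]; ring

/-- The potential of a concentric design is constant to second order at the centre. -/
lemma IsDesign.sum_fderiv_newton {R r : ℝ} {F : Finset E3} (h : IsDesign R F) (hR : 0 < R)
    (hr : 0 < r) (A : E3 ≃ₗᵢ[ℝ] E3) (u : E3) :
    ∑ v ∈ F, fderiv ℝ newton (-(r • A v)) u = 0 := by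
  have e : ∀ v ∈ F, fderiv ℝ newton (-(r • A v)) u =
      r / (2 * (r * R) ^ 3) * inner ℝ v (A.symm u) := by
    intro v hv
    have hn : ‖-(r • A v)‖ = r * R := by
      rw [norm_neg, norm_smul, A.norm_map, h.norm_eq v hv, Real.norm_of_nonneg hr.le]
    have h0 : -(r • A v) ≠ 0 := norm_ne_zero_iff.1 (by rw [hn]; positivity)
    have hi : inner ℝ (A v) u = inner ℝ v (A.symm u) := by
      rw [← A.inner_map_map v (A.symm u), A.apply_symm_apply]
    rw [fderiv_newton h0, hn, inner_neg_left, real_inner_smul_left, hi]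
    ring
  rw [Finset.sum_congr rfl e, ← Finset.mul_sum, h.sum_inner, mul_zero]

lemma IsDesign.sum_fderiv_fderiv_newton {R r : ℝ} {F : Finset E3} (h : IsDesign R F) (hR : 0 < R)
    (hr : 0 < r) (A : E3 ≃ₗᵢ[ℝ] E3) (u w : E3) :
    ∑ v ∈ F, fderiv ℝ (fderiv ℝ newton) (-(r • A v)) u w = 0 := by
  have e : ∀ v ∈ F, fderiv ℝ (fderiv ℝ newton) (-(r • A v)) u w =
      -1 / (2 * (r * R) ^ 3) * inner ℝ u w + 3 * r ^ 2 / (2 * (r * R) ^ 5) *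
        (inner ℝ v (A.symm u) * inner ℝ v (A.symm w)) := by
    intro v hv
    have hn : ‖-(r • A v)‖ = r * R := by
      rw [norm_neg, norm_smul, A.norm_map, h.norm_eq v hv, Real.norm_of_nonneg hr.le]
    have h0 : -(r • A v) ≠ 0 := norm_ne_zero_iff.1 (by rw [hn]; positivity)
    have hi : ∀ u, inner ℝ (A v) u = inner ℝ v (A.symm u) := fun u => by
      rw [← A.inner_map_map v (A.symm u), A.apply_symm_apply]
    rw [fderiv_fderiv_newton h0, hn, inner_neg_left, inner_neg_left, real_inner_smul_left,
      real_inner_smul_left, hi, hi]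
    ring
  rw [Finset.sum_congr rfl e, Finset.sum_add_distrib, ← Finset.mul_sum _ _ (3 * r ^ 2 / _),
    h.sum_inner_mul, Finset.sum_const, nsmul_eq_mul, A.symm.inner_map_map]
  field_simp
  ring

end PlatonicVertices


/-! ### Concentric Platonic solids with a given number of vertices -/

section PlatonicSums

/-- The sign `±1`. -/
def sgn (b : Bool) : ℝ := bif b then 1 else -1

lemma abs_sgn (b : Bool) : |sgn b| = 1 := by cases b <;> simp [sgn]

lemma sgn_ne_zero (b : Bool) : sgn b ≠ 0 := by cases b <;> simp [sgn]

lemma sgn_injective : Function.Injective sgn := by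
  intro a b h
  cases a <;> cases b <;> simp [sgn] at h ⊢ <;> norm_num at h

lemma exists_sgn_mul {x c : ℝ} (h : |x| = c) : ∃ b, x = sgn b * c := by
  rcases abs_choice x with h1 | h1
  · exact ⟨true, by rw [← h, h1]; simp [sgn]⟩
  · exact ⟨false, by rw [← h, h1]; simp [sgn]⟩

lemma exists_sgn {x : ℝ} (h : |x| = 1) : ∃ b, x = sgn b := by simpa using exists_sgn_mul h

/-- The point with coordinates `a, b, c`, counted cyclically from the `i`-th one. -/
noncomputable def cycVec (i : Fin 3) (a b c : ℝ) : E3 :=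
  WithLp.toLp 2 fun j => if j = i then a else if j = i + 1 then b else c

lemma cycVec_apply (i : Fin 3) (a b c : ℝ) :
    cycVec i a b c i = a ∧ cycVec i a b c (i + 1) = b ∧ cycVec i a b c (i + 2) = c := by
  fin_cases i <;> simp [cycVec]

lemma eq_cycVec (i : Fin 3) (x : E3) : x = cycVec i (x i) (x (i + 1)) (x (i + 2)) := by
  fin_cases i <;> apply E3_ext <;> simp [cycVec]

/-- The vertices of the cube, as a finite family. -/
lemma cubeVertices_eq : cubeVertices =
    Set.range fun s : Bool × Bool × Bool => cycVec 0 (sgn s.1) (sgn s.2.1) (sgn s.2.2) := by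
  ext x
  constructor
  · intro h
    obtain ⟨a, ha⟩ := exists_sgn (h 0)
    obtain ⟨b, hb⟩ := exists_sgn (h 1)
    obtain ⟨c, hc⟩ := exists_sgn (h 2)
    exact ⟨(a, b, c), by rw [eq_cycVec 0 x, ha]; simp [hb, hc]⟩
  · rintro ⟨s, rfl⟩ i
    fin_cases i <;> simp [cycVec, abs_sgn]

lemma ncard_range {α : Type*} [Fintype α] {β : Type*} {f : α → β} (hf : Function.Injective f) :
    (Set.range f).Finite ∧ (Set.range f).ncard = Fintype.card α := by
  refine ⟨Set.finite_range f, ?_⟩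
  rw [← Set.image_univ, Set.ncard_image_of_injective _ hf, Set.ncard_univ,
    Nat.card_eq_fintype_card]

lemma cubeVertices_card : cubeVertices.Finite ∧ cubeVertices.ncard = 8 := by
  rw [cubeVertices_eq]
  refine ncard_range fun s t h => ?_
  have h0 := congrArg (fun x : E3 => x 0) h
  have h1 := congrArg (fun x : E3 => x 1) h
  have h2 := congrArg (fun x : E3 => x 2) h
  simp [cycVec] at h0 h1 h2
  exact Prod.ext (sgn_injective h0) (Prod.ext (sgn_injective h1) (sgn_injective h2))

lemma rectangles_card {α β : ℝ} (hα : 0 < α) (hβ : 0 < β) :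
    (rectangles α β).Finite ∧ (rectangles α β).ncard = 12 := by
  have h : rectangles α β = Set.range fun s : Fin 3 × Bool × Bool =>
      cycVec s.1 0 (sgn s.2.1 * α) (sgn s.2.2 * β) := by
    ext x
    constructor
    · rintro ⟨i, h0, h1, h2⟩
      obtain ⟨a, ha⟩ := exists_sgn_mul h1
      obtain ⟨b, hb⟩ := exists_sgn_mul h2
      exact ⟨(i, a, b), by rw [eq_cycVec i x, h0, ha, hb]⟩
    · rintro ⟨⟨i, a, b⟩, rfl⟩
      obtain ⟨h0, h1, h2⟩ := cycVec_apply i 0 (sgn a * α) (sgn b * β)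
      exact ⟨i, h0, by rw [h1, abs_mul, abs_sgn, one_mul, abs_of_pos hα],
        by rw [h2, abs_mul, abs_sgn, one_mul, abs_of_pos hβ]⟩
  rw [h]
  refine ncard_range fun s t hst => ?_
  obtain ⟨i, a, b⟩ := s
  obtain ⟨j, a', b'⟩ := t
  simp only at hst
  obtain ⟨h0, h1, h2⟩ := cycVec_apply i 0 (sgn a * α) (sgn b * β)
  obtain ⟨h0', h1', h2'⟩ := cycVec_apply j 0 (sgn a' * α) (sgn b' * β)
  have hij : i = j := by
    rw [hst] at h0
    have hj1 : cycVec j 0 (sgn a' * α) (sgn b' * β) (j + 1) ≠ 0 := by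
      rw [h1']; exact mul_ne_zero (sgn_ne_zero _) hα.ne'
    have hj2 : cycVec j 0 (sgn a' * α) (sgn b' * β) (j + 2) ≠ 0 := by
      rw [h2']; exact mul_ne_zero (sgn_ne_zero _) hβ.ne'
    have : ∀ i j : Fin 3, i ≠ j → i = j + 1 ∨ i = j + 2 := by decide
    by_contra hne
    rcases this i j hne with rfl | rfl
    · exact hj1 h0
    · exact hj2 h0
  subst hij
  rw [hst, h1'] at h1
  rw [hst, h2'] at h2
  rw [sgn_injective (mul_right_cancel₀ hα.ne' h1), sgn_injective (mul_right_cancel₀ hβ.ne' h2)]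

namespace PlatonicSolid

/-- The number of vertices. -/
def numVertices : PlatonicSolid → ℕ
  | tetrahedron => 4
  | octahedron => 6
  | cube => 8
  | icosahedron => 12
  | dodecahedron => 20

lemma vertices_card (s : PlatonicSolid) : s.vertices.Finite ∧ s.vertices.ncard = s.numVertices := by
  have hφ := Real.goldenRatio_pos
  cases s with
  | tetrahedron =>
    have h : vertices tetrahedron =
        Set.range fun s : Bool × Bool => cycVec 0 (sgn s.1) (sgn s.2) (sgn s.1 * sgn s.2) := by
      have hs : ∀ b, sgn b * sgn b = 1 := fun b => by cases b <;> simp [sgn]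
      ext x
      constructor
      · rintro ⟨h, h3⟩
        obtain ⟨a, ha⟩ := exists_sgn (h 0)
        obtain ⟨b, hb⟩ := exists_sgn (h 1)
        refine ⟨(a, b), ?_⟩
        rw [ha, hb] at h3
        have h4 : x 2 = sgn a * sgn b := by
          linear_combination (sgn a * sgn b) * h3 - x 2 * hs a * (sgn b * sgn b) - x 2 * hs b
        rw [eq_cycVec 0 x, ha]; simp [hb, h4]
      · rintro ⟨s, rfl⟩
        refine ⟨fun i => by fin_cases i <;> simp [cycVec, abs_sgn], ?_⟩
        have : cycVec 0 (sgn s.1) (sgn s.2) (sgn s.1 * sgn s.2) 0 *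
          cycVec 0 (sgn s.1) (sgn s.2) (sgn s.1 * sgn s.2) 1 *
          cycVec 0 (sgn s.1) (sgn s.2) (sgn s.1 * sgn s.2) 2 =
          sgn s.1 * sgn s.2 * (sgn s.1 * sgn s.2) := by simp [cycVec]
        refine this.trans ?_
        linear_combination sgn s.2 * sgn s.2 * hs s.1 + hs s.2
    rw [h]
    refine ncard_range fun s t h => ?_
    have h0 := congrArg (fun x : E3 => x 0) h
    have h1 := congrArg (fun x : E3 => x 1) h
    simp [cycVec] at h0 h1
    exact Prod.ext (sgn_injective h0) (sgn_injective h1)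
  | octahedron =>
    have h : vertices octahedron = Set.range fun s : Fin 3 × Bool =>
        (EuclideanSpace.single s.1 (sgn s.2) : E3) := by
      ext x
      constructor
      · rintro ⟨i, s, hs, rfl⟩
        obtain ⟨b, rfl⟩ := exists_sgn hs
        exact ⟨(i, b), rfl⟩
      · rintro ⟨⟨i, b⟩, rfl⟩
        exact ⟨i, sgn b, abs_sgn b, rfl⟩
    rw [h]
    refine ncard_range fun s t h => ?_
    have h0 := congrArg (fun x : E3 => x s.1) h
    simp only [PiLp.single_apply, if_true] at h0
    by_cases hst : s.1 = t.1
    · rw [if_pos hst] at h0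
      exact Prod.ext hst (sgn_injective h0)
    · rw [if_neg hst] at h0
      exact absurd h0 (sgn_ne_zero _)
  | cube => exact cubeVertices_card
  | icosahedron => exact rectangles_card one_pos hφ
  | dodecahedron =>
    have h1 := cubeVertices_card
    have h2 := rectangles_card (inv_pos.2 hφ) hφ
    have hd : Disjoint cubeVertices (rectangles Real.goldenRatio⁻¹ Real.goldenRatio) := by
      refine Set.disjoint_left.2 ?_
      rintro x hx ⟨i, h0, -⟩
      have := hx i
      rw [h0] at this
      simp at this
    have h : vertices dodecahedron =
        cubeVertices ∪ rectangles Real.goldenRatio⁻¹ Real.goldenRatio := rfl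
    rw [h]
    exact ⟨h1.1.union h2.1, by rw [Set.ncard_union_eq hd h1.1 h2.1, h1.2, h2.2]; rfl⟩

lemma exists_numVertices {a : ℕ} (h : a ∈ ({4, 6, 8, 12, 20} : Set ℕ)) :
    ∃ s : PlatonicSolid, s.numVertices = a := by
  rcases h with rfl | rfl | rfl | rfl | rfl
  exacts [⟨tetrahedron, rfl⟩, ⟨octahedron, rfl⟩, ⟨cube, rfl⟩, ⟨icosahedron, rfl⟩,
    ⟨dodecahedron, rfl⟩]

end PlatonicSolid

lemma infinite_isPlatonicSum : {k : ℕ | IsPlatonicSum (k + 1)}.Infinite := by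
  refine Set.infinite_of_injective_forall_mem (f := fun n : ℕ => 4 * n + 3)
    (fun a b h => by simpa using h) fun n => ?_
  refine ⟨⟨Multiset.replicate (n + 1) 4, fun {i} hi => ?_, ?_⟩, fun a ha => ?_⟩
  · rw [Multiset.eq_of_mem_replicate hi]; norm_num
  · rw [Multiset.sum_replicate, smul_eq_mul]; ring
  · rw [Multiset.eq_of_mem_replicate ha]; simp

/-- Platonic solids with distinct circumradii realize every sum of numbers of vertices. -/
lemma exists_isConcentricPlatonic {k : ℕ} (h : IsPlatonicSum (k + 1)) :
    ∃ (c : E3) (S : Finset E3), IsConcentricPlatonic c S ∧ S.card = k + 1 := by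
  classical
  obtain ⟨Q, hQ⟩ := h
  set l := Q.parts.toList with hl
  have hsum : l.sum = k + 1 := by
    rw [← Q.parts_sum, hl, Multiset.sum_toList]
  choose s hs using fun i : Fin l.length => PlatonicSolid.exists_numVertices
    (hQ (l.get i) (Multiset.mem_toList.1 (List.get_mem l i)))
  have hr : ∀ i : Fin l.length, 0 < ((i : ℕ) + 1 : ℝ) / (s i).radius := fun i =>
    div_pos (by positivity) (s i).radius_pos
  let f : ∀ i : Fin l.length, E3 → E3 := fun i v =>
    0 + (((i : ℕ) + 1 : ℝ) / (s i).radius) • LinearIsometryEquiv.refl ℝ E3 v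
  have hf : ∀ i, Function.Injective (f i) := fun i v w hvw => by
    have h1 : (((i : ℕ) + 1 : ℝ) / (s i).radius) • v = (((i : ℕ) + 1 : ℝ) / (s i).radius) • w := by
      simpa [f] using hvw
    exact smul_right_injective E3 (hr i).ne' h1
  let T : Fin l.length → Set E3 := fun i => f i '' (s i).vertices
  have hT : ∀ i, (T i).Finite := fun i => (s i).vertices_card.1.image _
  have hnorm : ∀ i, ∀ x ∈ T i, ‖x‖ = (i : ℕ) + 1 := by
    rintro i _ ⟨v, hv, rfl⟩
    have h1 : f i v = (((i : ℕ) + 1 : ℝ) / (s i).radius) • v := by simp [f]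
    rw [h1, norm_smul, Real.norm_of_nonneg (hr i).le, (s i).isTetrahedral_vertices.norm_eq v hv,
      div_mul_cancel₀ _ (s i).radius_pos.ne']
  have hdisj : Pairwise fun i j => Disjoint (T i) (T j) := fun i j hij =>
    Set.disjoint_left.2 fun x hx hx' => hij (by
      have := (hnorm i x hx).symm.trans (hnorm j x hx')
      exact Fin.ext (by exact_mod_cast add_right_cancel this))
  refine ⟨0, Finset.univ.biUnion fun i => (hT i).toFinset, ⟨l.length, T, ?_, ?_, hdisj, ?_⟩, ?_⟩
  · rw [List.length_pos_iff]
    rintro h0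
    rw [h0] at hsum; simp at hsum
  · exact fun i => ⟨s i, _, LinearIsometryEquiv.refl ℝ E3, hr i, rfl⟩
  · ext x; simp
  · rw [Finset.card_biUnion fun i _ j _ hij => by
      simpa [Set.Finite.disjoint_toFinset] using hdisj hij]
    have hc : ∀ i, (hT i).toFinset.card = l.get i := fun i => by
      rw [← Set.ncard_eq_toFinset_card _ (hT i), Set.ncard_image_of_injective _ (hf i),
        (s i).vertices_card.2, hs]
    simp only [hc]
    rw [← hsum]
    simp [Fin.sum_univ_getElem]

/-- The potential of concentric Platonic solids is constant to second order at the centre. -/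
lemma IsConcentricPlatonic.sum_newton {c : E3} {S : Finset E3} (h : IsConcentricPlatonic c S) :
    c ∉ S ∧ (∀ u, ∑ p ∈ S, fderiv ℝ newton (c - p) u = 0) ∧
      ∀ u w, ∑ p ∈ S, fderiv ℝ (fderiv ℝ newton) (c - p) u w = 0 := by
  classical
  obtain ⟨n, T, -, hT, hdisj, hS⟩ := h
  choose s r A hr hTe using hT
  have hf : ∀ i, Function.Injective fun v => c + r i • A i v := fun i v w hvw => by
    have h1 := smul_right_injective E3 (hr i).ne' (add_left_cancel hvw)
    exact (A i).injective h1
  let F : Fin n → Finset E3 := fun i => (s i).vertices_card.1.toFinset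
  have hF : ∀ i, IsDesign (s i).radius (F i) := fun i => by
    apply IsTetrahedral.isDesign
    rw [Set.Finite.coe_toFinset]
    exact (s i).isTetrahedral_vertices
  have hFT : ∀ i, T i = (((F i).image fun v => c + r i • A i v : Finset E3) : Set E3) := fun i => by
    rw [hTe, Finset.coe_image, Set.Finite.coe_toFinset]
  have hSe : S = Finset.univ.biUnion fun i => (F i).image fun v => c + r i • A i v := by
    rw [← Finset.coe_inj, hS]
    simp [hFT]
  have hsum : ∀ f : E3 → ℝ, ∑ p ∈ S, f (c - p) = ∑ i, ∑ v ∈ F i, f (-(r i • A i v)) := by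
    intro f
    rw [hSe, Finset.sum_biUnion fun i _ j _ hij => by
      have : Disjoint (T i) (T j) := hdisj hij
      rw [hFT, hFT, Finset.disjoint_coe] at this
      exact this]
    refine Finset.sum_congr rfl fun i _ => ?_
    rw [Finset.sum_image fun v _ w _ hvw => hf i hvw]
    refine Finset.sum_congr rfl fun v _ => ?_
    congr 1; abel
  refine ⟨fun hc => ?_, fun u => ?_, fun u w => ?_⟩
  · have hc' : c ∈ (S : Set E3) := hc
    rw [hS] at hc'
    obtain ⟨i, hi⟩ := Set.mem_iUnion.1 hc'
    rw [hTe] at hi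
    obtain ⟨v, hv, hvc⟩ := hi
    have h1 : r i • A i v = 0 := by simpa using hvc
    have h2 : v = 0 := (A i).map_eq_zero_iff.1 ((smul_eq_zero.1 h1).resolve_left (hr i).ne')
    have h3 := (s i).isTetrahedral_vertices.norm_eq v hv
    rw [h2, norm_zero] at h3
    exact (s i).radius_pos.ne h3
  · rw [hsum fun x => fderiv ℝ newton x u]
    exact Finset.sum_eq_zero fun i _ =>
      (hF i).sum_fderiv_newton (s i).radius_pos (hr i) (A i) u
  · rw [hsum fun x => fderiv ℝ (fderiv ℝ newton) x u w]
    exact Finset.sum_eq_zero fun i _ =>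
      (hF i).sum_fderiv_fderiv_newton (s i).radius_pos (hr i) (A i) u w

end PlatonicSums


/-! ### The fibre over the common centre -/

theorem theorem1p5 :
    {k : ℕ | IsPlatonicSum (k + 1)}.Infinite ∧
    ∀ k : ℕ, IsPlatonicSum (k + 1) →
      (∃ (c : E3) (S : Finset E3), IsConcentricPlatonic c S ∧ S.card = k + 1) ∧
      ∀ (c : E3) (S : Finset E3), IsConcentricPlatonic c S → S.card = k + 1 →
        ∀ m : ℝ, 0 ≤ m →
          (ContDiffAt ℝ ∞ (potential m S) c ∧ fderiv ℝ (potential m S) c = 0 ∧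
            fderiv ℝ (fderiv ℝ (potential m S)) c = 0) ∧
          ∃ (X : Type) (_ : TopologicalSpace X) (_ : ChartedSpace E4 X) (_ : IsManifold I4 ∞ X)
            (_ : T2Space X) (_ : SecondCountableTopology X) (_ : ConnectedSpace X)
            (M : GibbonsHawking X m S) (γ : SmoothLoop X),
            M.proj (γ.toFun 0) = c ∧ (∀ t, γ.toFun t = M.rot t (γ.toFun 0)) ∧
            IsClosedGeodesic M.g γ ∧ IsStableToSecondOrder M.g γ ∧ ¬ IsStable M.g γ := by
  refine ⟨infinite_isPlatonicSum, fun k hk => ⟨exists_isConcentricPlatonic hk, ?_⟩⟩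
  intro c S hS hcard m hm
  classical
  obtain ⟨hcS, hsum1, hsum2⟩ := hS.sum_newton
  let P : S ↪ E3 := Function.Embedding.subtype _
  have hPS : Finset.univ.map P = S := Finset.attach_map_val
  have hpot : potential m S = pot P m := by
    rw [← potential_map]; exact congrArg (potential m) hPS.symm
  have hne : ∀ j, c ≠ P j := fun j h0 => hcS (h0 ▸ j.2)
  have hnonempty : Nonempty S := by
    obtain ⟨p, hp⟩ := Finset.card_pos.1 (hcard.symm ▸ k.succ_pos : 0 < S.card)
    exact ⟨⟨p, hp⟩⟩
  have h1 : fderiv ℝ (pot P m) c = 0 := ContinuousLinearMap.ext fun u => by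
    rw [fderiv_pot hne]
    exact (Finset.sum_coe_sort S fun p => fderiv ℝ newton (c - p) u).trans (hsum1 u)
  have h2 : fderiv ℝ (fderiv ℝ (pot P m)) c = 0 :=
    ContinuousLinearMap.ext fun u => ContinuousLinearMap.ext fun w => by
      rw [fderiv_fderiv_pot hne, sum_apply, sum_apply]
      exact (Finset.sum_coe_sort S fun p => fderiv ℝ (fderiv ℝ newton) (c - p) u w).trans
        (hsum2 u w)
  refine ⟨⟨hpot ▸ contDiffAt_pot hne, hpot ▸ h1, hpot ▸ h2⟩, ?_⟩
  obtain ⟨G⟩ := exists_flatGauge hne h1 h2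
  obtain ⟨i⟩ := id hnonempty
  obtain ⟨M, hg, hproj, hrot⟩ : ∃ M : GibbonsHawking (G.Space i) m S,
      M.g = GHSpace.metric P (G.chartChoice i) hm ∧ M.proj = GHSpace.pr ∧ M.rot = GHSpace.rot := by
    have : ∃ M : GibbonsHawking (G.Space i) m (Finset.univ.map P),
      M.g = GHSpace.metric P (G.chartChoice i) hm ∧ M.proj = GHSpace.pr ∧ M.rot = GHSpace.rot :=
      ⟨GHSpace.gibbonsHawking P (G.chartChoice i) hm, rfl, rfl, rfl⟩
    rwa [hPS] at this
  obtain ⟨y, hy⟩ := M.proj_surjective c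
  rw [hproj] at hy
  have h0 : (GHSpace.orbit y).toFun 0 = y := GHBundle.rot_zero y
  refine ⟨G.Space i, inferInstance, inferInstance, inferInstance, inferInstance, inferInstance,
    inferInstance, M, GHSpace.orbit y, ?_, fun t => ?_, ?_, ?_, ?_⟩
  · rw [h0, hproj, hy]
  · rw [h0, hrot]; rfl
  · rw [hg]; exact FlatGauge.isClosedGeodesic_orbit hm h1 h2 hy
  · rw [hg]; exact FlatGauge.isStableToSecondOrder_orbit hm h1 h2 hy
  · rw [hg]
    exact fun hs => not_isLocalMax_pot hne (FlatGauge.isLocalMax_of_isStable hm hy hs)
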